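/- **Setting.** Let $\mathbb K$ be a field and let $q\in\mathbb K^\times$ have a chosen square root $q^{1/2}\in\mathbb K$; assume $q^8\neq 1$, $q^{10}\neq 1$ and $q^{12}\neq 1$ (so in particular $q^2-1+q^{-2}\ne 0$; every $q$ that is not a root of unity qualifies). Let $H_1,H_2$ be the simple roots of $\mathfrak{sl}(3)$, with $\langle H_i,H_i\rangle=1$, $\langle H_1,H_2\rangle=-\tfrac12$, and let $P$ be the weight lattice. Let $\mathcal U=\overline U_q(\mathfrak{sl}(3))$ be the algebra with generators $E_1,E_2,F_1,F_2$ and $q^\mu$ ($\mu\in P$) and relations $q^0=1$, $q^\mu q^\nu=q^{\mu+\nu}$, $$q^\mu E_i=q^{\langle H_i,\mu\rangle}E_iq^\mu,\qquad q^\mu F_i=q^{-\langle H_i,\mu\rangle}F_iq^\mu,\qquad E_iF_j-F_jE_i=\delta_{ij}\frac{q^{2H_i}-q^{-2H_i}}{q-q^{-1}},$$ and $E_i^2E_j-(q+q^{-1})E_iE_jE_i+E_jE_i^2=0=F_i^2F_j-(q+q^{-1})F_iF_jF_i+F_jF_i^2$ for $i\ne j$. It is a Hopf algebra with $\Delta(E_i)=E_i\otimes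 q^{-H_i}+q^{H_i}\otimes E_i$, $\Delta(F_i)=F_i\otimes q^{-H_i}+q^{H_i}\otimes F_i$, $\Delta(q^\mu)=q^\mu\otimes q^\mu$, counit $\varepsilon(E_i)=\varepsilon(F_i)=0$, $\varepsilon(q^\mu)=1$, and antipode $S(E_i)=-q^{-1}E_i$, $S(F_i)=-qF_i$, $S(q^\mu)=q^{-\mu}$. Write $\operatorname{ad}x(y)=[x,y]=\sum x_{(1)}\,y\,S(x_{(2)})$. **The quantum Lie algebra and its antisymmetriser.** Put $\lambda=\tfrac13(2H_1+H_2)$ and $\overline L=\operatorname{ad}\mathcal U(q^{-4\lambda})$. Consider pairs $(C,L)$ where $L\subset\overline L$ is an $\operatorname{ad}$-invariant subspace, $0\neq C\in\overline L$ satisfies $\operatorname{ad}u(C)=\varepsilon(u)C$ for all $u\in\mathcal U$, $\overline L=\mathbb KC\oplus L$, and $q^{-4\lambda}-C\in L$. Given such a pair, $L$ is the quantum Lie algebra $\mathfrak{sl}(3)_q$, and its quantum antisymmetriser is the map $\gamma:L\otimes L\to L\otimes L$, $$\gamma=\frac{1-\sigma}{q^2-1+q^{-2}},\qquad \sigma(x\otimes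 y)=\sum\operatorname{ad}x_{(1)}(y)\otimes x_{(2)}-[x,y]\otimes C .$$ Let $X_1=\frac{\operatorname{ad}E_1(q^{-4\lambda})}{q-q^{-1}}$, $X_{12}=\operatorname{ad}E_2(X_1)$, $X_2=\operatorname{ad}F_1(X_{12})$, $X_{-1}=\frac{\operatorname{ad}F_1(q^{-4\lambda})}{q-q^{-1}}$, $X_{-12}=\operatorname{ad}F_2(X_{-1})$, $X_{-2}=\operatorname{ad}E_1(X_{-12})$, $T_1=\frac{\operatorname{ad}(F_1E_1)(q^{-4\lambda})}{q-q^{-1}}$, $T_2=\operatorname{ad}(F_2E_2)(T_1)$, and $$\begin{aligned} W_{27}&=X_{12}\otimes X_{12},\\ W_{10}&=q^{1/2}X_1\otimes X_{12}-q^{-1/2}X_{12}\otimes X_1,\\ W_{10}^*&=q^{1/2}X_2\otimes X_{12}-q^{-1/2}X_{12}\otimes X_2,\\ W_8^{\mathrm s}&=\{q^{5/2}(q+q^{-1})+q^{-5/2}\}X_1\otimes X_2+\{q^{-5/2}(q+q^{-1})+q^{5/2}\}X_2\otimes X_1\\&\quad-(q^4T_1+q^{-1}T_2)\otimes X_{12}-X_{12}\otimes(q^{-4}T_1+qT_2),\\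 W_8^{\mathrm a}&=q^{3/2}X_1\otimes X_2-q^{-3/2}X_2\otimes X_1-q(qT_1-T_2)\otimes X_{12}+q^{-1}X_{12}\otimes(q^{-1}T_1-T_2),\\ W_1&=T_1\otimes T_2+T_2\otimes T_1-(q+q^{-1})(T_1\otimes T_1+T_2\otimes T_2)\\&\quad+(q^2+1+q^{-2})\bigl(q^{-1}X_1\otimes X_{-1}+qX_{-1}\otimes X_1+q^{-1}X_2\otimes X_{-2}+qX_{-2}\otimes X_2\\&\qquad-q^{-2}X_{12}\otimes X_{-12}-q^2X_{-12}\otimes X_{12}\bigr). \end{aligned}$$ **Lemma.** A pair $(C,L)$ as above exists, and for every such pair $\dim L=8$ and the following hold. The six vectors above lie in $L\otimes L$ and are highest-weight vectors (annihilated by $E_1,E_2$, and weight vectors, of weights $2H_1+2H_2$, $2H_1+H_2$, $H_1+2H_2$, $H_1+H_2$, $H_1+H_2$, $0$ for $W_{27},W_{10},W_{10}^*,W_8^{\mathrm s},W_8^{\mathrm a},W_1$) for the diagonal action $(\operatorname{ad}\otimes\operatorname{ad})\circ\Delta$ of $\mathcal U$. The submodules $M_{27},M_{10},M_{10}^*,M_8^{\mathrm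 s},M_8^{\mathrm a},M_1$ that they generate are simple, of dimensions $27,10,10,8,8,1$, and $$L\otimes L=M_{27}\oplus M_{10}\oplus M_{10}^*\oplus M_8^{\mathrm a}\oplus M_8^{\mathrm s}\oplus M_1 .$$ If $\Pi_{10},\Pi_{10}^*,\Pi_8^{\mathrm a}$ denote the projectors onto $M_{10},M_{10}^*,M_8^{\mathrm a}$ along the other summands, then $\sigma$ maps $L\otimes L$ to itself and the quantum antisymmetriser is $$\gamma=\frac{(q^2+1)\,\Pi_{10}^*+(q^2+q^{-2})\,\Pi_8^{\mathrm a}+(1+q^{-2})\,\Pi_{10}}{q^2-1+q^{-2}} .$$ -/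

import Mathlib

open scoped TensorProduct

noncomputable section

namespace Sl3q

variable {K : Type*} [Field K]

/-! ### The simply-connected quantised enveloping algebra of `sl(3)`

The unit `s` is a chosen square root `q ^ (1/2)` of the deformation parameter, so that
`q ^ (n/2)` is `s ^ n`. -/

/-- The deformation parameter `q = s ^ 2`. -/
def q (s : Kˣ) : K := (s : K) ^ 2

/-- The weight lattice of `sl(3)`, in coordinates with respect to the two fundamental weights.
With the invariant form normalised by `⟨H i, H i⟩ = 1` one has `⟨H i, μ⟩ = μ i / 2`. -/
abbrev Weight : Type := Fin 2 → ℤ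

/-- The simple roots, `⟨H i, H i⟩ = 1` and `⟨H 0, H 1⟩ = -1/2`. -/
def H (i : Fin 2) : Weight := fun j => if i = j then 2 else -1

/-- The generators: `E i`, `F i` and the symbols `q ^ μ` for `μ` in the weight lattice. -/
inductive Gen : Type
  | E : Fin 2 → Gen
  | F : Fin 2 → Gen
  | t : Weight → Gen

/-- The free algebra on the generators. -/
abbrev Free (K : Type*) [Field K] : Type _ := FreeAlgebra K Gen

/-- The generators, as elements of the free algebra. -/
abbrev fr (K : Type*) [Field K] (g : Gen) : Free K := FreeAlgebra.ι K g

/-- The quantum Serre expression `a² b - (q + q⁻¹) a b a + b a²`. -/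
def serre {A : Type*} [Ring A] [Algebra K A] (s : Kˣ) (a b : A) : A :=
  a * a * b - (q s + (q s)⁻¹) • (a * b * a) + b * a * a

/-- The defining relations. -/
inductive Rel (s : Kˣ) : Free K → Free K → Prop
  | t_zero : Rel s (fr K (.t 0)) 1
  | t_add (μ ν : Weight) : Rel s (fr K (.t μ) * fr K (.t ν)) (fr K (.t (μ + ν)))
  | t_E (μ : Weight) (i : Fin 2) :
      Rel s (fr K (.t μ) * fr K (.E i)) ((s : K) ^ μ i • (fr K (.E i) * fr K (.t μ)))
  | t_F (μ : Weight) (i : Fin 2) :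
      Rel s (fr K (.t μ) * fr K (.F i)) ((s : K) ^ (-μ i) • (fr K (.F i) * fr K (.t μ)))
  | E_F_same (i : Fin 2) :
      Rel s (fr K (.E i) * fr K (.F i) - fr K (.F i) * fr K (.E i))
        ((q s - (q s)⁻¹)⁻¹ • (fr K (.t (H i + H i)) - fr K (.t (-(H i + H i)))))
  | E_F_ne (i j : Fin 2) (h : i ≠ j) :
      Rel s (fr K (.E i) * fr K (.F j) - fr K (.F j) * fr K (.E i)) 0
  | serre_E (i j : Fin 2) (h : i ≠ j) : Rel s (serre s (fr K (.E i)) (fr K (.E j))) 0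
  | serre_F (i j : Fin 2) (h : i ≠ j) : Rel s (serre s (fr K (.F i)) (fr K (.F j))) 0

/-- The simply-connected quantised enveloping algebra of `sl(3)`. -/
def U (s : Kˣ) : Type _ := RingQuot (Rel s)

instance (s : Kˣ) : Ring (U s) := inferInstanceAs (Ring (RingQuot (Rel s)))

instance (s : Kˣ) : Algebra K (U s) := inferInstanceAs (Algebra K (RingQuot (Rel s)))

/-- The quotient map. -/
def mk (s : Kˣ) : Free K →ₐ[K] U s := RingQuot.mkAlgHom K (Rel s)

theorem mk_rel (s : Kˣ) {x y : Free K} (h : Rel s x y) : mk s x = mk s y :=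
  RingQuot.mkAlgHom_rel K h

/-- The homomorphism out of `U s` given by values on the generators which respect the relations. -/
def lift {A : Type*} [Ring A] [Algebra K A] (s : Kˣ) (f : Gen → A)
    (hf : ∀ ⦃x y⦄, Rel s x y → FreeAlgebra.lift K f x = FreeAlgebra.lift K f y) : U s →ₐ[K] A :=
  RingQuot.liftAlgHom K ⟨FreeAlgebra.lift K f, hf⟩

theorem lift_mk {A : Type*} [Ring A] [Algebra K A] (s : Kˣ) (f : Gen → A)
    (hf : ∀ ⦃x y⦄, Rel s x y → FreeAlgebra.lift K f x = FreeAlgebra.lift K f y) (g : Gen) :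
    lift s f hf (mk s (fr K g)) = f g :=
  (RingQuot.liftAlgHom_mkAlgHom_apply K _ hf _).trans (FreeAlgebra.lift_ι_apply f g)

/-- The generators `E i`. -/
def E (s : Kˣ) (i : Fin 2) : U s := mk s (fr K (.E i))

/-- The generators `F i`. -/
def F (s : Kˣ) (i : Fin 2) : U s := mk s (fr K (.F i))

/-- The elements `q ^ μ`. -/
def t (s : Kˣ) (μ : Weight) : U s := mk s (fr K (.t μ))

/-! The relations, in the quotient. -/

theorem t_zero (s : Kˣ) : t s 0 = 1 := by
  simpa [t] using mk_rel s (Rel.t_zero (s := s))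

theorem t_mul (s : Kˣ) (μ ν : Weight) : t s μ * t s ν = t s (μ + ν) := by
  simpa [t] using mk_rel s (Rel.t_add (s := s) μ ν)

theorem t_E (s : Kˣ) (μ : Weight) (i : Fin 2) :
    t s μ * E s i = (s : K) ^ μ i • (E s i * t s μ) := by
  simpa [t, E] using mk_rel s (Rel.t_E (s := s) μ i)

theorem t_F (s : Kˣ) (μ : Weight) (i : Fin 2) :
    t s μ * F s i = (s : K) ^ (-μ i) • (F s i * t s μ) := by
  simpa only [t, F, map_mul, map_smul] using mk_rel s (Rel.t_F (s := s) μ i)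

theorem E_F_same (s : Kˣ) (i : Fin 2) :
    E s i * F s i - F s i * E s i
      = (q s - (q s)⁻¹)⁻¹ • (t s (H i + H i) - t s (-(H i + H i))) := by
  simpa only [t, E, F, map_mul, map_smul, map_sub] using
    mk_rel s (Rel.E_F_same (s := s) i)

theorem E_F_ne (s : Kˣ) (i j : Fin 2) (h : i ≠ j) :
    E s i * F s j - F s j * E s i = 0 := by
  simpa only [E, F, map_mul, map_zero, map_sub] using
    mk_rel s (Rel.E_F_ne (s := s) i j h)

theorem map_serre {A B : Type*} [Ring A] [Algebra K A] [Ring B] [Algebra K B] (s : Kˣ)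
    (f : A →ₐ[K] B) (a b : A) : f (serre s a b) = serre s (f a) (f b) := by
  simp only [serre, map_add, map_sub, map_mul, map_smul]

theorem serre_E (s : Kˣ) (i j : Fin 2) (h : i ≠ j) : serre s (E s i) (E s j) = 0 := by
  simpa only [E, map_serre, map_zero] using mk_rel s (Rel.serre_E (s := s) i j h)

theorem serre_F (s : Kˣ) (i j : Fin 2) (h : i ≠ j) : serre s (F s i) (F s j) = 0 := by
  simpa only [F, map_serre, map_zero] using mk_rel s (Rel.serre_F (s := s) i j h)

/-- The quantum Serre relation for sums of `q`-commuting elements. -/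
theorem serre_add {A : Type*} [Ring A] [Algebra K A] (s : Kˣ) {r : K} (hr : r ≠ 0)
    (hq : q s + (q s)⁻¹ = r + r⁻¹) {a b c d : A}
    (hba : b * a = r ^ 2 • (a * b)) (hda : d * a = r⁻¹ • (a * d)) (hbc : b * c = r⁻¹ • (c * b))
    (hac : serre s a c = 0) (hbd : serre s b d = 0) : serre s (a + b) (c + d) = 0 := by
  have e : ∀ x : A, b * (a * x) = r ^ 2 • (a * (b * x)) := fun x => by
    rw [← mul_assoc, hba, smul_mul_assoc, mul_assoc]
  have e' : ∀ x : A, d * (a * x) = r⁻¹ • (a * (d * x)) := fun x => by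
    rw [← mul_assoc, hda, smul_mul_assoc, mul_assoc]
  have e'' : ∀ x : A, b * (c * x) = r⁻¹ • (c * (b * x)) := fun x => by
    rw [← mul_assoc, hbc, smul_mul_assoc, mul_assoc]
  have key : serre s (a + b) (c + d) = serre s a c + serre s b d := by
    simp only [serre, hq, mul_add, add_mul, mul_assoc, hba, hda, hbc, e, e', e'',
      mul_smul_comm, smul_mul_assoc, smul_smul, smul_add]
    match_scalars <;> field_simp <;> ring
  rw [key, hac, hbd, add_zero]

theorem serre_tmul_left {A : Type*} [Ring A] [Algebra K A] (s : Kˣ) {a b x y : A}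
    (hxy : x * y = y * x) (h : serre s a b = 0) : serre s (a ⊗ₜ[K] x) (b ⊗ₜ[K] y) = 0 := by
  have e : serre s (a ⊗ₜ[K] x) (b ⊗ₜ[K] y) = serre s a b ⊗ₜ[K] (x * x * y) := by
    have h₁ : x * y * x = x * x * y := by rw [mul_assoc, ← hxy, mul_assoc]
    have h₂ : y * x * x = x * x * y := by rw [← hxy, h₁]
    simp only [serre, Algebra.TensorProduct.tmul_mul_tmul, TensorProduct.add_tmul,
      TensorProduct.sub_tmul, h₁, h₂, TensorProduct.smul_tmul']
  rw [e, h, TensorProduct.zero_tmul]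

theorem serre_tmul_right {A : Type*} [Ring A] [Algebra K A] (s : Kˣ) {a b x y : A}
    (hxy : x * y = y * x) (h : serre s a b = 0) : serre s (x ⊗ₜ[K] a) (y ⊗ₜ[K] b) = 0 := by
  have e : serre s (x ⊗ₜ[K] a) (y ⊗ₜ[K] b) = (x * x * y) ⊗ₜ[K] serre s a b := by
    have h₁ : x * y * x = x * x * y := by rw [mul_assoc, ← hxy, mul_assoc]
    have h₂ : y * x * x = x * x * y := by rw [← hxy, h₁]
    simp only [serre, Algebra.TensorProduct.tmul_mul_tmul, TensorProduct.tmul_add,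
      TensorProduct.tmul_sub, h₁, h₂, TensorProduct.tmul_smul]
  rw [e, h, TensorProduct.tmul_zero]

theorem t_comm (s : Kˣ) (μ ν : Weight) : t s μ * t s ν = t s ν * t s μ := by
  rw [t_mul, t_mul, add_comm]

/-! ### The Hopf structure -/

theorem q_ne_zero (s : Kˣ) : q s ≠ 0 := pow_ne_zero 2 s.ne_zero

/-- Values of the comultiplication on the generators. -/
def comulGen (s : Kˣ) : Gen → U s ⊗[K] U s
  | .E i => E s i ⊗ₜ t s (-H i) + t s (H i) ⊗ₜ E s i
  | .F i => F s i ⊗ₜ t s (-H i) + t s (H i) ⊗ₜ F s i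
  | .t μ => t s μ ⊗ₜ t s μ

theorem E_t (s : Kˣ) (μ : Weight) (i : Fin 2) :
    E s i * t s μ = (s : K) ^ (-μ i) • (t s μ * E s i) := by
  rw [t_E, smul_smul, ← zpow_add₀ s.ne_zero]; simp

theorem F_t (s : Kˣ) (μ : Weight) (i : Fin 2) :
    F s i * t s μ = (s : K) ^ μ i • (t s μ * F s i) := by
  rw [t_F, smul_smul, ← zpow_add₀ s.ne_zero]; simp

theorem H_same (i : Fin 2) : H i i = 2 := by simp [H]

theorem H_ne {i j : Fin 2} (h : i ≠ j) : H i j = -1 := by simp [H, h]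

theorem comul_rel (s : Kˣ) ⦃x y : Free K⦄ (h : Rel s x y) :
    FreeAlgebra.lift K (comulGen s) x = FreeAlgebra.lift K (comulGen s) y := by
  have hs : (s : K) ≠ 0 := s.ne_zero
  cases h with
  | t_zero => simp [comulGen, t_zero, Algebra.TensorProduct.one_def]
  | t_add μ ν => simp [comulGen, t_mul]
  | t_E μ i =>
    simp only [map_mul, map_smul, FreeAlgebra.lift_ι_apply, comulGen, mul_add, add_mul,
      Algebra.TensorProduct.tmul_mul_tmul, t_mul, t_E, ← TensorProduct.smul_tmul',
      TensorProduct.tmul_smul, smul_add, add_comm]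
  | t_F μ i =>
    simp only [map_mul, map_smul, FreeAlgebra.lift_ι_apply, comulGen, mul_add, add_mul,
      Algebra.TensorProduct.tmul_mul_tmul, t_mul, t_F, ← TensorProduct.smul_tmul',
      TensorProduct.tmul_smul, smul_add, add_comm]
  | E_F_same i =>
    have h := E_F_same s i
    rw [sub_eq_iff_eq_add] at h
    simp only [map_sub, map_mul, map_smul, FreeAlgebra.lift_ι_apply, comulGen, mul_add, add_mul,
      Algebra.TensorProduct.tmul_mul_tmul, t_mul, h, E_t, F_t, ← TensorProduct.smul_tmul',
      TensorProduct.tmul_smul, TensorProduct.add_tmul, TensorProduct.tmul_add,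
      TensorProduct.sub_tmul, TensorProduct.tmul_sub, H_same, Pi.neg_apply, neg_add,
      neg_neg, smul_sub]
    abel
  | E_F_ne i j hij =>
    have h := E_F_ne s i j hij
    rw [sub_eq_zero] at h
    simp only [map_sub, map_zero, map_mul, FreeAlgebra.lift_ι_apply, comulGen, mul_add,
      add_mul, Algebra.TensorProduct.tmul_mul_tmul, t_mul, h, E_t, F_t,
      ← TensorProduct.smul_tmul', TensorProduct.tmul_smul, H_ne hij, H_ne hij.symm,
      Pi.neg_apply, add_comm (H j) (H i), add_comm (-H j) (-H i), neg_neg]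
    abel
  | serre_E i j hij =>
    refine (map_serre s (FreeAlgebra.lift K (comulGen s)) _ _).trans ?_
    simp only [FreeAlgebra.lift_ι_apply, comulGen, map_zero]
    apply serre_add s (r := q s) (q_ne_zero s) rfl
    case hac => exact serre_tmul_left s (t_comm s _ _) (serre_E s i j hij)
    case hbd => exact serre_tmul_right s (t_comm s _ _) (serre_E s i j hij)
    all_goals
      simp only [Algebra.TensorProduct.tmul_mul_tmul, E_t, ← TensorProduct.smul_tmul',
        TensorProduct.tmul_smul, smul_smul, H_same, H_ne hij, H_ne hij.symm, Pi.neg_apply, neg_neg]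
      match_scalars
      simp only [q]
      field_simp
  | serre_F i j hij =>
    refine (map_serre s (FreeAlgebra.lift K (comulGen s)) _ _).trans ?_
    simp only [FreeAlgebra.lift_ι_apply, comulGen, map_zero]
    apply serre_add s (r := (q s)⁻¹) (inv_ne_zero (q_ne_zero s)) (by rw [inv_inv, add_comm])
    case hac => exact serre_tmul_left s (t_comm s _ _) (serre_F s i j hij)
    case hbd => exact serre_tmul_right s (t_comm s _ _) (serre_F s i j hij)
    all_goals
      simp only [Algebra.TensorProduct.tmul_mul_tmul, F_t, ← TensorProduct.smul_tmul',
        TensorProduct.tmul_smul, smul_smul, H_same, H_ne hij, H_ne hij.symm, Pi.neg_apply, neg_neg]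
      match_scalars
      simp only [q]
      field_simp

/-- The comultiplication, `Δ (E i) = E i ⊗ q ^ (-H i) + q ^ (H i) ⊗ E i`,
`Δ (F i) = F i ⊗ q ^ (-H i) + q ^ (H i) ⊗ F i`, `Δ (q ^ μ) = q ^ μ ⊗ q ^ μ`. -/
def comul (s : Kˣ) : U s →ₐ[K] U s ⊗[K] U s :=
  lift s (comulGen s) (comul_rel s)

/-- Values of the counit on the generators. -/
def counitGen (K : Type*) [Field K] : Gen → K
  | .E _ => 0
  | .F _ => 0
  | .t _ => 1

theorem counit_rel (s : Kˣ) ⦃x y : Free K⦄ (h : Rel s x y) :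
    FreeAlgebra.lift K (counitGen K) x = FreeAlgebra.lift K (counitGen K) y := by
  cases h <;> simp [counitGen, serre]

/-- The counit. -/
def counit (s : Kˣ) : U s →ₐ[K] K :=
  lift s (counitGen K) (counit_rel s)

/-- Values of the antipode on the generators. -/
def antipodeGen (s : Kˣ) : Gen → (U s)ᵐᵒᵖ
  | .E i => MulOpposite.op (-(q s)⁻¹ • E s i)
  | .F i => MulOpposite.op (-q s • F s i)
  | .t μ => MulOpposite.op (t s (-μ))

theorem antipode_rel (s : Kˣ) ⦃x y : Free K⦄ (h : Rel s x y) :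
    FreeAlgebra.lift K (antipodeGen s) x = FreeAlgebra.lift K (antipodeGen s) y := by
  have hq : q s ≠ 0 := q_ne_zero s
  apply MulOpposite.unop_injective
  cases h with
  | t_zero => simp [antipodeGen, t_zero]
  | t_add μ ν => simp [antipodeGen, t_mul, add_comm]
  | t_E μ i =>
    simp only [map_mul, map_smul, FreeAlgebra.lift_ι_apply, antipodeGen, MulOpposite.unop_mul,
      MulOpposite.unop_op, MulOpposite.unop_smul, smul_mul_assoc, mul_smul_comm, t_E, smul_smul,
      Pi.neg_apply]
    match_scalars
    have := zpow_ne_zero (μ i) s.ne_zero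
    rw [zpow_neg]
    field_simp
  | t_F μ i =>
    simp only [map_mul, map_smul, FreeAlgebra.lift_ι_apply, antipodeGen, MulOpposite.unop_mul,
      MulOpposite.unop_op, MulOpposite.unop_smul, smul_mul_assoc, mul_smul_comm, t_F, smul_smul,
      Pi.neg_apply, neg_neg]
    match_scalars
    have := zpow_ne_zero (μ i) s.ne_zero
    rw [zpow_neg]
    field_simp
  | E_F_same i =>
    have h := E_F_same s i
    rw [sub_eq_iff_eq_add] at h
    simp only [map_sub, map_mul, map_smul, FreeAlgebra.lift_ι_apply, antipodeGen,
      MulOpposite.unop_mul, MulOpposite.unop_sub,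
      MulOpposite.unop_op, MulOpposite.unop_smul, smul_mul_assoc, mul_smul_comm, h, smul_smul,
      neg_neg, neg_mul_neg, mul_inv_cancel₀ hq, inv_mul_cancel₀ hq, one_smul]
    module
  | E_F_ne i j hij =>
    have h := E_F_ne s i j hij
    rw [sub_eq_zero] at h
    simp only [map_sub, map_mul, map_zero, FreeAlgebra.lift_ι_apply, antipodeGen,
      MulOpposite.unop_mul, MulOpposite.unop_sub, MulOpposite.unop_zero,
      MulOpposite.unop_op, smul_mul_assoc, mul_smul_comm, h, smul_smul,
      neg_mul_neg, mul_inv_cancel₀ hq, inv_mul_cancel₀ hq, one_smul, sub_self]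
  | serre_E i j hij =>
    have h := serre_E s i j hij
    have e : (FreeAlgebra.lift K (antipodeGen s) (serre s (fr K (.E i)) (fr K (.E j)))).unop
        = (-(q s)⁻¹) ^ 3 • serre s (E s i) (E s j) := by
      rw [map_serre]
      simp only [serre, FreeAlgebra.lift_ι_apply, antipodeGen, MulOpposite.unop_mul,
        MulOpposite.unop_sub, MulOpposite.unop_add, MulOpposite.unop_smul, MulOpposite.unop_op,
        smul_mul_assoc, mul_smul_comm, smul_smul, mul_assoc]
      module
    rw [e, h, smul_zero, map_zero, MulOpposite.unop_zero]
  | serre_F i j hij =>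
    have h := serre_F s i j hij
    have e : (FreeAlgebra.lift K (antipodeGen s) (serre s (fr K (.F i)) (fr K (.F j)))).unop
        = (-q s) ^ 3 • serre s (F s i) (F s j) := by
      rw [map_serre]
      simp only [serre, FreeAlgebra.lift_ι_apply, antipodeGen, MulOpposite.unop_mul,
        MulOpposite.unop_sub, MulOpposite.unop_add, MulOpposite.unop_smul, MulOpposite.unop_op,
        smul_mul_assoc, mul_smul_comm, smul_smul, mul_assoc]
      module
    rw [e, h, smul_zero, map_zero, MulOpposite.unop_zero]

/-- The antipode, as a homomorphism to the opposite algebra. -/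
def antipode (s : Kˣ) : U s →ₐ[K] (U s)ᵐᵒᵖ :=
  lift s (antipodeGen s) (antipode_rel s)

/-! ### The adjoint action -/

/-- The adjoint representation, `ad u x = ∑ u₍₁₎ * x * S u₍₂₎`. -/
def ad (s : Kˣ) : U s →ₐ[K] Module.End K (U s) :=
  (AlgHom.mulLeftRight K (U s)).comp
    ((Algebra.TensorProduct.map (AlgHom.id K (U s)) (antipode s)).comp (comul s))

/-- The adjoint bracket `[x, y] = ad x y`, as a bilinear map. -/
def bracket (s : Kˣ) : U s →ₗ[K] U s →ₗ[K] U s := (ad s).toLinearMap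

/-- The linear map `x ⊗ y ↦ ∑ ad x₍₁₎ y ⊗ x₍₂₎`. -/
def sigmaBar (s : Kˣ) : U s ⊗[K] U s →ₗ[K] U s ⊗[K] U s :=
  TensorProduct.lift
    ((LinearMap.rTensorHom (U s) ∘ₗ (bracket s).flip).flip ∘ₗ (comul s).toLinearMap)

/-- The linear map `x ⊗ y ↦ ∑ ad x₍₁₎ y ⊗ x₍₂₎ - [x, y] ⊗ C`. -/
def sigma (s : Kˣ) (C : U s) : U s ⊗[K] U s →ₗ[K] U s ⊗[K] U s :=
  sigmaBar s - (TensorProduct.mk K (U s) (U s)).flip C ∘ₗ TensorProduct.lift (bracket s)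

/-- The element `q ^ (-4 λ)`, with `λ = (2 H 0 + H 1) / 3` the highest weight of the
three-dimensional representation, that is, the first fundamental weight. -/
def K0 (s : Kˣ) : U s := t s ![-4, 0]

/-- The `ad`-submodule generated by `q ^ (-4 λ)`. -/
def Lbar (s : Kˣ) : Submodule K (U s) := LinearMap.range ((bracket s).flip (K0 s))

/-- `C` and `L` form the decomposition of `Lbar` as a `U`-module into a line carrying the trivial
representation and a complement, with `C` normalised so that `q ^ (-4 λ)` lies in `C + L`. -/
structure IsQuantumLie (s : Kˣ) (C : U s) (L : Submodule K (U s)) : Prop where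
  ad_mem : ∀ u, ∀ x ∈ L, ad s u x ∈ L
  ad_C : ∀ u, ad s u C = counit s u • C
  C_ne_zero : C ≠ 0
  disjoint : Disjoint (Submodule.span K {C}) L
  sup_eq : Submodule.span K {C} ⊔ L = Lbar s
  K0_sub_mem : K0 s - C ∈ L

/-- The adjoint representation on an `ad`-invariant subspace. -/
def adOn (s : Kˣ) (L : Submodule K (U s)) (hL : ∀ u, ∀ x ∈ L, ad s u x ∈ L) :
    U s →ₐ[K] Module.End K L :=
  AlgHom.ofLinearMap
    { toFun := fun u => (ad s u).restrict (hL u)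
      map_add' := fun u v => by ext x; simp
      map_smul' := fun c u => by ext x; simp }
    (by ext x; simp) (fun u v => by ext x; simp)

/-- The diagonal action `(ad ⊗ ad) ∘ Δ` on `L ⊗ L`. -/
def adTensor (s : Kˣ) (L : Submodule K (U s)) (hL : ∀ u, ∀ x ∈ L, ad s u x ∈ L) :
    U s →ₐ[K] Module.End K (L ⊗[K] L) :=
  Module.endTensorEndAlgHom.comp
    ((Algebra.TensorProduct.map (adOn s L hL) (adOn s L hL)).comp (comul s))

/-- The inclusion of `L ⊗ L` in `U ⊗ U` (injective, as `K` is a field). -/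
def incl (s : Kˣ) (L : Submodule K (U s)) : L ⊗[K] L →ₗ[K] U s ⊗[K] U s :=
  TensorProduct.map L.subtype L.subtype

/-- `γ` is the quantum antisymmetriser `(1 - σ) / (q² - 1 + q⁻²)` of `L`. -/
def IsAntisymmetriser (s : Kˣ) (C : U s) (L : Submodule K (U s))
    (γ : L ⊗[K] L →ₗ[K] L ⊗[K] L) : Prop :=
  ∀ x, incl s L (γ x)
    = (q s ^ 2 - 1 + (q s)⁻¹ ^ 2)⁻¹ • (incl s L x - sigma s C (incl s L x))

/-! ### Basis elements and highest-weight vectors -/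

/-- The basis element for the root `H 0`. -/
def X1 (s : Kˣ) : U s := (q s - (q s)⁻¹)⁻¹ • ad s (E s 0) (K0 s)
/-- The basis element for the root `H 0 + H 1`. -/
def X12 (s : Kˣ) : U s := ad s (E s 1) (X1 s)
/-- The basis element for the root `H 1`. -/
def X2 (s : Kˣ) : U s := ad s (F s 0) (X12 s)
/-- The basis element for the root `-H 0`. -/
def Xm1 (s : Kˣ) : U s := (q s - (q s)⁻¹)⁻¹ • ad s (F s 0) (K0 s)
/-- The basis element for the root `-(H 0 + H 1)`. -/
def Xm12 (s : Kˣ) : U s := ad s (F s 1) (Xm1 s)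
/-- The basis element for the root `-H 1`. -/
def Xm2 (s : Kˣ) : U s := ad s (E s 0) (Xm12 s)
/-- The basis element `T1` of weight zero. -/
def T1 (s : Kˣ) : U s := (q s - (q s)⁻¹)⁻¹ • ad s (F s 0 * E s 0) (K0 s)
/-- The basis element `T2` of weight zero. -/
def T2 (s : Kˣ) : U s := ad s (F s 1 * E s 1) (T1 s)

/-- Labels of the simple summands of `L ⊗ L`. -/
inductive Summand : Type
  | m27 | m10 | m10star | m8a | m8s | m1
  deriving DecidableEq

/-- The dimension of a summand. -/
def Summand.dim : Summand → ℕ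
  | .m27 => 27
  | .m10 => 10
  | .m10star => 10
  | .m8a => 8
  | .m8s => 8
  | .m1 => 1

/-- The highest weight of a summand, in coordinates with respect to the simple roots. -/
def Summand.weight : Summand → ℤ × ℤ
  | .m27 => (2, 2)
  | .m10 => (2, 1)
  | .m10star => (1, 2)
  | .m8a => (1, 1)
  | .m8s => (1, 1)
  | .m1 => (0, 0)

/-- The power `q ^ (n/2)`. -/
def qh (s : Kˣ) (n : ℤ) : K := (s : K) ^ n

/-- The highest-weight vectors. -/
def W (s : Kˣ) : Summand → U s ⊗[K] U s
  | .m27 => X12 s ⊗ₜ X12 s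
  | .m10 => qh s 1 • (X1 s ⊗ₜ X12 s) - qh s (-1) • (X12 s ⊗ₜ X1 s)
  | .m10star => qh s 1 • (X2 s ⊗ₜ X12 s) - qh s (-1) • (X12 s ⊗ₜ X2 s)
  | .m8a =>
    qh s 3 • (X1 s ⊗ₜ X2 s) - qh s (-3) • (X2 s ⊗ₜ X1 s)
      - q s • ((q s • T1 s - T2 s) ⊗ₜ X12 s)
      + (q s)⁻¹ • (X12 s ⊗ₜ ((q s)⁻¹ • T1 s - T2 s))
  | .m8s =>
    (qh s 5 * (q s + (q s)⁻¹) + qh s (-5)) • (X1 s ⊗ₜ X2 s)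
      + (qh s (-5) * (q s + (q s)⁻¹) + qh s 5) • (X2 s ⊗ₜ X1 s)
      - (q s ^ 4 • T1 s + (q s)⁻¹ • T2 s) ⊗ₜ X12 s
      - X12 s ⊗ₜ ((q s)⁻¹ ^ 4 • T1 s + q s • T2 s)
  | .m1 =>
    T1 s ⊗ₜ T2 s + T2 s ⊗ₜ T1 s - (q s + (q s)⁻¹) • (T1 s ⊗ₜ T1 s + T2 s ⊗ₜ T2 s)
      + (q s ^ 2 + 1 + (q s)⁻¹ ^ 2) •
        ((q s)⁻¹ • (X1 s ⊗ₜ Xm1 s) + q s • (Xm1 s ⊗ₜ X1 s)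
          + (q s)⁻¹ • (X2 s ⊗ₜ Xm2 s) + q s • (Xm2 s ⊗ₜ X2 s)
          - (q s)⁻¹ ^ 2 • (X12 s ⊗ₜ Xm12 s) - q s ^ 2 • (Xm12 s ⊗ₜ X12 s))

/-! ### Submodules and projectors -/

/-- The submodule generated by a vector under a representation. -/
def generated {A V : Type*} [Ring A] [Algebra K A] [AddCommMonoid V] [Module K V]
    (ρ : A →ₐ[K] Module.End K V) (v : V) : Submodule K V :=
  LinearMap.range (ρ.toLinearMap.flip v)

/-- The subspace `M` is a simple subrepresentation. -/
def IsSimpleSub {A V : Type*} [Ring A] [Algebra K A] [AddCommMonoid V] [Module K V]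
    (ρ : A →ₐ[K] Module.End K V) (M : Submodule K V) : Prop :=
  (∀ a, ∀ v ∈ M, ρ a v ∈ M) ∧ M ≠ ⊥ ∧
    ∀ N ≤ M, (∀ a, ∀ v ∈ N, ρ a v ∈ N) → N = ⊥ ∨ N = M

/-- The projector onto the summand `M i` of an internal direct sum. -/
def projector {ι V : Type*} [DecidableEq ι] [AddCommMonoid V] [Module K V]
    (M : ι → Submodule K V) (h : DirectSum.IsInternal M) (i : ι) : V →ₗ[K] V :=
  (M i).subtype ∘ₗ DirectSum.component K ι (fun j => M j) i ∘ₗ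
    (LinearEquiv.ofBijective (DirectSum.coeLinearMap M) h).symm.toLinearMap

/-- The submodules of `L ⊗ L` generated, under the diagonal adjoint action, by vectors `w i`. -/
def M (s : Kˣ) (L : Submodule K (U s)) (hL : ∀ u, ∀ x ∈ L, ad s u x ∈ L)
    (w : Summand → L ⊗[K] L) (i : Summand) : Submodule K (L ⊗[K] L) :=
  generated (adTensor s L hL) (w i)

end Sl3q

end

open scoped TensorProduct

noncomputable section

namespace Sl3q

variable {K : Type*} [Field K]

/-! ### Generalities on representations of `U s` -/

/-! The element q^(-4λ) has weight zero and is killed under `ad` by `E 1`, `F 1`, `E 0 * E 0` and `F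
0 * F 0`. With the Serre relations this forces the eight vectors `X` to transform like the adjoint
representation (`isOctet_X`). They are independent because `X12` acts nontrivially in the vector
representation (`X12_ne_zero`). Subtracting from q^(-4λ) a suitable weight-zero vector `kap` of
their span `L0` leaves an invariant `C0` (`ad_C0`). The counit is 1 on `C0` and 0 on `L0`, so `C0`
and `L0` form a pair. It is the only one, because an octet contains no nonzero invariant
(`IsQuantumLie.unique`).

The decomposition of the tensor square of the octet is proved without general complete reducibility.
A highest-weight vector is determined by its component along the top basis vector of the second
factor, and that component is confined to six dimensions; hence the six given vectors span all
highest-weight vectors (`hw_mem_span`). The contravariant form is nondegenerate on this span. It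
yields functionals dual to the six vectors that vanish on the images of the `F i`
(`exists_dual_hwv`), so each generated submodule has a single highest-weight line. Simplicity and
independence follow, since the `E i` act nilpotently. Root strings bound the weight multiplicities
below, and the resulting bounds 27, 10, 10, 8, 8, 1 add up to 64 = 8², so all are equalities and the
sum is everything (`finrank_hwMod`).

The map σ commutes with the diagonal action (`sigma_diag`), and the coproduct of `X1` is short
enough to give σ(X1 ⊗ y) in closed form (`sigma_X1`). Equivariance spreads this to the whole tensor
square: σ preserves L ⊗ L and is determined there. As the octet occurs twice, Schur's lemma alone
would not show that the two given octet vectors are eigenvectors. The top components of σ(w) are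
computed instead, and they determine σ(w) because it is again a highest-weight vector
(`braiding_hwv`). Hence σ is scalar on each summand, and γ is read off from 1 minus the eigenvalue.
-/

theorem U_induction {s : Kˣ} {p : U s → Prop} (hE : ∀ i, p (E s i)) (hF : ∀ i, p (F s i))
    (ht : ∀ μ, p (t s μ)) (hc : ∀ c : K, p (algebraMap K (U s) c))
    (hadd : ∀ u v, p u → p v → p (u + v)) (hmul : ∀ u v, p u → p v → p (u * v)) (u : U s) :
    p u := by
  obtain ⟨x, rfl⟩ : ∃ x, mk s x = u := RingQuot.mkAlgHom_surjective K (Rel s) u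
  induction x using FreeAlgebra.induction with
  | grade0 c => simpa using hc c
  | grade1 g =>
    cases g with
    | E i => exact hE i
    | F i => exact hF i
    | t μ => exact ht μ
  | mul a b ha hb => rw [map_mul]; exact hmul _ _ ha hb
  | add a b ha hb => rw [map_add]; exact hadd _ _ ha hb

@[simp] theorem comul_E (s : Kˣ) (i : Fin 2) :
    comul s (E s i) = E s i ⊗ₜ t s (-H i) + t s (H i) ⊗ₜ E s i := lift_mk s _ _ _

@[simp] theorem comul_F (s : Kˣ) (i : Fin 2) :
    comul s (F s i) = F s i ⊗ₜ t s (-H i) + t s (H i) ⊗ₜ F s i := lift_mk s _ _ _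

@[simp] theorem comul_t (s : Kˣ) (μ : Weight) : comul s (t s μ) = t s μ ⊗ₜ t s μ :=
  lift_mk s _ _ _

@[simp] theorem counit_E (s : Kˣ) (i : Fin 2) : counit s (E s i) = 0 := lift_mk s _ _ _

@[simp] theorem counit_F (s : Kˣ) (i : Fin 2) : counit s (F s i) = 0 := lift_mk s _ _ _

@[simp] theorem counit_t (s : Kˣ) (μ : Weight) : counit s (t s μ) = 1 := lift_mk s _ _ _

theorem antipode_E (s : Kˣ) (i : Fin 2) :
    antipode s (E s i) = MulOpposite.op (-(q s)⁻¹ • E s i) := lift_mk s _ _ _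

theorem antipode_F (s : Kˣ) (i : Fin 2) :
    antipode s (F s i) = MulOpposite.op (-q s • F s i) := lift_mk s _ _ _

theorem antipode_t (s : Kˣ) (μ : Weight) :
    antipode s (t s μ) = MulOpposite.op (t s (-μ)) := lift_mk s _ _ _

theorem ad_E (s : Kˣ) (i : Fin 2) (x : U s) :
    ad s (E s i) x = E s i * x * t s (H i) - (q s)⁻¹ • (t s (H i) * x * E s i) := by
  simp [ad, antipode_E, antipode_t, sub_eq_add_neg]

theorem ad_F (s : Kˣ) (i : Fin 2) (x : U s) :
    ad s (F s i) x = F s i * x * t s (H i) - q s • (t s (H i) * x * F s i) := by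
  simp [ad, antipode_F, antipode_t, sub_eq_add_neg]

theorem ad_t (s : Kˣ) (μ : Weight) (x : U s) : ad s (t s μ) x = t s μ * x * t s (-μ) := by
  simp [ad, antipode_t]

/-- Used to see that the counit vanishes on the octet, which separates the octet from the invariant
`C0`. -/
theorem counit_ad (s : Kˣ) (u x : U s) : counit s (ad s u x) = counit s u * counit s x := by
  induction u using U_induction generalizing x with
  | hE i => simp [ad_E]
  | hF i => simp [ad_F]
  | ht μ => simp [ad_t]
  | hc c => simp
  | hadd u v hu hv => simp [hu, hv, add_mul]
  | hmul u v hu hv => simp [hu, hv, mul_assoc]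

section Rep

variable {s : Kˣ} {V : Type*} [AddCommGroup V] [Module K V] (ρ : U s →ₐ[K] Module.End K V)

theorem stable_of_gens {N : Submodule K V} (hE : ∀ i, ∀ x ∈ N, ρ (E s i) x ∈ N)
    (hF : ∀ i, ∀ x ∈ N, ρ (F s i) x ∈ N) (ht : ∀ μ, ∀ x ∈ N, ρ (t s μ) x ∈ N) (u : U s) :
    ∀ x ∈ N, ρ u x ∈ N := by
  induction u using U_induction with
  | hE i => exact hE i
  | hF i => exact hF i
  | ht μ => exact ht μ
  | hc c =>
    intro x hx
    rw [AlgHom.commutes, Module.algebraMap_end_apply]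
    exact N.smul_mem c hx
  | hadd u v hu hv =>
    intro x hx
    rw [map_add, LinearMap.add_apply]
    exact N.add_mem (hu x hx) (hv x hx)
  | hmul u v hu hv =>
    intro x hx
    rw [map_mul, Module.End.mul_apply]
    exact hu _ (hv x hx)

/-- A linear map commuting with the generators commutes with the whole algebra. -/
theorem commute_of_gens {V' : Type*} [AddCommGroup V'] [Module K V']
    (ρ' : U s →ₐ[K] Module.End K V') (f : V →ₗ[K] V')
    (hE : ∀ i x, f (ρ (E s i) x) = ρ' (E s i) (f x))
    (hF : ∀ i x, f (ρ (F s i) x) = ρ' (F s i) (f x))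
    (ht : ∀ μ x, f (ρ (t s μ) x) = ρ' (t s μ) (f x)) (u : U s) (x : V) :
    f (ρ u x) = ρ' u (f x) := by
  induction u using U_induction generalizing x with
  | hE i => exact hE i x
  | hF i => exact hF i x
  | ht μ => exact ht μ x
  | hc c => simp
  | hadd u v hu hv => simp [hu, hv]
  | hmul u v hu hv => simp [hu, hv]

/-- The diagonal action on the tensor square of a representation. -/
def diag : U s →ₐ[K] Module.End K (V ⊗[K] V) :=
  Module.endTensorEndAlgHom.comp ((Algebra.TensorProduct.map ρ ρ).comp (comul s))

theorem diag_E (i : Fin 2) (x y : V) : diag ρ (E s i) (x ⊗ₜ y)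
    = ρ (E s i) x ⊗ₜ ρ (t s (-H i)) y + ρ (t s (H i)) x ⊗ₜ ρ (E s i) y := by
  simp only [diag, AlgHom.comp_apply, comul_E, map_add, Algebra.TensorProduct.map_tmul]
  rfl

theorem diag_F (i : Fin 2) (x y : V) : diag ρ (F s i) (x ⊗ₜ y)
    = ρ (F s i) x ⊗ₜ ρ (t s (-H i)) y + ρ (t s (H i)) x ⊗ₜ ρ (F s i) y := by
  simp only [diag, AlgHom.comp_apply, comul_F, map_add, Algebra.TensorProduct.map_tmul]
  rfl

theorem diag_t (μ : Weight) (x y : V) :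
    diag ρ (t s μ) (x ⊗ₜ y) = ρ (t s μ) x ⊗ₜ ρ (t s μ) y := by
  simp only [diag, AlgHom.comp_apply, comul_t, Algebra.TensorProduct.map_tmul]
  rfl

theorem rep_t_mul (μ ν : Weight) (x : V) : ρ (t s μ) (ρ (t s ν) x) = ρ (t s (μ + ν)) x := by
  rw [← t_mul, map_mul, Module.End.mul_apply]

theorem rep_t_neg (μ : Weight) (x : V) : ρ (t s μ) (ρ (t s (-μ)) x) = x := by
  rw [rep_t_mul, add_neg_cancel, t_zero, map_one, Module.End.one_apply]

theorem rep_t_neg' (μ : Weight) (x : V) : ρ (t s (-μ)) (ρ (t s μ) x) = x := by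
  rw [rep_t_mul, neg_add_cancel, t_zero, map_one, Module.End.one_apply]

theorem rep_EF_ne {i j : Fin 2} (h : i ≠ j) (x : V) :
    ρ (E s i) (ρ (F s j) x) = ρ (F s j) (ρ (E s i) x) := by
  have := congrArg (fun u => ρ u x) (sub_eq_zero.1 (E_F_ne s i j h))
  simpa using this

theorem rep_serre_E {i j : Fin 2} (h : i ≠ j) (x : V) :
    ρ (E s i) (ρ (E s i) (ρ (E s j) x)) - (q s + (q s)⁻¹) • ρ (E s i) (ρ (E s j) (ρ (E s i) x))
      + ρ (E s j) (ρ (E s i) (ρ (E s i) x)) = 0 := by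
  have := congrArg (fun u => ρ u x) (serre_E s i j h)
  simpa [serre] using this

theorem rep_serre_F {i j : Fin 2} (h : i ≠ j) (x : V) :
    ρ (F s i) (ρ (F s i) (ρ (F s j) x)) - (q s + (q s)⁻¹) • ρ (F s i) (ρ (F s j) (ρ (F s i) x))
      + ρ (F s j) (ρ (F s i) (ρ (F s i) x)) = 0 := by
  have := congrArg (fun u => ρ u x) (serre_F s i j h)
  simpa [serre] using this

/-- `x` has weight `a.1 • H 0 + a.2 • H 1`. -/
def IsWt (a : ℤ × ℤ) (x : V) : Prop :=
  ∀ μ, ρ (t s μ) x = (s : K) ^ (a.1 * μ 0 + a.2 * μ 1) • x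

/-- The simple roots in coordinates with respect to the simple roots. -/
def root : Fin 2 → ℤ × ℤ := ![(1, 0), (0, 1)]

/-- The pairing of a weight with the simple coroots. -/
def pair (i : Fin 2) (a : ℤ × ℤ) : ℤ := if i = 0 then 2 * a.1 - a.2 else 2 * a.2 - a.1

/-- The quantum integers. -/
def qint (s : Kˣ) (n : ℤ) : K := (q s - (q s)⁻¹)⁻¹ * (q s ^ n - q s ^ (-n))

variable {ρ}

theorem IsWt.E {a : ℤ × ℤ} {x : V} (h : IsWt ρ a x) (i : Fin 2) :
    IsWt ρ (a + root i) (ρ (E s i) x) := by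
  intro μ
  have := congrArg (fun u => ρ u x) (t_E s μ i)
  simp only [map_mul, Module.End.mul_apply, map_smul, LinearMap.smul_apply, h μ] at this
  rw [this, smul_smul, ← zpow_add₀ s.ne_zero]
  congr 2
  fin_cases i <;> simp [root] <;> ring

theorem IsWt.F {a : ℤ × ℤ} {x : V} (h : IsWt ρ a x) (i : Fin 2) :
    IsWt ρ (a - root i) (ρ (F s i) x) := by
  intro μ
  have := congrArg (fun u => ρ u x) (t_F s μ i)
  simp only [map_mul, Module.End.mul_apply, map_smul, LinearMap.smul_apply, h μ] at this
  rw [this, smul_smul, ← zpow_add₀ s.ne_zero]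
  congr 2
  fin_cases i <;> simp [root] <;> ring

theorem IsWt.EF {a : ℤ × ℤ} {x : V} (h : IsWt ρ a x) (i : Fin 2) :
    ρ (Sl3q.E s i) (ρ (Sl3q.F s i) x)
      = ρ (Sl3q.F s i) (ρ (Sl3q.E s i) x) + qint s (pair i a) • x := by
  have := congrArg (fun u => ρ u x) (E_F_same s i)
  simp only [map_sub, map_mul, LinearMap.sub_apply, Module.End.mul_apply, map_smul,
    LinearMap.smul_apply, h _] at this
  rw [sub_eq_iff_eq_add'] at this
  rw [this, ← sub_smul, smul_smul, qint]
  congr 4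
  · rw [q, ← zpow_natCast, ← zpow_mul]
    congr 1
    fin_cases i <;> simp [H, pair] <;> ring
  · rw [q, ← zpow_natCast, ← zpow_mul]
    congr 1
    fin_cases i <;> simp [H, pair] <;> ring

theorem IsWt.E' {a b : ℤ × ℤ} {x : V} (h : IsWt ρ a x) (i : Fin 2) (hb : a + root i = b) :
    IsWt ρ b (ρ (Sl3q.E s i) x) := hb ▸ h.E i

theorem IsWt.F' {a b : ℤ × ℤ} {x : V} (h : IsWt ρ a x) (i : Fin 2) (hb : a - root i = b) :
    IsWt ρ b (ρ (Sl3q.F s i) x) := hb ▸ h.F i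

theorem IsWt.FE {a : ℤ × ℤ} {x : V} (h : IsWt ρ a x) (i : Fin 2)
    (h₀ : ρ (Sl3q.F s i) x = 0) :
    ρ (Sl3q.F s i) (ρ (Sl3q.E s i) x) = (-qint s (pair i a)) • x := by
  rw [neg_smul, eq_neg_iff_add_eq_zero, ← h.EF i, h₀, map_zero]

theorem IsWt.tmul {a b : ℤ × ℤ} {x y : V} (hx : IsWt ρ a x) (hy : IsWt ρ b y) :
    IsWt (diag ρ) (a + b) (x ⊗ₜ[K] y) := by
  intro μ
  rw [diag_t, hx μ, hy μ, TensorProduct.smul_tmul_smul, ← zpow_add₀ s.ne_zero]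
  congr 2
  simp; ring

theorem IsWt.add {a : ℤ × ℤ} {x y : V} (hx : IsWt ρ a x) (hy : IsWt ρ a y) :
    IsWt ρ a (x + y) := fun μ => by rw [map_add, hx, hy, smul_add]

theorem IsWt.sub {a : ℤ × ℤ} {x y : V} (hx : IsWt ρ a x) (hy : IsWt ρ a y) :
    IsWt ρ a (x - y) := fun μ => by rw [map_sub, hx, hy, smul_sub]

theorem IsWt.smul {a : ℤ × ℤ} {x : V} (hx : IsWt ρ a x) (c : K) : IsWt ρ a (c • x) :=
  fun μ => by rw [map_smul, hx, smul_comm]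

end Rep

/-! ### Consequences of the genericity of `q` -/

/-- The genericity assumption on `q`. -/
structure Generic (s : Kˣ) : Prop where
  h8 : q s ^ 8 ≠ 1
  h10 : q s ^ 10 ≠ 1
  h12 : q s ^ 12 ≠ 1

/-- Every n from 1 to 6 divides 8, 10 or 12. -/
theorem Generic.pow_ne_one {s : Kˣ} (h : Generic s) {n : ℕ} (h₀ : 0 < n) (hn : n ≤ 6) :
    q s ^ n ≠ 1 := by
  intro e
  have key : ∀ m, q s ^ (n * m) = 1 := fun m => by rw [pow_mul, e, one_pow]
  interval_cases n
  · exact h.h8 (key 8)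
  · exact h.h8 (key 4)
  · exact h.h12 (key 4)
  · exact h.h8 (key 2)
  · exact h.h10 (key 2)
  · exact h.h12 (key 2)

theorem Generic.q_sub_ne {s : Kˣ} (h : Generic s) : q s - (q s)⁻¹ ≠ 0 := by
  intro e
  have hq := q_ne_zero s
  field_simp at e
  exact h.pow_ne_one (n := 2) (by norm_num) (by norm_num) (by linear_combination e)

theorem Generic.two_ne {s : Kˣ} (h : Generic s) : q s + (q s)⁻¹ ≠ 0 := by
  intro e
  have hq := q_ne_zero s
  field_simp at e
  exact h.pow_ne_one (n := 4) (by norm_num) (by norm_num) (by linear_combination (q s ^ 2 - 1) * e)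

theorem Generic.three_ne {s : Kˣ} (h : Generic s) : q s ^ 2 + 1 + (q s)⁻¹ ^ 2 ≠ 0 := by
  intro e
  have hq := q_ne_zero s
  field_simp at e
  exact h.pow_ne_one (n := 6) (by norm_num) (by norm_num) (by linear_combination (q s ^ 2 - 1) * e)

theorem Generic.q2_add_ne {s : Kˣ} (h : Generic s) : q s ^ 2 + (q s)⁻¹ ^ 2 ≠ 0 := by
  intro e
  have hq := q_ne_zero s
  field_simp at e
  exact h.h8 (by linear_combination (q s ^ 4 - 1) * e)

theorem Generic.five_ne {s : Kˣ} (h : Generic s) :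
    q s ^ 4 + q s ^ 2 + 1 + (q s)⁻¹ ^ 2 + (q s)⁻¹ ^ 4 ≠ 0 := by
  intro e
  have hq := q_ne_zero s
  field_simp at e
  exact h.h10 (by linear_combination (q s ^ 2 - 1) * e)

/-- [n] = 0 would give q^(2n) = 1, and n = 4, 5, 6 are precisely the three hypotheses on q. The
bound 6 is the one needed for the root strings in `F_pow_eq_zero`. -/
theorem Generic.qint_ne_zero {s : Kˣ} (h : Generic s) {n : ℤ} (h₀ : 0 < n) (hn : n ≤ 6) :
    qint s n ≠ 0 := by
  have hq := q_ne_zero s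
  refine mul_ne_zero (inv_ne_zero h.q_sub_ne) fun e => ?_
  rw [sub_eq_zero] at e
  have e' : q s ^ (n * 2) = 1 := by
    rw [mul_two, zpow_add₀ hq]
    nth_rewrite 1 [e]
    rw [← zpow_add₀ hq, neg_add_cancel, zpow_zero]
  obtain ⟨m, rfl⟩ := Int.eq_ofNat_of_zero_le h₀.le
  have e : q s ^ (m * 2) = 1 := by exact_mod_cast e'
  have h₀ : 0 < m := by omega
  have hn : m ≤ 6 := by omega
  interval_cases m
  · exact h.pow_ne_one (by norm_num) (by norm_num) e
  · exact h.pow_ne_one (by norm_num) (by norm_num) e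
  · exact h.pow_ne_one (by norm_num) (by norm_num) e
  · exact h.h8 e
  · exact h.h10 e
  · exact h.h12 e

theorem qint_zero (s : Kˣ) : qint s 0 = 0 := by simp [qint]

theorem qint_one {s : Kˣ} (h : Generic s) : qint s 1 = 1 := by
  simp [qint, inv_mul_cancel₀ h.q_sub_ne]

theorem qint_neg (s : Kˣ) (n : ℤ) : qint s (-n) = -qint s n := by
  simp only [qint, neg_neg]; ring

theorem qint_two {s : Kˣ} (h : Generic s) : qint s 2 = q s + (q s)⁻¹ := by
  have := h.q_sub_ne
  have hq := q_ne_zero s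
  rw [qint, zpow_neg, inv_mul_eq_iff_eq_mul₀ this]
  simp only [zpow_ofNat]
  field_simp
  ring

/-! ### The octet -/

/-- Labels of a weight basis of the adjoint representation. -/
inductive Ix : Type
  | p12 | p1 | p2 | T1 | T2 | m1 | m2 | m12
  deriving DecidableEq

instance : Fintype Ix :=
  ⟨{.p12, .p1, .p2, .T1, .T2, .m1, .m2, .m12}, fun a => by cases a <;> decide⟩

/-- The weights of the adjoint representation. -/
def Ix.wt : Ix → ℤ × ℤ
  | .p12 => (1, 1) | .p1 => (1, 0) | .p2 => (0, 1) | .T1 => (0, 0) | .T2 => (0, 0)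
  | .m1 => (-1, 0) | .m2 => (0, -1) | .m12 => (-1, -1)

section Tables

variable {V : Type*} [AddCommGroup V] [Module K V] (s : Kˣ) (e : Ix → V)

/-- The action of `E 0` on the octet. -/
def tabE0 : Ix → V
  | .p12 => 0 | .p1 => 0 | .p2 => e .p12 | .T1 => (q s + (q s)⁻¹) • e .p1 | .T2 => e .p1
  | .m1 => e .T1 | .m2 => 0 | .m12 => e .m2

/-- The action of `E 1` on the octet. -/
def tabE1 : Ix → V
  | .p12 => 0 | .p1 => e .p12 | .p2 => 0 | .T1 => e .p2 | .T2 => (q s + (q s)⁻¹) • e .p2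
  | .m1 => 0 | .m2 => e .T2 | .m12 => e .m1

/-- The action of `F 0` on the octet. -/
def tabF0 : Ix → V
  | .p12 => e .p2 | .p1 => e .T1 | .p2 => 0 | .T1 => (q s + (q s)⁻¹) • e .m1 | .T2 => e .m1
  | .m1 => 0 | .m2 => e .m12 | .m12 => 0

/-- The action of `F 1` on the octet. -/
def tabF1 : Ix → V
  | .p12 => e .p1 | .p1 => 0 | .p2 => e .T2 | .T1 => e .m2 | .T2 => (q s + (q s)⁻¹) • e .m2
  | .m1 => e .m12 | .m2 => 0 | .m12 => 0

variable {s}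

/-- The vectors `e` transform like the standard basis of the adjoint representation. -/
structure IsOctet (ρ : U s →ₐ[K] Module.End K V) (e : Ix → V) : Prop where
  wt : ∀ a, IsWt ρ a.wt (e a)
  E0 : ∀ a, ρ (E s 0) (e a) = tabE0 s e a
  E1 : ∀ a, ρ (E s 1) (e a) = tabE1 s e a
  F0 : ∀ a, ρ (F s 0) (e a) = tabF0 s e a
  F1 : ∀ a, ρ (F s 1) (e a) = tabF1 s e a

end Tables

/-- The basis elements of the quantum Lie algebra. -/
def X (s : Kˣ) : Ix → U s
  | .p12 => X12 s | .p1 => X1 s | .p2 => X2 s | .T1 => T1 s | .T2 => T2 s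
  | .m1 => Xm1 s | .m2 => Xm2 s | .m12 => Xm12 s

/-! ### The adjoint action on q^(-4λ) and the octet relations. -/

theorem wt_K0 (s : Kˣ) : IsWt (ad s) (0, 0) (K0 s) := by
  intro μ
  rw [ad_t, K0, t_mul, t_mul]
  simp [add_comm μ]

theorem E_zpow (s : Kˣ) (i : Fin 2) (μ : Weight) (x : U s) :
    E s i * (t s μ * x) = (s : K) ^ (-μ i) • (t s μ * (E s i * x)) := by
  rw [← mul_assoc, E_t, smul_mul_assoc, mul_assoc]

theorem F_zpow (s : Kˣ) (i : Fin 2) (μ : Weight) (x : U s) :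
    F s i * (t s μ * x) = (s : K) ^ (μ i) • (t s μ * (F s i * x)) := by
  rw [← mul_assoc, F_t, smul_mul_assoc, mul_assoc]

theorem t_mul' (s : Kˣ) (μ ν : Weight) (x : U s) : t s μ * (t s ν * x) = t s (μ + ν) * x := by
  rw [← mul_assoc, t_mul]

theorem ad_E0_K0 (s : Kˣ) :
    ad s (E s 0) (K0 s) = ((s : K) ^ 2 - (s : K) ^ (-2 : ℤ)) • (t s ![-2, -1] * E s 0) := by
  have h1 : ![-4, 0] + H 0 = ![-2, -1] := by decide
  have h2 : H 0 + ![-4, 0] = ![-2, -1] := by decide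
  simp only [ad_E, K0, mul_assoc, E_t, t_mul', h1, h2, smul_smul, mul_smul_comm,
    smul_mul_assoc, q]
  rw [← sub_smul]
  congr 1
  simp [H]
  have := s.ne_zero
  field_simp

theorem ad_F0_K0 (s : Kˣ) :
    ad s (F s 0) (K0 s) = ((s : K) ^ (-2 : ℤ) - (s : K) ^ 2) • (t s ![-2, -1] * F s 0) := by
  have h1 : ![-4, 0] + H 0 = ![-2, -1] := by decide
  have h2 : H 0 + ![-4, 0] = ![-2, -1] := by decide
  simp only [ad_F, K0, mul_assoc, F_t, t_mul', h1, h2, smul_smul, mul_smul_comm,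
    smul_mul_assoc, q]
  rw [← sub_smul]
  congr 1
  simp [H]
  have := s.ne_zero
  field_simp

/-- λ is orthogonal to `H 1`, so `K0` commutes with `E 1`; the factor q⁻¹ in `ad_E` is the one
produced by moving `E 1` past q^(H 1), and the two terms cancel. -/
theorem ad_E1_K0 (s : Kˣ) : ad s (E s 1) (K0 s) = 0 := by
  have h2 : H 1 + ![-4, 0] = ![-4, 0] + H 1 := by decide
  simp only [ad_E, K0, mul_assoc, E_t, t_mul', h2, smul_smul, mul_smul_comm,
    smul_mul_assoc, q]
  rw [← sub_smul]
  have := s.ne_zero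
  simp [H]

theorem ad_F1_K0 (s : Kˣ) : ad s (F s 1) (K0 s) = 0 := by
  have h2 : H 1 + ![-4, 0] = ![-4, 0] + H 1 := by decide
  simp only [ad_F, K0, mul_assoc, F_t, t_mul', h2, smul_smul, mul_smul_comm,
    smul_mul_assoc, q]
  rw [← sub_smul]
  have := s.ne_zero
  simp [H]

theorem ad_E0_E0_K0 (s : Kˣ) : ad s (E s 0) (ad s (E s 0) (K0 s)) = 0 := by
  have h1 : ![-2, -1] + H 0 = H 0 + ![-2, -1] := by decide
  rw [ad_E0_K0, map_smul]
  simp only [ad_E, mul_assoc, E_zpow, E_t, t_mul', h1, smul_smul, mul_smul_comm,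
    smul_mul_assoc, q]
  rw [← sub_smul]
  have := s.ne_zero
  simp [H]

theorem ad_F0_F0_K0 (s : Kˣ) : ad s (F s 0) (ad s (F s 0) (K0 s)) = 0 := by
  have h1 : ![-2, -1] + H 0 = H 0 + ![-2, -1] := by decide
  rw [ad_F0_K0, map_smul]
  simp only [ad_F, mul_assoc, F_zpow, F_t, t_mul', h1, smul_smul, mul_smul_comm,
    smul_mul_assoc, q]
  rw [← sub_smul]
  have := s.ne_zero
  simp [H]

/-- The octet spanned by a cyclic vector `k` of weight zero which is killed by `E 1`, `F 1`,
`E 0 * E 0` and `F 0 * F 0`. -/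
theorem isOctet_X {s : Kˣ} (h : Generic s) : IsOctet (ad s) (X s) := by
  have two := h.two_ne
  have n01 : (0 : Fin 2) ≠ 1 := by decide
  have n10 : (1 : Fin 2) ≠ 0 := by decide
  set c := (q s - (q s)⁻¹)⁻¹
  have w0 := wt_K0 s
  have dX1 : X1 s = c • ad s (E s 0) (K0 s) := rfl
  have dm1 : Xm1 s = c • ad s (F s 0) (K0 s) := rfl
  have dX12 : X12 s = ad s (E s 1) (X1 s) := rfl
  have dX2 : X2 s = ad s (F s 0) (X12 s) := rfl
  have dm12 : Xm12 s = ad s (F s 1) (Xm1 s) := rfl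
  have dm2 : Xm2 s = ad s (E s 0) (Xm12 s) := rfl
  have dT1 : T1 s = ad s (F s 0) (X1 s) := by
    rw [T1, dX1, map_mul, Module.End.mul_apply, map_smul]
  have dT2' : T2 s = ad s (F s 1) (ad s (E s 1) (T1 s)) := by
    rw [T2, map_mul, Module.End.mul_apply]
  have w1 : IsWt (ad s) (1, 0) (X1 s) := (w0.E' 0 (by decide)).smul c
  have wm1 : IsWt (ad s) (-1, 0) (Xm1 s) := (w0.F' 0 (by decide)).smul c
  have w12 : IsWt (ad s) (1, 1) (X12 s) := w1.E' 1 (by decide)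
  have w2 : IsWt (ad s) (0, 1) (X2 s) := w12.F' 0 (by decide)
  have wm12 : IsWt (ad s) (-1, -1) (Xm12 s) := wm1.F' 1 (by decide)
  have wm2 : IsWt (ad s) (0, -1) (Xm2 s) := wm12.E' 0 (by decide)
  have wT1 : IsWt (ad s) (0, 0) (T1 s) := dT1 ▸ w1.F' 0 (by decide)
  have wT2 : IsWt (ad s) (0, 0) (T2 s) := dT2' ▸ (wT1.E 1).F' 1 (by decide)
  have q2 := qint_two h
  have q1 := qint_one h
  have q0 := qint_zero s
  -- the action of the simple root vectors on the octet
  have E0X1 : ad s (E s 0) (X1 s) = 0 := by rw [dX1, map_smul, ad_E0_E0_K0, smul_zero]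
  have F0m1 : ad s (F s 0) (Xm1 s) = 0 := by rw [dm1, map_smul, ad_F0_F0_K0, smul_zero]
  have F1X1 : ad s (F s 1) (X1 s) = 0 := by
    rw [dX1, map_smul, ← rep_EF_ne (ad s) n01, ad_F1_K0, map_zero, smul_zero]
  have E1m1 : ad s (E s 1) (Xm1 s) = 0 := by
    rw [dm1, map_smul, rep_EF_ne (ad s) n10, ad_E1_K0, map_zero, smul_zero]
  -- On weight zero the commutator of `E 0` and `F 0` acts by [0] = 0, so the two orders give the
  -- same vector.
  have E0m1 : ad s (E s 0) (Xm1 s) = T1 s := by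
    have := w0.EF 0
    rw [show pair 0 (0, 0) = 0 by decide, q0, zero_smul, add_zero] at this
    rw [dm1, map_smul, this, dT1, dX1, map_smul]
  -- In the Serre relation applied to `K0`, the terms with `E 1` acting first vanish, leaving only
  -- `E 1 * E 1 * E 0`.
  have E1X12 : ad s (E s 1) (X12 s) = 0 := by
    have := rep_serre_E (ad s) n10 (K0 s)
    rw [ad_E1_K0, map_zero, map_zero, smul_zero, map_zero, sub_zero, add_zero] at this
    rw [dX12, dX1, map_smul, map_smul, this, smul_zero]
  -- Here only the middle Serre term survives, and its coefficient [2] is invertible.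
  have E0X12 : ad s (E s 0) (X12 s) = 0 := by
    have := rep_serre_E (ad s) n01 (K0 s)
    rw [ad_E1_K0, map_zero, map_zero, ad_E0_E0_K0, map_zero, add_zero, zero_sub, neg_eq_zero,
      smul_eq_zero] at this
    rw [dX12, dX1, map_smul, map_smul, this.resolve_left two, smul_zero]
  have F1m12 : ad s (F s 1) (Xm12 s) = 0 := by
    have := rep_serre_F (ad s) n10 (K0 s)
    rw [ad_F1_K0, map_zero, map_zero, smul_zero, map_zero, sub_zero, add_zero] at this
    rw [dm12, dm1, map_smul, map_smul, this, smul_zero]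
  have F0m12 : ad s (F s 0) (Xm12 s) = 0 := by
    have := rep_serre_F (ad s) n01 (K0 s)
    rw [ad_F1_K0, map_zero, map_zero, ad_F0_F0_K0, map_zero, add_zero, zero_sub, neg_eq_zero,
      smul_eq_zero] at this
    rw [dm12, dm1, map_smul, map_smul, this.resolve_left two, smul_zero]
  have F1X12 : ad s (F s 1) (X12 s) = X1 s := by
    have := w1.FE 1 F1X1
    rw [show pair 1 (1, 0) = -1 by decide, qint_neg, neg_neg, q1] at this
    rw [dX12, this, one_smul]
  have E1m12 : ad s (E s 1) (Xm12 s) = Xm1 s := by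
    have := wm1.EF 1
    rw [show pair 1 (-1, 0) = 1 by decide, q1, E1m1, map_zero, zero_add, one_smul] at this
    rw [dm12, this]
  have E0X2 : ad s (E s 0) (X2 s) = X12 s := by
    have := w12.EF 0
    rw [show pair 0 (1, 1) = 1 by decide, q1, E0X12, map_zero, zero_add, one_smul] at this
    rw [dX2, this]
  have E1X2 : ad s (E s 1) (X2 s) = 0 := by
    rw [dX2, rep_EF_ne (ad s) n10, E1X12, map_zero]
  have F0m2 : ad s (F s 0) (Xm2 s) = Xm12 s := by
    have := wm12.FE 0 F0m12
    rw [show pair 0 (-1, -1) = -1 by decide, qint_neg, neg_neg, q1] at this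
    rw [dm2, this, one_smul]
  have F1m2 : ad s (F s 1) (Xm2 s) = 0 := by
    rw [dm2, ← rep_EF_ne (ad s) n01, F1m12, map_zero]
  have E0T1 : ad s (E s 0) (T1 s) = (q s + (q s)⁻¹) • X1 s := by
    have := w1.EF 0
    rw [show pair 0 (1, 0) = 2 by decide, q2, E0X1, map_zero, zero_add] at this
    rw [dT1, this]
  have F0T1 : ad s (F s 0) (T1 s) = (q s + (q s)⁻¹) • Xm1 s := by
    have := wm1.FE 0 F0m1
    rw [show pair 0 (-1, 0) = -2 by decide, qint_neg, neg_neg, q2] at this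
    rw [← E0m1, this]
  have E1T1 : ad s (E s 1) (T1 s) = X2 s := by
    rw [dT1, rep_EF_ne (ad s) n10, dX2, dX12]
  have F1T1 : ad s (F s 1) (T1 s) = Xm2 s := by
    rw [← E0m1, ← rep_EF_ne (ad s) n01, dm2, dm12]
  have dT2 : T2 s = ad s (F s 1) (X2 s) := by rw [dT2', E1T1]
  have dT2m : ad s (E s 1) (Xm2 s) = T2 s := by
    have := wT1.EF 1
    rw [show pair 1 (0, 0) = 0 by decide, q0, zero_smul, add_zero] at this
    rw [← F1T1, this, dT2']
  have E1T2 : ad s (E s 1) (T2 s) = (q s + (q s)⁻¹) • X2 s := by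
    have := w2.EF 1
    rw [show pair 1 (0, 1) = 2 by decide, q2, E1X2, map_zero, zero_add] at this
    rw [dT2, this]
  have E0T2 : ad s (E s 0) (T2 s) = X1 s := by
    rw [dT2, rep_EF_ne (ad s) n01, E0X2, F1X12]
  have F1T2 : ad s (F s 1) (T2 s) = (q s + (q s)⁻¹) • Xm2 s := by
    have := wm2.FE 1 F1m2
    rw [show pair 1 (0, -1) = -2 by decide, qint_neg, neg_neg, q2] at this
    rw [← dT2m, this]
  have F0T2 : ad s (F s 0) (T2 s) = Xm1 s := by
    rw [← dT2m, ← rep_EF_ne (ad s) n10, F0m2, E1m12]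
  -- Moving `E 1` to the left gives `E 1` applied to `F 0` `F 0` `X1`, a multiple of `Xm1`, which `E
  -- 1` kills.
  have F0X2 : ad s (F s 0) (X2 s) = 0 := by
    rw [dX2, dX12, ← rep_EF_ne (ad s) n10, ← rep_EF_ne (ad s) n10, ← dT1, F0T1, map_smul, E1m1,
      smul_zero]
  have E0m2 : ad s (E s 0) (Xm2 s) = 0 := by
    rw [dm2, dm12, rep_EF_ne (ad s) n01, rep_EF_ne (ad s) n01, E0m1, E0T1, map_smul, F1X1,
      smul_zero]
  have F0X1 := dT1.symm
  have F0X12 := dX2.symm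
  have F1m1 := dm12.symm
  have E0m12 := dm2.symm
  have E1X1 := dX12.symm
  have F1X2 := dT2.symm
  constructor <;> intro a <;> cases a
  exacts [w12, w1, w2, wT1, wT2, wm1, wm2, wm12,
    E0X12, E0X1, E0X2, E0T1, E0T2, E0m1, E0m2, E0m12,
    E1X12, E1X1, E1X2, E1T1, E1T2, E1m1, dT2m, E1m12,
    F0X12, F0X1, F0X2, F0T1, F0T2, F0m1, F0m2, F0m12,
    F1X12, F1X1, F1X2, F1T1, F1T2, F1m1, F1m2, F1m12]

/-! ### The octet is linearly independent -/

theorem sum_Ix {M : Type*} [AddCommMonoid M] (f : Ix → M) : ∑ a, f a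
    = f .p12 + f .p1 + f .p2 + f .T1 + f .T2 + f .m1 + f .m2 + f .m12 := by
  simp [Finset.univ, Fintype.elems, add_assoc]

/-- Raising words carry a linear relation to multiples of `e .p12`. Longer words isolate the lowest
vectors, so the coefficients are eliminated from the bottom up. -/
theorem IsOctet.linearIndependent {s : Kˣ} (h : Generic s) {V : Type*} [AddCommGroup V]
    [Module K V] {ρ : U s →ₐ[K] Module.End K V} {e : Ix → V} (he : IsOctet ρ e)
    (h₀ : e .p12 ≠ 0) : LinearIndependent K e := by
  rw [Fintype.linearIndependent_iff]
  intro g hg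
  rw [sum_Ix] at hg
  have cancel : ∀ {c : K}, c • e .p12 = 0 → c = 0 := fun hc => (smul_eq_zero.1 hc).resolve_right h₀
  have m12 : g .m12 = 0 := cancel (by
    simpa [he.E0, he.E1, tabE0, tabE1] using
      congrArg (fun x => ρ (E s 0) (ρ (E s 1) (ρ (E s 0) (ρ (E s 1) x)))) hg)
  simp only [m12, zero_smul, add_zero] at hg
  have m1 : g .m1 = 0 := cancel (by
    simpa [he.E0, he.E1, tabE0, tabE1] using
      congrArg (fun x => ρ (E s 0) (ρ (E s 1) (ρ (E s 0) x))) hg)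
  have m2 : g .m2 = 0 := cancel (by
    simpa [he.E0, he.E1, tabE0, tabE1] using
      congrArg (fun x => ρ (E s 1) (ρ (E s 0) (ρ (E s 1) x))) hg)
  simp only [m1, m2, zero_smul, add_zero] at hg
  have t1 : g .T1 * (q s + (q s)⁻¹) + g .T2 = 0 := cancel (by
    simpa [he.E0, he.E1, tabE0, tabE1, smul_smul, ← add_smul, mul_comm] using
      congrArg (fun x => ρ (E s 1) (ρ (E s 0) x)) hg)
  have t2 : g .T1 + g .T2 * (q s + (q s)⁻¹) = 0 := cancel (by
    simpa [he.E0, he.E1, tabE0, tabE1, smul_smul, ← add_smul, mul_comm] using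
      congrArg (fun x => ρ (E s 0) (ρ (E s 1) x)) hg)
  have hq := q_ne_zero s
  -- The two equations have as matrix the q-Cartan matrix with rows ([2], 1) and (1, [2]), whose
  -- determinant is [2]² - 1 = [3].
  have T1 : g .T1 = 0 := by
    refine (mul_eq_zero.1 (?_ : (q s ^ 2 + 1 + (q s)⁻¹ ^ 2) * g .T1 = 0)).resolve_left h.three_ne
    field_simp at t1 t2 ⊢
    linear_combination (q s ^ 2 + 1) * t1 - q s * t2
  have T2 : g .T2 = 0 := by simpa [T1] using t1
  simp only [T1, T2, zero_smul, add_zero] at hg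
  have p1 : g .p1 = 0 := cancel (by
    simpa [he.E0, he.E1, tabE0, tabE1] using congrArg (fun x => ρ (E s 1) x) hg)
  have p2 : g .p2 = 0 := cancel (by
    simpa [he.E0, he.E1, tabE0, tabE1] using congrArg (fun x => ρ (E s 0) x) hg)
  have p12 : g .p12 = 0 := cancel (by simpa [p1, p2] using hg)
  intro a
  cases a <;> assumption

/-! ### The three-dimensional representation -/

section Three

variable {A : Type*} [Field A] [Algebra K A]

/-- The vector representation on the generators; `r` is a cube root of `s`. -/
def vecGen (r : A) : Gen → Matrix (Fin 3) (Fin 3) A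
  | .E i => if i = 0 then !![0, 1, 0; 0, 0, 0; 0, 0, 0] else !![0, 0, 0; 0, 0, 1; 0, 0, 0]
  | .F i => if i = 0 then !![0, 0, 0; 1, 0, 0; 0, 0, 0] else !![0, 0, 0; 0, 0, 0; 0, 1, 0]
  | .t μ => Matrix.diagonal ![r ^ (2 * μ 0 + μ 1), r ^ (-μ 0 + μ 1), r ^ (-μ 0 - 2 * μ 1)]

/-- The weights of the vector representation are thirds of integral combinations of roots, so q^μ
acts through powers of a cube root of `s`. The extension field `A` makes room for such a root. -/
theorem vec_rel {s : Kˣ} (hs : q s - (q s)⁻¹ ≠ 0) {r : A} (hr : r ^ 3 = algebraMap K A s)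
    ⦃x y : Free K⦄ (h : Rel s x y) :
    FreeAlgebra.lift K (vecGen r) x = FreeAlgebra.lift K (vecGen r) y := by
  have r0 : r ≠ 0 := by
    rintro rfl
    rw [zero_pow three_ne_zero] at hr
    exact s.ne_zero ((map_eq_zero _).1 hr.symm)
  have hz : ∀ n : ℤ, algebraMap K A ((s : K) ^ n) = r ^ (3 * n) := fun n => by
    rw [map_zpow₀, ← hr, zpow_mul, zpow_ofNat]
  have hq : algebraMap K A (q s) = r ^ 6 := by rw [q, map_pow, ← hr, ← pow_mul]
  cases h with
  | t_zero => 
    ext i j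
    fin_cases i <;> fin_cases j <;> simp [vecGen]
  | t_add μ ν =>
    simp only [map_mul, FreeAlgebra.lift_ι_apply, vecGen, Matrix.diagonal_mul_diagonal]
    congr 1
    ext i
    fin_cases i <;> simp [← zpow_add₀ r0] <;> ring_nf
  | t_E μ i =>
    simp only [map_mul, map_smul, FreeAlgebra.lift_ι_apply, vecGen]
    ext a b
    rw [Matrix.diagonal_mul, Matrix.smul_apply, Matrix.mul_diagonal, Algebra.smul_def, hz]
    fin_cases i <;> fin_cases a <;> fin_cases b <;> simp [← zpow_add₀ r0] <;> ring_nf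
  | t_F μ i =>
    simp only [map_mul, map_smul, FreeAlgebra.lift_ι_apply, vecGen]
    ext a b
    rw [Matrix.diagonal_mul, Matrix.smul_apply, Matrix.mul_diagonal, Algebra.smul_def, hz]
    fin_cases i <;> fin_cases a <;> fin_cases b <;>
      simp [← zpow_add₀ r0, -mul_neg, -zpow_neg] <;> ring_nf
  | E_F_same i =>
    have hq' : r ^ 6 - (r ^ 6)⁻¹ ≠ 0 := by
      rw [← hq, ← map_inv₀, ← map_sub]
      exact (map_ne_zero _).2 hs
    simp only [map_mul, map_smul, map_sub, FreeAlgebra.lift_ι_apply, vecGen]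
    ext a b
    rw [Matrix.smul_apply, Algebra.smul_def, map_inv₀, map_sub, map_inv₀, hq]
    fin_cases i <;> fin_cases a <;> fin_cases b <;>
      simp [H] <;>
      first
        | rw [inv_mul_cancel₀ hq']
        | rw [← neg_sub (r ^ 6), mul_neg, inv_mul_cancel₀ hq']
  | E_F_ne i j h =>
    simp only [map_mul, map_zero, map_sub, FreeAlgebra.lift_ι_apply, vecGen]
    fin_cases i <;> fin_cases j <;> simp at h ⊢ <;> ext a b <;>
      fin_cases a <;> fin_cases b <;> rfl
  | serre_E i j h =>
    rw [map_serre, map_zero]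
    simp only [serre, FreeAlgebra.lift_ι_apply, vecGen]
    fin_cases i <;> fin_cases j <;> simp at h ⊢ <;> ext a b <;>
      fin_cases a <;> fin_cases b <;> rfl
  | serre_F i j h =>
    rw [map_serre, map_zero]
    simp only [serre, FreeAlgebra.lift_ι_apply, vecGen]
    fin_cases i <;> fin_cases j <;> simp at h ⊢ <;> ext a b <;>
      fin_cases a <;> fin_cases b <;> rfl

end Three

/-- A presentation by relations gives no lower bound on the algebra; a representation does. In the
vector representation `E 1` `E 0` acts as zero and `E 0` `E 1` as the matrix unit at (0, 2), so that
entry of `X12` is nonzero. -/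
theorem X12_ne_zero {s : Kˣ} (h : Generic s) : X12 s ≠ 0 := by
  obtain ⟨r, hr⟩ := IsAlgClosed.exists_pow_nat_eq (algebraMap K (AlgebraicClosure K) s)
    (n := 3) (by norm_num)
  have r0 : r ≠ 0 := by
    rintro rfl
    rw [zero_pow three_ne_zero] at hr
    exact s.ne_zero ((map_eq_zero _).1 hr.symm)
  set f := lift s (vecGen r) (vec_rel h.q_sub_ne hr) with hf
  have fE : ∀ i, f (E s i) = vecGen r (.E i) := fun i => lift_mk s _ _ _
  have ft : ∀ μ, f (t s μ) = vecGen r (.t μ) := fun μ => lift_mk s _ _ _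
  intro e
  have := congrArg (fun x => f x 0 2) e
  rw [X12, X1, ad_E0_K0, map_smul, map_smul, ad_E] at this
  have hs := h.q_sub_ne
  have hs' : (s : K) ^ 2 - ((s : K) ^ 2)⁻¹ ≠ 0 := hs
  simp only [map_smul, map_sub, map_mul, fE, ft, map_zero, Matrix.sub_apply, Matrix.smul_apply,
    Matrix.mul_apply, Fin.sum_univ_three, vecGen, Matrix.diagonal_apply] at this
  simp [hs, hs', q_ne_zero, r0, zpow_ne_zero] at this

/-! ### The quantum Lie algebra -/

section Octet

variable {s : Kˣ} {V : Type*} [AddCommGroup V] [Module K V] {ρ : U s →ₐ[K] Module.End K V}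

theorem tab_mem (s : Kˣ) (e : Ix → V) (a : Ix) :
    tabE0 s e a ∈ Submodule.span K (Set.range e) ∧ tabE1 s e a ∈ Submodule.span K (Set.range e) ∧
    tabF0 s e a ∈ Submodule.span K (Set.range e) ∧
      tabF1 s e a ∈ Submodule.span K (Set.range e) := by
  have he : ∀ b, e b ∈ Submodule.span K (Set.range e) := fun b => Submodule.subset_span ⟨b, rfl⟩
  cases a <;> refine ⟨?_, ?_, ?_, ?_⟩ <;>
    first
      | exact Submodule.zero_mem _
      | exact he _
      | exact Submodule.smul_mem _ _ (he _)

theorem IsOctet.span_stable {e : Ix → V} (he : IsOctet ρ e) (u : U s) :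
    ∀ x ∈ Submodule.span K (Set.range e), ρ u x ∈ Submodule.span K (Set.range e) := by
  have key : ∀ f : Module.End K V, (∀ a, f (e a) ∈ Submodule.span K (Set.range e)) →
      ∀ x ∈ Submodule.span K (Set.range e), f x ∈ Submodule.span K (Set.range e) := by
    intro f hf x hx
    refine (Submodule.span_le (p := (Submodule.span K (Set.range e)).comap f)).2 ?_ hx
    rintro _ ⟨a, rfl⟩
    exact hf a
  apply stable_of_gens
  · intro i
    refine key _ fun a => ?_
    fin_cases i
    · exact (he.E0 a) ▸ (tab_mem s e a).1
    · exact (he.E1 a) ▸ (tab_mem s e a).2.1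
  · intro i
    refine key _ fun a => ?_
    fin_cases i
    · exact (he.F0 a) ▸ (tab_mem s e a).2.2.1
    · exact (he.F1 a) ▸ (tab_mem s e a).2.2.2
  · intro μ
    refine key _ fun a => ?_
    rw [he.wt a μ]
    exact Submodule.smul_mem _ _ (Submodule.subset_span ⟨a, rfl⟩)

/-- Being killed by `E 0` and `E 1` leaves only multiples of `b .p12`, which `F 0` sends to
multiples of `b .p2`. -/
theorem IsOctet.invariant_eq_zero (h : Generic s) {b : Module.Basis Ix K V} (he : IsOctet ρ b)
    {x : V} (hE : ∀ i, ρ (E s i) x = 0) (hF : ρ (F s 0) x = 0) : x = 0 := by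
  have hx := b.sum_repr x
  rw [sum_Ix] at hx
  generalize b.repr x = c at hx
  have e0 := hE 0
  have e1 := hE 1
  rw [← hx] at e0 e1 hF
  simp only [map_add, map_smul, he.E0, he.E1, he.F0, tabE0, tabE1, tabF0, smul_zero] at e0 e1 hF
  have p2 := congrArg (fun y => b.repr y .p12) e0
  have p1 := congrArg (fun y => b.repr y .p12) e1
  have p12 := congrArg (fun y => b.repr y .p2) hF
  have m1 := congrArg (fun y => b.repr y .T1) e0
  have m2 := congrArg (fun y => b.repr y .T2) e1
  have m12 := congrArg (fun y => b.repr y .m2) e0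
  have t1 := congrArg (fun y => b.repr y .p1) e0
  have t2 := congrArg (fun y => b.repr y .p2) e1
  simp at p2 p1 p12 m1 m2 m12 t1 t2
  have hq := q_ne_zero s
  have T1 : c .T1 = 0 := by
    refine (mul_eq_zero.1 (?_ : (q s ^ 2 + 1 + (q s)⁻¹ ^ 2) * c .T1 = 0)).resolve_left h.three_ne
    field_simp at t1 t2 ⊢
    linear_combination (q s ^ 2 + 1) * t1 - q s * t2
  have T2 : c .T2 = 0 := by simpa [T1] using t1
  rw [← hx]
  simp [*]

end Octet

/-- The quantum Lie algebra, as the span of its standard basis. -/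
def L0 (s : Kˣ) : Submodule K (U s) := Submodule.span K (Set.range (X s))

/-- The component of `q ^ (-4 λ)` in the quantum Lie algebra. -/
def kap (s : Kˣ) : U s :=
  ((q s ^ 2 + 1 + (q s)⁻¹ ^ 2)⁻¹ * (q s - (q s)⁻¹)) • ((q s + (q s)⁻¹) • T1 s - T2 s)

/-- The invariant component of `q ^ (-4 λ)`. -/
def C0 (s : Kˣ) : U s := K0 s - kap s

theorem X_mem (s : Kˣ) (a : Ix) : X s a ∈ L0 s := Submodule.subset_span ⟨a, rfl⟩

theorem kap_mem (s : Kˣ) : kap s ∈ L0 s :=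
  Submodule.smul_mem _ _ (Submodule.sub_mem _ (Submodule.smul_mem _ _ (X_mem s .T1)) (X_mem s .T2))

theorem ad_mem_L0 {s : Kˣ} (h : Generic s) (u : U s) : ∀ x ∈ L0 s, ad s u x ∈ L0 s :=
  (isOctet_X h).span_stable u

theorem counit_X (s : Kˣ) (a : Ix) : counit s (X s a) = 0 := by
  cases a <;> simp [X, X1, X2, X12, Xm1, Xm2, Xm12, T1, T2, counit_ad]

theorem counit_L0 (s : Kˣ) {x : U s} (hx : x ∈ L0 s) : counit s x = 0 := by
  refine (Submodule.span_le (p := LinearMap.ker (counit s).toLinearMap)).2 ?_ hx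
  rintro _ ⟨a, rfl⟩
  exact counit_X s a

theorem counit_C0 (s : Kˣ) : counit s (C0 s) = 1 := by
  rw [C0, map_sub, counit_L0 s (kap_mem s), K0, counit_t, sub_zero]

/-- `kap` is the weight-zero combination of `T1` and `T2` on which `E 0` and `E 1` act as on `K0`.
The q-Cartan matrix determines it, whence the inverse of its determinant [3]; the `F i` then agree
as well. -/
theorem ad_C0 {s : Kˣ} (h : Generic s) (u : U s) : ad s u (C0 s) = counit s u • C0 s := by
  have hX := isOctet_X h
  have hs := h.q_sub_ne
  have h3 := h.three_ne
  have hq := q_ne_zero s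
  have c0 : ad s (E s 0) (K0 s) = (q s - (q s)⁻¹) • X s .p1 := by
    rw [X, X1, smul_smul, mul_inv_cancel₀ hs, one_smul]
  have c1 : ad s (F s 0) (K0 s) = (q s - (q s)⁻¹) • X s .m1 := by
    rw [X, Xm1, smul_smul, mul_inv_cancel₀ hs, one_smul]
  have hk : kap s = ((q s ^ 2 + 1 + (q s)⁻¹ ^ 2)⁻¹ * (q s - (q s)⁻¹)) •
      ((q s + (q s)⁻¹) • X s .T1 - X s .T2) := rfl
  have coef : (q s ^ 2 + 1 + (q s)⁻¹ ^ 2)⁻¹ * (q s - (q s)⁻¹) *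
      ((q s + (q s)⁻¹) * (q s + (q s)⁻¹) - 1) = q s - (q s)⁻¹ := by
    have : (q s + (q s)⁻¹) * (q s + (q s)⁻¹) - 1 = q s ^ 2 + 1 + (q s)⁻¹ ^ 2 := by
      field_simp
      ring
    rw [this, mul_right_comm, inv_mul_cancel₀ h3, one_mul]
  have hE : ∀ i, ad s (E s i) (C0 s) = 0 := by
    intro i
    rw [C0, hk]
    fin_cases i
    · simp only [Fin.zero_eta, map_sub, map_smul, c0, hX.E0, tabE0]
      trans ((q s - (q s)⁻¹) - (q s ^ 2 + 1 + (q s)⁻¹ ^ 2)⁻¹ * (q s - (q s)⁻¹) *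
        ((q s + (q s)⁻¹) * (q s + (q s)⁻¹) - 1)) • X s .p1
      · module
      · rw [coef, sub_self, zero_smul]
    · simp only [Fin.mk_one, map_sub, map_smul, ad_E1_K0, hX.E1, tabE1]
      module
  have hF : ∀ i, ad s (F s i) (C0 s) = 0 := by
    intro i
    rw [C0, hk]
    fin_cases i
    · simp only [Fin.zero_eta, map_sub, map_smul, c1, hX.F0, tabF0]
      trans ((q s - (q s)⁻¹) - (q s ^ 2 + 1 + (q s)⁻¹ ^ 2)⁻¹ * (q s - (q s)⁻¹) *
        ((q s + (q s)⁻¹) * (q s + (q s)⁻¹) - 1)) • X s .m1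
      · module
      · rw [coef, sub_self, zero_smul]
    · simp only [Fin.mk_one, map_sub, map_smul, ad_F1_K0, hX.F1, tabF1]
      module
  have ht : ∀ μ, ad s (t s μ) (C0 s) = C0 s := by
    intro μ
    rw [C0, hk]
    simp only [map_sub, map_smul, wt_K0 s μ, hX.wt _ μ, Ix.wt]
    simp
  induction u using U_induction with
  | hE i => rw [hE, counit_E, zero_smul]
  | hF i => rw [hF, counit_F, zero_smul]
  | ht μ => rw [ht, counit_t, one_smul]
  | hc c => simp
  | hadd u v hu hv => simp [hu, hv, add_smul]
  | hmul u v hu hv => simp [hu, hv, smul_smul, mul_comm]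

theorem ad_mem_Lbar (s : Kˣ) (u : U s) : ∀ x ∈ Lbar s, ad s u x ∈ Lbar s := by
  rintro _ ⟨v, rfl⟩
  exact ⟨u * v, by simp [bracket]⟩

theorem K0_mem_Lbar (s : Kˣ) : K0 s ∈ Lbar s := ⟨1, by simp [bracket]⟩

/-- A submodule for the adjoint action which contains the two vectors generating the octet. -/
theorem L0_le {s : Kˣ} {N : Submodule K (U s)} (hN : ∀ u, ∀ x ∈ N, ad s u x ∈ N)
    (h1 : X1 s ∈ N) (hm1 : Xm1 s ∈ N) : L0 s ≤ N := by
  refine Submodule.span_le.2 ?_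
  have hT1 : T1 s ∈ N := by
    have := hN (F s 0) _ h1
    rwa [X1, map_smul, ← Module.End.mul_apply, ← map_mul] at this
  rintro _ ⟨a, rfl⟩
  cases a
  exacts [hN _ _ h1, h1, hN _ _ (hN _ _ h1), hT1, hN _ _ hT1, hm1, hN _ _ (hN _ _ hm1), hN _ _ hm1]

theorem L0_le_Lbar (s : Kˣ) : L0 s ≤ Lbar s :=
  L0_le (ad_mem_Lbar s) (Submodule.smul_mem _ _ (ad_mem_Lbar s _ _ (K0_mem_Lbar s)))
    (Submodule.smul_mem _ _ (ad_mem_Lbar s _ _ (K0_mem_Lbar s)))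

/-- The sum is `Lbar` because `K0 s = C0 s + kap s`; the counit makes it direct. -/
theorem isQuantumLie_L0 {s : Kˣ} (h : Generic s) : IsQuantumLie s (C0 s) (L0 s) where
  ad_mem := ad_mem_L0 h
  ad_C := ad_C0 h
  C_ne_zero := fun e => one_ne_zero (by rw [← counit_C0 s, e, map_zero])
  disjoint := by
    rw [Submodule.disjoint_def]
    intro x hx hx'
    obtain ⟨c, rfl⟩ := Submodule.mem_span_singleton.1 hx
    have := counit_L0 s hx'
    rw [map_smul, counit_C0, smul_eq_mul, mul_one] at this
    rw [this, zero_smul]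
  sup_eq := by
    apply le_antisymm
    · refine sup_le ?_ (L0_le_Lbar s)
      rw [Submodule.span_singleton_le_iff_mem]
      exact Submodule.sub_mem _ (K0_mem_Lbar s) (L0_le_Lbar s (kap_mem s))
    · rintro _ ⟨u, rfl⟩
      have e : K0 s = C0 s + kap s := by rw [C0, sub_add_cancel]
      change ad s u (K0 s) ∈ _
      rw [e, map_add, ad_C0 h]
      exact Submodule.add_mem_sup (Submodule.smul_mem _ _ (Submodule.mem_span_singleton_self _))
        (ad_mem_L0 h u _ (kap_mem s))
  K0_sub_mem := by
    rw [C0, sub_sub_cancel]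
    exact kap_mem s

/-- The standard basis of the quantum Lie algebra. -/
def basisL0 {s : Kˣ} (h : Generic s) : Module.Basis Ix K (L0 s) :=
  Module.Basis.span ((isOctet_X h).linearIndependent h (X12_ne_zero h))

@[simp] theorem coe_basisL0 {s : Kˣ} (h : Generic s) (a : Ix) : (basisL0 h a : U s) = X s a :=
  congrArg Subtype.val (Module.Basis.span_apply _ a)

theorem adOn_coe (s : Kˣ) (L : Submodule K (U s)) (hL : ∀ u, ∀ x ∈ L, ad s u x ∈ L) (u : U s)
    (x : L) : (adOn s L hL u x : U s) = ad s u x := rfl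

theorem isOctet_basisL0 {s : Kˣ} (h : Generic s) :
    IsOctet (adOn s (L0 s) (ad_mem_L0 h)) (basisL0 h) := by
  have hX := isOctet_X h
  constructor
  · intro a μ
    ext
    simp [adOn_coe, hX.wt a μ]
  · intro a
    ext
    rw [adOn_coe, coe_basisL0, hX.E0]
    cases a <;> simp [tabE0]
  · intro a
    ext
    rw [adOn_coe, coe_basisL0, hX.E1]
    cases a <;> simp [tabE1]
  · intro a
    ext
    rw [adOn_coe, coe_basisL0, hX.F0]
    cases a <;> simp [tabF0]
  · intro a
    ext
    rw [adOn_coe, coe_basisL0, hX.F1]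
    cases a <;> simp [tabF1]

/-- Elements of counit zero act alike on `K0` and on `K0 - C`, so `L` contains `X1` and `Xm1`, hence
`L0`. Writing C as `ad u` of `K0`, the difference `C - C0 s` equals `ad u` of `kap`: an invariant in
the octet, hence zero. Comparing the two decompositions of `Lbar` then gives `L = L0 s`. -/
theorem IsQuantumLie.unique {s : Kˣ} (h : Generic s) {C : U s} {L : Submodule K (U s)}
    (hL : IsQuantumLie s C L) : C = C0 s ∧ L = L0 s := by
  have inv : ∀ u, counit s u = 0 → ad s u (K0 s) = ad s u (K0 s - C) := fun u hu => by
    rw [map_sub, hL.ad_C, hu, zero_smul, sub_zero]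
  have le : L0 s ≤ L := by
    apply L0_le hL.ad_mem
    · rw [X1, inv _ (counit_E s 0)]
      exact Submodule.smul_mem _ _ (hL.ad_mem _ _ hL.K0_sub_mem)
    · rw [Xm1, inv _ (counit_F s 0)]
      exact Submodule.smul_mem _ _ (hL.ad_mem _ _ hL.K0_sub_mem)
  have disj := Submodule.disjoint_def.1 hL.disjoint
  have hC : C - C0 s ∈ L0 s := by
    obtain ⟨u, hu⟩ : C ∈ Lbar s :=
      hL.sup_eq ▸ Submodule.mem_sup_left (Submodule.mem_span_singleton_self C)
    have hu : ad s u (K0 s) = C := hu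
    -- `ad u` maps `K0 - C`, an element of L, to `C - counit s u • C`, and L meets the line of C
    -- trivially.
    have e : counit s u = 1 := by
      have h1 : (1 - counit s u) • C ∈ L := by
        have := hL.ad_mem u _ hL.K0_sub_mem
        rwa [map_sub, hu, hL.ad_C, ← one_smul K C, smul_smul, mul_one, ← sub_smul] at this
      have := disj _ (Submodule.smul_mem _ _ (Submodule.mem_span_singleton_self C)) h1
      rw [smul_eq_zero, or_iff_left hL.C_ne_zero, sub_eq_zero] at this
      exact this.symm
    have := ad_mem_L0 h u _ (kap_mem s)
    rwa [← sub_sub_cancel (K0 s) (kap s), map_sub, hu, ← C0, ad_C0 h, e, one_smul] at this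
  have hCC : C = C0 s := by
    have hE : ∀ u, counit s u = 0 →
        adOn s (L0 s) (ad_mem_L0 h) u ⟨C - C0 s, hC⟩ = 0 := by
      intro u hu
      ext
      simp [adOn_coe, hL.ad_C, ad_C0 h, hu]
    have := (isOctet_basisL0 h).invariant_eq_zero h (fun i => hE _ (counit_E s i))
      (hE _ (counit_F s 0))
    exact sub_eq_zero.1 (congrArg Subtype.val this)
  refine ⟨hCC, le_antisymm (fun x hx => ?_) le⟩
  have hx' : x ∈ Lbar s := hL.sup_eq ▸ Submodule.mem_sup_right hx
  rw [← (isQuantumLie_L0 h).sup_eq] at hx'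
  obtain ⟨y, hy, z, hz, rfl⟩ := Submodule.mem_sup.1 hx'
  have : y = 0 := disj y (hCC ▸ hy) (by simpa using L.sub_mem hx (le hz))
  rwa [this, zero_add]

theorem finrank_L0 {s : Kˣ} (h : Generic s) : Module.finrank K (L0 s) = 8 := by
  rw [Module.finrank_eq_card_basis (basisL0 h)]
  rfl

/-! ### Highest-weight vectors in the tensor square of the octet -/

theorem Generic.zpow_inj {s : Kˣ} (h : Generic s) {m n : ℤ} (hm : m - n ≤ 6) (hn : n - m ≤ 6)
    (e : q s ^ m = q s ^ n) : m = n := by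
  have hq := q_ne_zero s
  have key : ∀ {k l : ℤ}, 0 < k - l → k - l ≤ 6 → q s ^ k ≠ q s ^ l := by
    intro k l h₀ h₁ e
    obtain ⟨d, hd⟩ := Int.eq_ofNat_of_zero_le h₀.le
    refine h.pow_ne_one (n := d) (by omega) (by omega) ?_
    rw [← zpow_natCast, ← show k - l = (d : ℤ) from hd, zpow_sub₀ hq, e,
      div_self (zpow_ne_zero _ hq)]
  rcases lt_trichotomy m n with hlt | heq | hgt
  · exact absurd e.symm (key (by omega) hn)
  · exact heq
  · exact absurd e (key (by omega) hm)

instance : Fintype Summand :=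
  ⟨{.m27, .m10, .m10star, .m8a, .m8s, .m1}, fun a => by cases a <;> decide⟩

theorem sum_Summand {M : Type*} [AddCommMonoid M] (f : Summand → M) : ∑ a, f a
    = f .m27 + f .m10 + f .m10star + f .m8a + f .m8s + f .m1 := by
  simp [Finset.univ, Fintype.elems, add_assoc]

/-- The highest-weight vectors, in terms of a standard basis of the octet. -/
def hwv {V : Type*} [AddCommGroup V] [Module K V] (s : Kˣ) (e : Ix → V) :
    Summand → V ⊗[K] V
  | .m27 => e .p12 ⊗ₜ e .p12
  | .m10 => qh s 1 • (e .p1 ⊗ₜ e .p12) - qh s (-1) • (e .p12 ⊗ₜ e .p1)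
  | .m10star => qh s 1 • (e .p2 ⊗ₜ e .p12) - qh s (-1) • (e .p12 ⊗ₜ e .p2)
  | .m8a =>
    qh s 3 • (e .p1 ⊗ₜ e .p2) - qh s (-3) • (e .p2 ⊗ₜ e .p1)
      - q s • ((q s • e .T1 - e .T2) ⊗ₜ e .p12)
      + (q s)⁻¹ • (e .p12 ⊗ₜ ((q s)⁻¹ • e .T1 - e .T2))
  | .m8s =>
    (qh s 5 * (q s + (q s)⁻¹) + qh s (-5)) • (e .p1 ⊗ₜ e .p2)
      + (qh s (-5) * (q s + (q s)⁻¹) + qh s 5) • (e .p2 ⊗ₜ e .p1)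
      - (q s ^ 4 • e .T1 + (q s)⁻¹ • e .T2) ⊗ₜ e .p12
      - e .p12 ⊗ₜ ((q s)⁻¹ ^ 4 • e .T1 + q s • e .T2)
  | .m1 =>
    e .T1 ⊗ₜ e .T2 + e .T2 ⊗ₜ e .T1 - (q s + (q s)⁻¹) • (e .T1 ⊗ₜ e .T1 + e .T2 ⊗ₜ e .T2)
      + (q s ^ 2 + 1 + (q s)⁻¹ ^ 2) •
        ((q s)⁻¹ • (e .p1 ⊗ₜ e .m1) + q s • (e .m1 ⊗ₜ e .p1)
          + (q s)⁻¹ • (e .p2 ⊗ₜ e .m2) + q s • (e .m2 ⊗ₜ e .p2)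
          - (q s)⁻¹ ^ 2 • (e .p12 ⊗ₜ e .m12) - q s ^ 2 • (e .m12 ⊗ₜ e .p12))

theorem hwv_X (s : Kˣ) : hwv s (X s) = W s := by
  ext i
  cases i <;> rfl

section Octet

variable {s : Kˣ} {V : Type*} [AddCommGroup V] [Module K V] {ρ : U s →ₐ[K] Module.End K V}

theorem IsWt.tH {a : ℤ × ℤ} {x : V} (hx : IsWt ρ a x) (i : Fin 2) :
    ρ (t s (H i)) x = (s : K) ^ pair i a • x := by
  rw [hx]
  congr 2
  fin_cases i <;> simp [H, pair] <;> ring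

theorem IsWt.t_neg_H {a : ℤ × ℤ} {x : V} (hx : IsWt ρ a x) (i : Fin 2) :
    ρ (t s (-H i)) x = (s : K) ^ (-pair i a) • x := by
  rw [hx]
  congr 2
  fin_cases i <;> simp [H, pair] <;> ring

variable {e : Ix → V} (he : IsOctet ρ e)
include he

theorem IsOctet.diag_E0 (a b : Ix) : diag ρ (E s 0) (e a ⊗ₜ e b)
    = (s : K) ^ (-pair 0 b.wt) • (tabE0 s e a ⊗ₜ[K] e b)
      + (s : K) ^ pair 0 a.wt • (e a ⊗ₜ[K] tabE0 s e b) := by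
  rw [diag_E, he.E0, he.E0, (he.wt b).t_neg_H, (he.wt a).tH, TensorProduct.tmul_smul,
    ← TensorProduct.smul_tmul']

theorem IsOctet.diag_E1 (a b : Ix) : diag ρ (E s 1) (e a ⊗ₜ e b)
    = (s : K) ^ (-pair 1 b.wt) • (tabE1 s e a ⊗ₜ[K] e b)
      + (s : K) ^ pair 1 a.wt • (e a ⊗ₜ[K] tabE1 s e b) := by
  rw [diag_E, he.E1, he.E1, (he.wt b).t_neg_H, (he.wt a).tH, TensorProduct.tmul_smul,
    ← TensorProduct.smul_tmul']

theorem IsOctet.diag_F0 (a b : Ix) : diag ρ (F s 0) (e a ⊗ₜ e b)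
    = (s : K) ^ (-pair 0 b.wt) • (tabF0 s e a ⊗ₜ[K] e b)
      + (s : K) ^ pair 0 a.wt • (e a ⊗ₜ[K] tabF0 s e b) := by
  rw [diag_F, he.F0, he.F0, (he.wt b).t_neg_H, (he.wt a).tH, TensorProduct.tmul_smul,
    ← TensorProduct.smul_tmul']

theorem IsOctet.diag_F1 (a b : Ix) : diag ρ (F s 1) (e a ⊗ₜ e b)
    = (s : K) ^ (-pair 1 b.wt) • (tabF1 s e a ⊗ₜ[K] e b)
      + (s : K) ^ pair 1 a.wt • (e a ⊗ₜ[K] tabF1 s e b) := by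
  rw [diag_F, he.F1, he.F1, (he.wt b).t_neg_H, (he.wt a).tH, TensorProduct.tmul_smul,
    ← TensorProduct.smul_tmul']

theorem IsOctet.E_hwv (i : Summand) (j : Fin 2) : diag ρ (E s j) (hwv s e i) = 0 := by
  have hs := s.ne_zero
  fin_cases j <;> cases i <;>
    simp only [Fin.zero_eta, Fin.mk_one, hwv, qh, q, TensorProduct.add_tmul,
      TensorProduct.tmul_add, TensorProduct.sub_tmul, TensorProduct.tmul_sub,
      ← TensorProduct.smul_tmul', TensorProduct.tmul_smul, map_add, map_sub, map_smul,
      he.diag_E0, he.diag_E1, tabE0, tabE1, pair, Ix.wt, TensorProduct.zero_tmul,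
      TensorProduct.tmul_zero, smul_zero, add_zero, zero_add, sub_zero, if_true,
      one_ne_zero, if_false, zpow_neg, zpow_ofNat (s : K) 2, zpow_ofNat (s : K) 3,
      zpow_ofNat (s : K) 5, zpow_one, zpow_zero, neg_zero, Int.reduceMul,
      Int.reduceSub, Int.reduceNeg, mul_zero, mul_one, neg_neg] <;>
    match_scalars <;> field_simp <;> ring

theorem IsOctet.wt_hwv (i : Summand) : IsWt (diag ρ) i.weight (hwv s e i) := by
  have hw : ∀ {a b c : ℤ × ℤ} {x y : V}, IsWt ρ a x → IsWt ρ b y → a + b = c →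
      IsWt (diag ρ) c (x ⊗ₜ[K] y) := fun hx hy hc => hc ▸ hx.tmul hy
  have wp12 := he.wt .p12
  have wT1 := he.wt .T1
  have wT2 := he.wt .T2
  cases i
  · exact hw wp12 wp12 (by decide)
  · exact ((hw (he.wt .p1) wp12 (by decide)).smul _).sub
      ((hw wp12 (he.wt .p1) (by decide)).smul _)
  · exact ((hw (he.wt .p2) wp12 (by decide)).smul _).sub
      ((hw wp12 (he.wt .p2) (by decide)).smul _)
  · exact ((((hw (he.wt .p1) (he.wt .p2) (by decide)).smul _).sub
      ((hw (he.wt .p2) (he.wt .p1) (by decide)).smul _)).sub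
      ((hw ((wT1.smul _).sub wT2) wp12 (by decide)).smul _)).add
      ((hw wp12 ((wT1.smul _).sub wT2) (by decide)).smul _)
  · exact ((((hw (he.wt .p1) (he.wt .p2) (by decide)).smul _).add
      ((hw (he.wt .p2) (he.wt .p1) (by decide)).smul _)).sub
      (hw ((wT1.smul _).add (wT2.smul _)) wp12 (by decide))).sub
      (hw wp12 ((wT1.smul _).add (wT2.smul _)) (by decide))
  · exact (((hw wT1 wT2 (by decide)).add (hw wT2 wT1 (by decide))).sub
      (((hw wT1 wT1 (by decide)).add (hw wT2 wT2 (by decide))).smul _)).add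
      (((((((hw (he.wt .p1) (he.wt .m1) (by decide)).smul _).add
      ((hw (he.wt .m1) (he.wt .p1) (by decide)).smul _)).add
      ((hw (he.wt .p2) (he.wt .m2) (by decide)).smul _)).add
      ((hw (he.wt .m2) (he.wt .p2) (by decide)).smul _)).sub
      ((hw wp12 (he.wt .m12) (by decide)).smul _)).sub
      ((hw (he.wt .m12) wp12 (by decide)).smul _)|>.smul _)

end Octet

/-! ### Classification of the highest-weight vectors -/

section Slots

variable {V : Type*} [AddCommGroup V] [Module K V] (b : Module.Basis Ix K V)

/-- The components of a tensor with respect to a basis of the second factor. -/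
def slot (c : Ix) : V ⊗[K] V →ₗ[K] V :=
  (TensorProduct.rid K V).toLinearMap ∘ₗ LinearMap.lTensor V (b.coord c)

theorem slot_tmul (c : Ix) (x y : V) : slot b c (x ⊗ₜ y) = b.repr y c • x := by
  simp [slot]

theorem sum_slot (z : V ⊗[K] V) : ∑ c, slot b c z ⊗ₜ[K] b c = z := by
  induction z with
  | zero => simp
  | add z z' hz hz' => simp only [map_add, TensorProduct.add_tmul, Finset.sum_add_distrib, hz, hz']
  | tmul x y =>
    simp only [slot_tmul, TensorProduct.smul_tmul]
    rw [← TensorProduct.tmul_sum, b.sum_repr]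

variable {s : Kˣ} {ρ : U s →ₐ[K] Module.End K V} {b} (he : IsOctet ρ b)
include he

theorem IsOctet.diag_E0_slot (x : V) (c : Ix) : diag ρ (E s 0) (x ⊗ₜ b c)
    = (s : K) ^ (-pair 0 c.wt) • (ρ (E s 0) x ⊗ₜ[K] b c)
      + ρ (t s (H 0)) x ⊗ₜ[K] tabE0 s b c := by
  rw [diag_E, he.E0, (he.wt c).t_neg_H, TensorProduct.tmul_smul]

theorem IsOctet.diag_E1_slot (x : V) (c : Ix) : diag ρ (E s 1) (x ⊗ₜ b c)
    = (s : K) ^ (-pair 1 c.wt) • (ρ (E s 1) x ⊗ₜ[K] b c)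
      + ρ (t s (H 1)) x ⊗ₜ[K] tabE1 s b c := by
  rw [diag_E, he.E1, (he.wt c).t_neg_H, TensorProduct.tmul_smul]

/-- Components of `E i` z = 0 along the basis of the second factor. Each relates `E i` of one slot
to the slots below it; only those used later are recorded. -/
theorem IsOctet.slot_eq (z : V ⊗[K] V) (hz : ∀ i, diag ρ (E s i) z = 0) :
    ((s : K) ^ (-1 : ℤ) • ρ (E s 0) (slot b .p12 z) + ρ (t s (H 0)) (slot b .p2 z) = 0 ∧
      (s : K) ^ (-2 : ℤ) • ρ (E s 0) (slot b .p1 z)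
        + ρ (t s (H 0)) ((q s + (q s)⁻¹) • slot b .T1 z + slot b .T2 z) = 0 ∧
      (s : K) ^ (1 : ℤ) • ρ (E s 0) (slot b .p2 z) = 0 ∧
      ρ (E s 0) (slot b .T1 z) + ρ (t s (H 0)) (slot b .m1 z) = 0 ∧
      (s : K) ^ (-1 : ℤ) • ρ (E s 0) (slot b .m2 z) + ρ (t s (H 0)) (slot b .m12 z) = 0) ∧
    ((s : K) ^ (-1 : ℤ) • ρ (E s 1) (slot b .p12 z) + ρ (t s (H 1)) (slot b .p1 z) = 0 ∧
      (s : K) ^ (-2 : ℤ) • ρ (E s 1) (slot b .p2 z)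
        + ρ (t s (H 1)) (slot b .T1 z + (q s + (q s)⁻¹) • slot b .T2 z) = 0 ∧
      (s : K) ^ (1 : ℤ) • ρ (E s 1) (slot b .p1 z) = 0 ∧
      ρ (E s 1) (slot b .T2 z) + ρ (t s (H 1)) (slot b .m2 z) = 0) := by
  set y := fun c => slot b c z with hy
  have hz0 := hz 0
  have hz1 := hz 1
  rw [← sum_slot b z] at hz0 hz1
  change diag ρ _ (∑ c, y c ⊗ₜ b c) = 0 at hz0 hz1
  have key := fun c => congrArg (slot b c) hz0
  have key1 := fun c => congrArg (slot b c) hz1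
  simp only [sum_Ix, map_add, he.diag_E0_slot, tabE0, map_zero, map_smul, slot_tmul, b.repr_self,
    Finsupp.single_apply, TensorProduct.tmul_smul, TensorProduct.tmul_zero] at key
  simp only [sum_Ix, map_add, he.diag_E1_slot, tabE1, map_zero, map_smul, slot_tmul, b.repr_self,
    Finsupp.single_apply, TensorProduct.tmul_smul, TensorProduct.tmul_zero] at key1
  refine ⟨⟨?_, ?_, ?_, ?_, ?_⟩, ?_, ?_, ?_, ?_⟩
  · simpa [pair, Ix.wt] using key .p12
  · simpa [pair, Ix.wt, add_assoc] using key .p1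
  · simpa [pair, Ix.wt] using key .p2
  · simpa [pair, Ix.wt] using key .T1
  · simpa [pair, Ix.wt] using key .m2
  · simpa [pair, Ix.wt] using key1 .p12
  · simpa [pair, Ix.wt, add_assoc] using key1 .p2
  · simpa [pair, Ix.wt] using key1 .p1
  · simpa [pair, Ix.wt] using key1 .T2

/-- The system of `slot_eq` is triangular and the q^μ are invertible, so the top slot determines all
lower ones. The two weight-zero slots are separated by the q-Cartan determinant [3]. -/
theorem IsOctet.eq_zero_of_slot (h : Generic s) {z : V ⊗[K] V}
    (hz : ∀ i, diag ρ (E s i) z = 0) (h₀ : slot b .p12 z = 0) : z = 0 := by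
  have tinj : ∀ (μ : Weight) (x : V), ρ (t s μ) x = 0 → x = 0 := fun μ x hx => by
    rw [← rep_t_neg' ρ μ x, hx, map_zero]
  obtain ⟨⟨e1, e2, -, e4, e5⟩, f1, f2, -, f4⟩ := he.slot_eq z hz
  rw [h₀, map_zero, smul_zero, zero_add] at e1 f1
  have y2 := tinj _ _ e1
  have y1 := tinj _ _ f1
  rw [y1, map_zero, smul_zero, zero_add] at e2
  rw [y2, map_zero, smul_zero, zero_add] at f2
  have e2 := tinj _ _ e2
  have f2 := tinj _ _ f2
  have hq := q_ne_zero s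
  have T1 : slot b .T1 z = 0 := by
    refine (smul_eq_zero.1 (?_ : (q s ^ 2 + 1 + (q s)⁻¹ ^ 2) • slot b .T1 z = 0)).resolve_left
      h.three_ne
    trans (q s + (q s)⁻¹) • ((q s + (q s)⁻¹) • slot b .T1 z + slot b .T2 z)
      - (slot b .T1 z + (q s + (q s)⁻¹) • slot b .T2 z)
    · match_scalars <;> field_simp <;> ring
    · rw [e2, f2, smul_zero, sub_zero]
  have T2 : slot b .T2 z = 0 := by rwa [T1, smul_zero, zero_add] at e2
  rw [T1, map_zero, zero_add] at e4
  rw [T2, map_zero, zero_add] at f4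
  have m1 := tinj _ _ e4
  have m2 := tinj _ _ f4
  rw [m2, map_zero, smul_zero, zero_add] at e5
  have m12 := tinj _ _ e5
  rw [← sum_slot b z, sum_Ix, h₀, y1, y2, T1, T2, m1, m2, m12]
  simp only [TensorProduct.zero_tmul, add_zero]

/-- The equations for the slots `p12`, `p2` and `p1` show that `E 0 * E 0` and `E 1 * E 1` kill the
top slot. These operators send `b .m1` and `b .m2` to [2] times `b .p1` and `b .p2`. -/
theorem IsOctet.slot_mem (h : Generic s) {z : V ⊗[K] V} (hz : ∀ i, diag ρ (E s i) z = 0) :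
    b.repr (slot b .p12 z) .m1 = 0 ∧ b.repr (slot b .p12 z) .m2 = 0 := by
  obtain ⟨⟨e1, -, e3, -, -⟩, f1, -, f3, -⟩ := he.slot_eq z hz
  have hs := zpow_ne_zero (-1) s.ne_zero
  have two := h.two_ne
  have tE : ∀ (i : Fin 2) (x : V), ρ (E s i) x = 0 → ρ (E s i) (ρ (t s (H i)) x) = 0 := by
    intro i x hx
    have := congrArg (fun u => ρ u x) (E_t s (H i) i)
    simpa [hx] using this
  rw [smul_eq_zero, or_iff_right (zpow_ne_zero _ s.ne_zero)] at e3 f3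
  have e := congrArg (ρ (E s 0)) e1
  have f := congrArg (ρ (E s 1)) f1
  rw [map_add, tE _ _ e3, add_zero, map_smul, map_zero, smul_eq_zero, or_iff_right hs] at e
  rw [map_add, tE _ _ f3, add_zero, map_smul, map_zero, smul_eq_zero, or_iff_right hs] at f
  generalize slot b .p12 z = y at e f
  have hy := b.sum_repr y
  rw [sum_Ix] at hy
  generalize b.repr y = c at hy
  rw [← hy] at e f
  simp only [map_add, map_smul, he.E0, he.E1, tabE0, tabE1, smul_zero, zero_add,
    add_zero] at e f
  have m1 := congrArg (fun y => b.repr y .p1) e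
  have m2 := congrArg (fun y => b.repr y .p2) f
  simp at m1 m2
  exact ⟨(mul_eq_zero.1 (by linear_combination m1 : (q s + (q s)⁻¹) * c .m1 = 0)).resolve_left two,
    (mul_eq_zero.1 (by linear_combination m2 : (q s + (q s)⁻¹) * c .m2 = 0)).resolve_left two⟩

/-- By `slot_mem` the top slot lies in a six-dimensional space, which the top slots of the six
vectors already span; by `eq_zero_of_slot` matching top slots suffices. -/
theorem IsOctet.hw_mem_span (h : Generic s) {z : V ⊗[K] V} (hz : ∀ i, diag ρ (E s i) z = 0) :
    ∃ α : Summand → K, z = ∑ i, α i • hwv s b i := by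
  obtain ⟨m1, m2⟩ := he.slot_mem h hz
  have hs := s.ne_zero
  have hq := q_ne_zero s
  have h3 := h.three_ne
  have h4 : q s ^ 4 + 1 ≠ 0 := by
    intro e
    refine h.q2_add_ne ?_
    field_simp
    linear_combination e
  have hy := b.sum_repr (slot b .p12 z)
  rw [sum_Ix, m1, m2, zero_smul, add_zero, zero_smul, add_zero] at hy
  generalize b.repr (slot b .p12 z) = c at hy
  obtain ⟨x, hx⟩ : ∃ x, x = q s ^ 2 + 1 + (q s)⁻¹ ^ 2 := ⟨_, rfl⟩
  rw [← hx] at h3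
  -- The top slots of the octet vectors contribute -q² T1 + q T2 and -q⁴ T1 - q⁻¹ T2. `S` is the
  -- coefficient of the second in the solution of this two-by-two system, solvable as q⁴ + 1 ≠ 0.
  let S := -(c .T1 + q s * c .T2) / (q s ^ 4 + 1)
  let α : Summand → K := fun
    | .m27 => c .p12
    | .m10 => (qh s 1)⁻¹ * c .p1
    | .m10star => (qh s 1)⁻¹ * c .p2
    | .m8a => (c .T2 + (q s)⁻¹ * S) / q s
    | .m8s => S
    | .m1 => -x⁻¹ * (q s ^ 2)⁻¹ * c .m12
  refine ⟨α, sub_eq_zero.1 (he.eq_zero_of_slot h (fun i => ?_) ?_)⟩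
  · simp [map_sub, hz, he.E_hwv]
  · rw [map_sub, ← hy, map_sum, sum_Summand]
    have h1 : qh s 1 ≠ 0 := zpow_ne_zero _ hs
    simp only [α, S, ← hx, map_smul, hwv, map_add, map_sub, slot_tmul, b.repr_self,
      Finsupp.single_apply,
      Finsupp.smul_apply, Finsupp.sub_apply, Finsupp.add_apply, reduceCtorEq, if_true, if_false,
      zero_smul, one_smul, smul_zero, smul_eq_mul, mul_zero, add_zero, sub_zero, zero_sub, zero_add]
    match_scalars <;> field_simp <;> ring

end Slots

/-! ### The contravariant form -/

section Form

variable (s : Kˣ) {V : Type*} [AddCommGroup V] [Module K V] (b : Module.Basis Ix K V)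

/-- The contravariant form on the octet. -/
def form : V →ₗ[K] Module.Dual K V :=
  b.constr K fun
    | .T1 => (q s + (q s)⁻¹) • b.coord .T1 + b.coord .T2
    | .T2 => b.coord .T1 + (q s + (q s)⁻¹) • b.coord .T2
    | a => b.coord a

/-- The contravariant form on the tensor square of the octet. -/
def form2 : V ⊗[K] V →ₗ[K] Module.Dual K (V ⊗[K] V) :=
  TensorProduct.dualDistrib K V V ∘ₗ TensorProduct.map (form s b) (form s b)

theorem form2_tmul (x y x' y' : V) :
    form2 s b (x ⊗ₜ y) (x' ⊗ₜ y') = form s b x x' * form s b y y' := by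
  simp [form2]

/-- The Gram matrix of the contravariant form. -/
def gram : Ix → Ix → K
  | .p12, .p12 => 1 | .p1, .p1 => 1 | .p2, .p2 => 1
  | .m12, .m12 => 1 | .m1, .m1 => 1 | .m2, .m2 => 1
  | .T1, .T1 => q s + (q s)⁻¹ | .T2, .T2 => q s + (q s)⁻¹ | .T1, .T2 => 1 | .T2, .T1 => 1
  | _, _ => 0

theorem form_basis (a c : Ix) : form s b (b a) (b c) = gram s a c := by
  rw [form, b.constr_basis]
  cases a <;> cases c <;> simp [gram]

variable {s b} {ρ : U s →ₐ[K] Module.End K V} (he : IsOctet ρ b)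
include he

theorem IsOctet.form_E (i : Fin 2) (x y : V) :
    form s b (ρ (E s i) x) y = form s b x (ρ (F s i) y) := by
  have key : form s b ∘ₗ ρ (E s i) = ((ρ (F s i)).dualMap) ∘ₗ form s b := by
    refine b.ext fun a => b.ext fun c => ?_
    fin_cases i
    · simp only [Fin.zero_eta, LinearMap.comp_apply, LinearMap.dualMap_apply, he.E0, he.F0]
      cases a <;> cases c <;> simp [tabE0, tabF0, form_basis, gram]
    · simp only [Fin.mk_one, LinearMap.comp_apply, LinearMap.dualMap_apply, he.E1, he.F1]
      cases a <;> cases c <;> simp [tabE1, tabF1, form_basis, gram]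
  exact LinearMap.congr_fun (LinearMap.congr_fun key x) y

theorem IsOctet.form_t (μ : Weight) (x y : V) :
    form s b (ρ (t s μ) x) y = form s b x (ρ (t s μ) y) := by
  have key : form s b ∘ₗ ρ (t s μ) = ((ρ (t s μ)).dualMap) ∘ₗ form s b := by
    refine b.ext fun a => b.ext fun c => ?_
    simp only [LinearMap.comp_apply, LinearMap.dualMap_apply, he.wt _ μ, map_smul, form_basis,
      LinearMap.smul_apply]
    cases a <;> cases c <;> simp [gram, Ix.wt]
  exact LinearMap.congr_fun (LinearMap.congr_fun key x) y

/-- Δ(E i) and Δ(F i) carry the same factors q^(±H i) in the same places, and these are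
self-adjoint, so the product of two contravariant forms is again contravariant. -/
theorem IsOctet.form2_E (i : Fin 2) (z z' : V ⊗[K] V) :
    form2 s b (diag ρ (E s i) z) z' = form2 s b z (diag ρ (F s i) z') := by
  induction z with
  | zero => simp
  | add z w hz hw => simp only [map_add, LinearMap.add_apply, hz, hw]
  | tmul x y =>
    induction z' with
    | zero => simp
    | add z w hz hw => simp only [map_add, hz, hw]
    | tmul x' y' =>
      simp only [diag_E, diag_F, map_add, LinearMap.add_apply, form2_tmul, he.form_E, he.form_t]

theorem IsOctet.form2_t (μ : Weight) (z z' : V ⊗[K] V) :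
    form2 s b (diag ρ (t s μ) z) z' = form2 s b z (diag ρ (t s μ) z') := by
  induction z with
  | zero => simp
  | add z w hz hw => simp only [map_add, LinearMap.add_apply, hz, hw]
  | tmul x y =>
    induction z' with
    | zero => simp
    | add z w hz hw => simp only [map_add, hz, hw]
    | tmul x' y' => simp only [diag_t, form2_tmul, he.form_t]

theorem IsOctet.form2_eq_zero_of_wt (h : Generic s) {a c : ℤ × ℤ} {z z' : V ⊗[K] V}
    (hz : IsWt (diag ρ) a z) (hz' : IsWt (diag ρ) c z') (hac : a ≠ c)
    (h₁ : |a.1 - c.1| ≤ 6) (h₂ : |a.2 - c.2| ≤ 6) : form2 s b z z' = 0 := by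
  by_contra hne
  have key : ∀ μ : Weight,
      (s : K) ^ (a.1 * μ 0 + a.2 * μ 1) = (s : K) ^ (c.1 * μ 0 + c.2 * μ 1) := by
    intro μ
    have := he.form2_t μ z z'
    rw [hz, hz', map_smul, map_smul, LinearMap.smul_apply, smul_eq_mul, smul_eq_mul] at this
    exact mul_right_cancel₀ hne this
  have hq : ∀ n : ℤ, (s : K) ^ (n * 2) = q s ^ n := fun n => by
    rw [q, ← zpow_natCast, ← zpow_mul, mul_comm]
    rfl
  apply hac
  rw [abs_le] at h₁ h₂
  ext
  · exact h.zpow_inj (by omega) (by omega) (by simpa [hq] using key ![2, 0])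
  · exact h.zpow_inj (by omega) (by omega) (by simpa [hq] using key ![0, 2])

/-- Pairing with a highest-weight vector kills the images of the `F j`, by contravariance. Distinct
weights are orthogonal, so the Gram matrix of the six vectors consists of four scalars and one
two-by-two block for the octets; genericity makes all of them invertible. -/
theorem IsOctet.exists_dual_hwv (h : Generic s) (i : Summand) :
    ∃ l : Module.Dual K (V ⊗[K] V), (∀ j z, l (diag ρ (F s j) z) = 0) ∧
      l (hwv s b i) ≠ 0 ∧ ∀ j ≠ i, l (hwv s b j) = 0 := by
  have hs := s.ne_zero
  have hq := q_ne_zero s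
  have hF : ∀ i j z, form2 s b (hwv s b i) (diag ρ (F s j) z) = 0 := fun i j z => by
    rw [← he.form2_E, he.E_hwv, map_zero, LinearMap.zero_apply]
  have orth : ∀ i j : Summand, i.weight ≠ j.weight → form2 s b (hwv s b i) (hwv s b j) = 0 :=
    fun i j hij => he.form2_eq_zero_of_wt h (he.wt_hwv i) (he.wt_hwv j) hij
      (by cases i <;> cases j <;> decide) (by cases i <;> cases j <;> decide)
  have g27 : form2 s b (hwv s b .m27) (hwv s b .m27) = 1 := by
    simp [hwv, form2_tmul, form_basis, gram]
  have g10 : form2 s b (hwv s b .m10) (hwv s b .m10) = q s + (q s)⁻¹ := by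
    simp [hwv, form2_tmul, form_basis, gram, qh, q]
    ring
  have g10s : form2 s b (hwv s b .m10star) (hwv s b .m10star) = q s + (q s)⁻¹ := by
    simp [hwv, form2_tmul, form_basis, gram, qh, q]
    ring
  have g1 : form2 s b (hwv s b .m1) (hwv s b .m1) =
      (q s ^ 2 + 1 + (q s)⁻¹ ^ 2) ^ 2 * (q s + (q s)⁻¹) ^ 2 * (q s ^ 2 + (q s)⁻¹ ^ 2) := by
    simp [hwv, form2_tmul, form_basis, gram]
    field_simp
    ring
  obtain ⟨x, y, z, gaa, gas, gsa, gss, det⟩ : ∃ x y z : K,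
      form2 s b (hwv s b .m8a) (hwv s b .m8a) = x ∧ form2 s b (hwv s b .m8a) (hwv s b .m8s) = y ∧
      form2 s b (hwv s b .m8s) (hwv s b .m8a) = y ∧ form2 s b (hwv s b .m8s) (hwv s b .m8s) = z ∧
      x * z - y * y ≠ 0 := by
    refine ⟨q s ^ 5 + q s ^ 3 + q s + (q s)⁻¹ + (q s)⁻¹ ^ 3 + (q s)⁻¹ ^ 5,
      q s ^ 7 + q s ^ 5 + q s ^ 3 - (q s)⁻¹ ^ 3 - (q s)⁻¹ ^ 5 - (q s)⁻¹ ^ 7,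
      q s ^ 9 + 2 * q s ^ 7 + 3 * q s ^ 5 + 4 * q s ^ 3 + 5 * q s + 5 * (q s)⁻¹
        + 4 * (q s)⁻¹ ^ 3 + 3 * (q s)⁻¹ ^ 5 + 2 * (q s)⁻¹ ^ 7 + (q s)⁻¹ ^ 9, ?_, ?_, ?_, ?_, ?_⟩
    · simp [hwv, form2_tmul, form_basis, gram, TensorProduct.sub_tmul, TensorProduct.tmul_sub, qh, q,
        -zpow_neg, zpow_ofNat]
      field_simp
      ring
    · simp [hwv, form2_tmul, form_basis, gram, TensorProduct.sub_tmul, TensorProduct.tmul_sub, qh,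
        q, zpow_ofNat]
      field_simp
      ring
    · simp [hwv, form2_tmul, form_basis, gram, TensorProduct.sub_tmul, TensorProduct.tmul_sub, qh,
        q, zpow_ofNat]
      field_simp
      ring
    · simp [hwv, form2_tmul, form_basis, gram, qh, q, zpow_ofNat]
      field_simp
      ring
    -- The factorisation of the determinant of the octet block: [3]² (q² + q⁻²)² [5].
    · have key : (q s ^ 2 + 1 + (q s)⁻¹ ^ 2) ^ 2 * (q s ^ 2 + (q s)⁻¹ ^ 2) ^ 2 *
          (q s ^ 4 + q s ^ 2 + 1 + (q s)⁻¹ ^ 2 + (q s)⁻¹ ^ 4) ≠ 0 :=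
        mul_ne_zero (mul_ne_zero (pow_ne_zero 2 h.three_ne) (pow_ne_zero 2 h.q2_add_ne)) h.five_ne
      convert key using 1
      field_simp
      ring
  have single : ∀ i, form2 s b (hwv s b i) (hwv s b i) ≠ 0 →
      (∀ j ≠ i, i.weight ≠ j.weight) → ∃ l : Module.Dual K (V ⊗[K] V),
        (∀ j z, l (diag ρ (F s j) z) = 0) ∧ l (hwv s b i) ≠ 0 ∧ ∀ j ≠ i, l (hwv s b j) = 0 :=
    fun i hi hj => ⟨form2 s b (hwv s b i), hF i, hi, fun j hji => orth i j (hj j hji)⟩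
  cases i
  · exact single _ (by rw [g27]; exact one_ne_zero) (by rintro (_ | _) <;> decide)
  · exact single _ (by rw [g10]; exact h.two_ne) (by rintro (_ | _) <;> decide)
  · exact single _ (by rw [g10s]; exact h.two_ne) (by rintro (_ | _) <;> decide)
  -- A row of the adjugate of the octet block: it vanishes on the other octet vector and takes the
  -- determinant as value on this one.
  · refine ⟨z • form2 s b (hwv s b .m8a) - y • form2 s b (hwv s b .m8s), fun j w => ?_, ?_, ?_⟩
    · simp [hF]
    · simpa [gaa, gsa, mul_comm] using det
    · intro j hj
      cases j
      case m8a => exact absurd rfl hj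
      case m8s => simp [gas, gss, mul_comm]
      all_goals
        rw [LinearMap.sub_apply, LinearMap.smul_apply, LinearMap.smul_apply, orth _ _ (by decide),
          orth _ _ (by decide), smul_zero, smul_zero, sub_zero]
  · refine ⟨x • form2 s b (hwv s b .m8s) - y • form2 s b (hwv s b .m8a), fun j w => ?_, ?_, ?_⟩
    · simp [hF]
    · simpa [gas, gss, mul_comm] using det
    · intro j hj
      cases j
      case m8s => exact absurd rfl hj
      case m8a => simp [gaa, gsa, mul_comm]
      all_goals
        rw [LinearMap.sub_apply, LinearMap.smul_apply, LinearMap.smul_apply, orth _ _ (by decide),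
          orth _ _ (by decide), smul_zero, smul_zero, sub_zero]
  · exact single _ (by
      rw [g1]
      exact mul_ne_zero (mul_ne_zero (pow_ne_zero 2 h.three_ne) (pow_ne_zero 2 h.two_ne))
        h.q2_add_ne) (by rintro (_ | _) <;> decide)

end Form

/-! ### Submodules generated by highest-weight vectors -/

section Generated

variable {s : Kˣ} {V : Type*} [AddCommGroup V] [Module K V] (ρ : U s →ₐ[K] Module.End K V)

theorem generated_stable (v : V) (u : U s) : ∀ x ∈ generated ρ v, ρ u x ∈ generated ρ v := by
  rintro _ ⟨w, rfl⟩
  exact ⟨u * w, by simp⟩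

theorem mem_generated (v : V) : v ∈ generated ρ v := ⟨1, by simp⟩

theorem generated_le {v : V} {N : Submodule K V} (hN : ∀ u, ∀ x ∈ N, ρ u x ∈ N) (hv : v ∈ N) :
    generated ρ v ≤ N := by
  rintro _ ⟨u, rfl⟩
  exact hN u v hv

/-- The vectors obtained from `v` by successive application of the operators `F i`. -/
def words (v : V) : Set V := Set.range fun l : List (Fin 2) => l.foldr (fun i => ρ (F s i)) v

variable {ρ}

/-- Each word is a weight vector, so commuting an `E i` through it to v, where it vanishes, leaves
only combinations of words. -/
theorem generated_le_words {a : ℤ × ℤ} {v : V} (hv : IsWt ρ a v) (hE : ∀ i, ρ (E s i) v = 0) :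
    generated ρ v ≤ Submodule.span K (words ρ v) := by
  have ext : ∀ f : Module.End K V, (∀ l : List (Fin 2),
      f (l.foldr (fun i => ρ (F s i)) v) ∈ Submodule.span K (words ρ v)) →
      ∀ x ∈ Submodule.span K (words ρ v), f x ∈ Submodule.span K (words ρ v) := by
    intro f hf x hx
    refine (Submodule.span_le (p := (Submodule.span K (words ρ v)).comap f)).2 ?_ hx
    rintro _ ⟨l, rfl⟩
    exact hf l
  have mem : ∀ l : List (Fin 2),
      l.foldr (fun i => ρ (F s i)) v ∈ Submodule.span K (words ρ v) := fun l =>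
    Submodule.subset_span ⟨l, rfl⟩
  have wt : ∀ l : List (Fin 2), ∃ c, IsWt ρ c (l.foldr (fun i => ρ (F s i)) v) := by
    intro l
    induction l with
    | nil => exact ⟨a, hv⟩
    | cons i l ih =>
      obtain ⟨c, hc⟩ := ih
      exact ⟨_, hc.F i⟩
  have hF : ∀ i, ∀ x ∈ Submodule.span K (words ρ v),
      ρ (F s i) x ∈ Submodule.span K (words ρ v) := fun i => ext _ fun l => mem (i :: l)
  refine generated_le ρ (stable_of_gens ρ (fun i => ext _ fun l => ?_) hF
    (fun μ => ext _ fun l => ?_)) (mem [])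
  · induction l with
    | nil => rw [List.foldr_nil, hE]; exact Submodule.zero_mem _
    | cons j l ih =>
      rw [List.foldr_cons]
      by_cases hij : i = j
      · subst hij
        obtain ⟨c, hc⟩ := wt l
        rw [hc.EF]
        exact Submodule.add_mem _ (hF _ _ ih) (Submodule.smul_mem _ _ (mem l))
      · rw [rep_EF_ne ρ hij]
        exact hF _ _ ih
  · obtain ⟨c, hc⟩ := wt l
    rw [hc]
    exact Submodule.smul_mem _ _ (mem l)

/-- A functional which kills `v` and the images of the `F i` kills the submodule generated by the
highest-weight vector `v`. -/
theorem eq_zero_on_generated {a : ℤ × ℤ} {v : V} (hv : IsWt ρ a v) (hE : ∀ i, ρ (E s i) v = 0)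
    {l : Module.Dual K V} (hl : ∀ i x, l (ρ (F s i) x) = 0) (h₀ : l v = 0) :
    ∀ x ∈ generated ρ v, l x = 0 := by
  intro x hx
  refine (Submodule.span_le (p := LinearMap.ker l)).2 ?_ (generated_le_words hv hE hx)
  rintro _ ⟨w, rfl⟩
  cases w with
  | nil => exact h₀
  | cons i w => exact hl i _

variable (ρ)

/-- All products of `n` operators `E i` kill `x`. -/
def Kills : ℕ → V → Prop
  | 0, x => x = 0
  | n + 1, x => ∀ i, Kills n (ρ (E s i) x)

variable {ρ}

theorem Kills.zero (n : ℕ) : Kills ρ n (0 : V) := by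
  induction n with
  | zero => exact rfl
  | succ n ih => intro i; rwa [map_zero]

theorem Kills.add {n : ℕ} {x y : V} (hx : Kills ρ n x) (hy : Kills ρ n y) :
    Kills ρ n (x + y) := by
  induction n generalizing x y with
  | zero =>
    rw [show x = 0 from hx, show y = 0 from hy, add_zero]
    exact rfl
  | succ n ih => intro i; rw [map_add]; exact ih (hx i) (hy i)

theorem Kills.smul {n : ℕ} {x : V} (hx : Kills ρ n x) (c : K) : Kills ρ n (c • x) := by
  induction n generalizing x with
  | zero =>
    rw [show x = 0 from hx, smul_zero]
    exact rfl
  | succ n ih => intro i; rw [map_smul]; exact ih (hx i)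

theorem Kills.t {n : ℕ} {x : V} (hx : Kills ρ n x) (μ : Weight) : Kills ρ n (ρ (t s μ) x) := by
  induction n generalizing x with
  | zero =>
    rw [show x = 0 from hx, map_zero]
    exact rfl
  | succ n ih =>
    intro i
    have := congrArg (fun u => ρ u x) (E_t s μ i)
    simp only [map_mul, Module.End.mul_apply, map_smul, LinearMap.smul_apply] at this
    rw [this]
    exact (ih (hx i)).smul _

/-- Each term of Δ(E i) applies `E i` to one factor and a harmless q^μ to the other, so one of the
two counts drops. -/
theorem Kills.tmul {m n : ℕ} {x y : V} (hx : Kills ρ m x) (hy : Kills ρ n y) :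
    Kills (diag ρ) (m + n) (x ⊗ₜ[K] y) := by
  induction m generalizing x y n with
  | zero =>
    rw [show x = 0 from hx, TensorProduct.zero_tmul]
    exact Kills.zero _
  | succ m ihm =>
    induction n generalizing x y with
    | zero =>
      rw [show y = 0 from hy, TensorProduct.tmul_zero]
      exact Kills.zero _
    | succ n ihn =>
      intro i
      rw [diag_E]
      refine Kills.add ?_ (ihn (hx.t _) (hy i))
      change Kills _ (m + 1 + n) _
      rw [show m + 1 + n = m + (n + 1) by omega]
      exact ihm (hx i) (hy.t _)

theorem exists_hw_of_kills {N : Submodule K V} (hN : ∀ i, ∀ x ∈ N, ρ (E s i) x ∈ N) {n : ℕ}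
    {x : V} (hx : x ∈ N) (h₀ : x ≠ 0) (hk : Kills ρ n x) :
    ∃ y ∈ N, y ≠ 0 ∧ ∀ i, ρ (E s i) y = 0 := by
  induction n generalizing x with
  | zero => exact absurd hk h₀
  | succ n ih =>
    by_cases hE : ∀ i, ρ (E s i) x = 0
    · exact ⟨x, hx, h₀, hE⟩
    · obtain ⟨i, hi⟩ := not_forall.1 hE
      exact ih (hN i x hx) hi (hk i)

end Generated

/-! ### Simplicity and independence of the generated submodules. -/

section Octet

variable {s : Kˣ} {V : Type*} [AddCommGroup V] [Module K V] {ρ : U s →ₐ[K] Module.End K V}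
  {b : Module.Basis Ix K V} (he : IsOctet ρ b)
include he

/-- Heights in the octet run from -2 to 2. -/
theorem IsOctet.kills (x : V) : Kills ρ 5 x := by
  have hb : ∀ a, Kills ρ 5 (b a) := by
    intro a i j k l m
    cases a <;> fin_cases i <;> fin_cases j <;> fin_cases k <;> fin_cases l <;> fin_cases m <;>
      simp [Kills, he.E0, he.E1, tabE0, tabE1]
  rw [← b.sum_repr x, sum_Ix]
  exact ((((((((hb _).smul _).add ((hb _).smul _)).add ((hb _).smul _)).add ((hb _).smul _)).add
    ((hb _).smul _)).add ((hb _).smul _)).add ((hb _).smul _)).add ((hb _).smul _)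

theorem IsOctet.exists_hw {N : Submodule K (V ⊗[K] V)}
    (hN : ∀ i, ∀ x ∈ N, diag ρ (E s i) x ∈ N) (h₀ : N ≠ ⊥) :
    ∃ y ∈ N, y ≠ 0 ∧ ∀ i, diag ρ (E s i) y = 0 := by
  obtain ⟨x, hx, hx₀⟩ := N.exists_mem_ne_zero_of_ne_bot h₀
  refine exists_hw_of_kills hN hx hx₀ (n := 5 + 5) ?_
  clear hx hx₀
  induction x with
  | zero => exact Kills.zero _
  | add x y hx hy => exact hx.add hy
  | tmul x y => exact (he.kills x).tmul (he.kills y)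

/-- The submodules of the tensor square generated by the highest-weight vectors. -/
abbrev hwMod (ρ : U s →ₐ[K] Module.End K V) (b : Module.Basis Ix K V) (i : Summand) :
    Submodule K (V ⊗[K] V) := generated (diag ρ) (hwv s b i)

/-- The functional dual to another vector `hwv s b j` vanishes on the whole submodule generated by
`hwv s b i`, so the j-th coefficient of z is zero. -/
theorem IsOctet.hw_mem_hwMod (h : Generic s) {i : Summand} {z : V ⊗[K] V}
    (hz : z ∈ hwMod ρ b i) (hE : ∀ j, diag ρ (E s j) z = 0) : ∃ c : K, z = c • hwv s b i := by
  obtain ⟨α, rfl⟩ := he.hw_mem_span h hE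
  have hα : ∀ j ≠ i, α j = 0 := by
    intro j hji
    obtain ⟨l, hl, h₁, h₂⟩ := he.exists_dual_hwv h j
    have := eq_zero_on_generated (he.wt_hwv i) (he.E_hwv i) hl (h₂ i hji.symm) _ hz
    rw [map_sum, Finset.sum_eq_single j (fun k _ hk => by rw [map_smul, h₂ k hk, smul_zero])
      (fun hj => absurd (Finset.mem_univ _) hj), map_smul, smul_eq_zero] at this
    exact this.resolve_right h₁
  exact ⟨α i, Finset.sum_eq_single i (fun k _ hk => by rw [hα k hk, zero_smul])
      (fun hj => absurd (Finset.mem_univ _) hj)⟩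

theorem IsOctet.hwv_ne_zero (h : Generic s) (i : Summand) : hwv s b i ≠ 0 := by
  obtain ⟨l, -, h₁, -⟩ := he.exists_dual_hwv h i
  intro e
  exact h₁ (by rw [e, map_zero])

/-- A nonzero subrepresentation contains a highest-weight vector, which must be a nonzero multiple
of the generator. -/
theorem IsOctet.isSimpleSub (h : Generic s) (i : Summand) :
    IsSimpleSub (diag ρ) (hwMod ρ b i) := by
  refine ⟨generated_stable _ _, fun e => he.hwv_ne_zero h i ?_, fun N hN hst => ?_⟩
  · rw [← Submodule.mem_bot K, ← e]
    exact mem_generated _ _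
  · by_cases hb : N = ⊥
    · exact Or.inl hb
    · obtain ⟨z, hz, hz₀, hE⟩ := he.exists_hw (fun i => hst (E s i)) hb
      obtain ⟨c, rfl⟩ := he.hw_mem_hwMod h (hN hz) hE
      have hc : c ≠ 0 := fun hc => hz₀ (by rw [hc, zero_smul])
      exact Or.inr (le_antisymm hN (generated_le _ hst ((N.smul_mem_iff hc).1 hz)))

/-- A nonzero intersection with the sum of the others would contain a nonzero multiple of `hwv s b
i`, on which the dual functional is nonzero although it kills all other summands. -/
theorem IsOctet.iSupIndep_hwMod (h : Generic s) : iSupIndep (hwMod ρ b) := by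
  intro i
  rw [disjoint_iff]
  by_contra hne
  have hst : ∀ j, ∀ u, ∀ x ∈ hwMod ρ b j, diag ρ u x ∈ hwMod ρ b j := fun j =>
    generated_stable _ _
  have hsup : ∀ k, ∀ x ∈ hwMod ρ b i ⊓ ⨆ j, ⨆ (_ : j ≠ i), hwMod ρ b j,
      diag ρ (E s k) x ∈ hwMod ρ b i ⊓ ⨆ j, ⨆ (_ : j ≠ i), hwMod ρ b j := by
    intro k x hx
    refine ⟨hst i _ _ hx.1, ?_⟩
    have hle : ⨆ j, ⨆ (_ : j ≠ i), hwMod ρ b j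
        ≤ (⨆ j, ⨆ (_ : j ≠ i), hwMod ρ b j).comap (diag ρ (E s k)) :=
      iSup₂_le fun j hj x hx => Submodule.mem_iSup_of_mem j
        (Submodule.mem_iSup_of_mem hj (hst j _ _ hx))
    exact hle hx.2
  obtain ⟨z, hz, hz₀, hE⟩ := he.exists_hw hsup hne
  obtain ⟨c, rfl⟩ := he.hw_mem_hwMod h hz.1 hE
  have hc : c ≠ 0 := fun hc => hz₀ (by rw [hc, zero_smul])
  obtain ⟨l, hl, h₁, h₂⟩ := he.exists_dual_hwv h i
  have hle : ⨆ j, ⨆ (_ : j ≠ i), hwMod ρ b j ≤ LinearMap.ker l :=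
    iSup₂_le fun j hj x hx =>
      eq_zero_on_generated (he.wt_hwv j) (he.E_hwv j) hl (h₂ j hj) x hx
  have := hle hz.2
  rw [LinearMap.mem_ker, map_smul, smul_eq_zero] at this
  exact this.elim hc h₁

end Octet

/-! ### Weight multiplicities -/

section Mult

variable {s : Kˣ} {V : Type*} [AddCommGroup V] [Module K V] (ρ : U s →ₐ[K] Module.End K V)

/-- The weight spaces of a representation. -/
def wtSpace (a : ℤ × ℤ) : Submodule K V where
  carrier := {x | IsWt ρ a x}
  add_mem' hx hy := hx.add hy
  zero_mem' := fun μ => by rw [map_zero, smul_zero]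
  smul_mem' c _ hx := hx.smul c

/-- The multiplicity of a weight in a subspace. -/
def mult (M : Submodule K V) (a : ℤ × ℤ) : ℕ := Module.finrank K ↥(M ⊓ wtSpace ρ a)

variable {ρ}

theorem q_zpow_eq (s : Kˣ) (n : ℤ) : (s : K) ^ (n * 2) = q s ^ n := by
  rw [q, ← zpow_natCast, ← zpow_mul, mul_comm]
  rfl

theorem sum_finrank_le {ι : Type*} [Fintype ι] [FiniteDimensional K V] {N : ι → Submodule K V}
    (hN : iSupIndep N) {M : Submodule K V} (hM : ∀ i, N i ≤ M) :
    ∑ i, Module.finrank K (N i) ≤ Module.finrank K M := by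
  classical
  rw [← Module.finrank_directSum K fun i => N i]
  have hr : ∀ x, DirectSum.coeLinearMap N x ∈ M := fun x => by
    have : DirectSum.coeLinearMap N x ∈ LinearMap.range (DirectSum.coeLinearMap N) := ⟨x, rfl⟩
    rw [DirectSum.range_coeLinearMap] at this
    exact iSup_le hM this
  refine LinearMap.finrank_le_finrank_of_injective
    (f := (DirectSum.coeLinearMap N).codRestrict M hr) ?_
  rw [← LinearMap.ker_eq_bot, LinearMap.ker_codRestrict, LinearMap.ker_eq_bot]
  exact hN.dfinsupp_lsum_injective

/-- Weight spaces lie in joint eigenspaces of two commuting operators. Coordinates of absolute value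
at most 2 differ by at most 4, so distinct weights have distinct pairs of eigenvalues. -/
theorem sum_mult_le (h : Generic s) [FiniteDimensional K V] (M : Submodule K V)
    (T : Finset (ℤ × ℤ)) (hT : ∀ a ∈ T, |a.1| ≤ 2 ∧ |a.2| ≤ 2) :
    ∑ a ∈ T, mult ρ M a ≤ Module.finrank K M := by
  rw [← Finset.sum_coe_sort]
  refine sum_finrank_le (ι := T) (N := fun a => M ⊓ wtSpace ρ a) ?_ fun a => inf_le_left
  let f : Fin 2 → Module.End K V := ![ρ (t s ![2, 0]), ρ (t s ![0, 2])]
  let χ : T → Fin 2 → K := fun a => ![q s ^ a.1.1, q s ^ a.1.2]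
  have hcomm : ∀ i j, Commute (f i) (f j) := by
    have : ∀ μ ν, Commute (ρ (t s μ)) (ρ (t s ν)) := fun μ ν => by
      rw [commute_iff_eq, ← map_mul, ← map_mul, t_comm]
    intro i j
    fin_cases i <;> fin_cases j <;> exact this _ _
  have hχ : Function.Injective χ := by
    intro a c hac
    have h0 := congrFun hac 0
    have h1 := congrFun hac 1
    obtain ⟨ha, ha'⟩ := hT a a.2
    obtain ⟨hc, hc'⟩ := hT c c.2
    rw [abs_le] at ha ha' hc hc'
    ext
    · exact h.zpow_inj (by omega) (by omega) h0
    · exact h.zpow_inj (by omega) (by omega) h1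
  have key := (Module.End.independent_iInf_maxGenEigenspace_of_forall_mapsTo f
    fun i j φ => Module.End.mapsTo_maxGenEigenspace_of_comm (hcomm j i) φ).comp hχ
  refine key.mono fun a x hx => ?_
  rw [Function.comp_apply, Submodule.mem_iInf]
  have hx : IsWt ρ a x := hx.2
  intro i
  refine Module.End.genEigenspace_le_maximal _ _ 1 (Module.End.mem_eigenspace_iff.2 ?_)
  fin_cases i
  · simpa [f, χ, q_zpow_eq] using hx ![2, 0]
  · simpa [f, χ, q_zpow_eq] using hx ![0, 2]

/-- The inductive step of the commutation formula `IsWt.E_F_pow`. -/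
theorem qint_identity (h : Generic s) (k n : ℤ) :
    qint s (k + 1) * qint s (n - k) + qint s (n - 2 * (k + 1))
      = qint s (k + 2) * qint s (n - (k + 1)) := by
  have hq := q_ne_zero s
  have h0 := h.q_sub_ne
  have hk := zpow_ne_zero k hq
  have hn := zpow_ne_zero n hq
  have e1 : q s ^ (k + 1) = q s ^ k * q s := zpow_add_one₀ hq k
  have e2 : q s ^ (k + 2) = q s ^ k * q s ^ 2 := by rw [zpow_add₀ hq, zpow_ofNat]
  simp only [qint, zpow_neg, zpow_sub₀ hq, mul_comm 2 (k + 1), zpow_mul, e1, e2, zpow_ofNat]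
  rw [← sub_eq_zero]
  generalize q s ^ k = x at hk
  generalize q s ^ n = y at hn
  generalize q s = p at hq h0
  have h1 : p ^ 2 - 1 ≠ 0 := by
    intro e
    apply h0
    field_simp
    linear_combination e
  field_simp
  ring

theorem IsWt.F_pow {a : ℤ × ℤ} {x : V} (hx : IsWt ρ a x) (i : Fin 2) (k : ℕ) :
    IsWt ρ (a - k • root i) ((ρ (Sl3q.F s i) ^ k) x) := by
  induction k with
  | zero => simpa using hx
  | succ k ih =>
    rw [pow_succ', Module.End.mul_apply]
    exact ih.F' i (by rw [succ_nsmul]; abel)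

theorem pair_sub (i : Fin 2) (a : ℤ × ℤ) (k : ℕ) :
    pair i (a - k • root i) = pair i a - 2 * k := by
  fin_cases i <;> simp [pair, root] <;> ring

theorem IsWt.E_F_pow (h : Generic s) {a : ℤ × ℤ} {x : V} (hx : IsWt ρ a x) (i : Fin 2) (k : ℕ) :
    ρ (Sl3q.E s i) ((ρ (Sl3q.F s i) ^ (k + 1)) x) = (ρ (Sl3q.F s i) ^ (k + 1)) (ρ (Sl3q.E s i) x)
      + (qint s (k + 1) * qint s (pair i a - k)) • (ρ (Sl3q.F s i) ^ k) x := by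
  induction k with
  | zero =>
    simpa [qint_one h] using hx.EF i
  | succ k ih =>
    have hF : ∀ k y, ρ (Sl3q.F s i) ((ρ (Sl3q.F s i) ^ k) y) = (ρ (Sl3q.F s i) ^ (k + 1)) y :=
      fun k y => by rw [pow_succ', Module.End.mul_apply]
    have := qint_identity h k (pair i a)
    rw [← hF (k + 1) x, (hx.F_pow i (k + 1)).EF, ih, map_add, map_smul, hF, hF, pair_sub,
      add_assoc, ← add_smul]
    push_cast at this ⊢
    rw [this, add_assoc (k : ℤ), one_add_one_eq_two]

/-- The coordinate of a weight along a simple root. -/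
def coef (i : Fin 2) (a : ℤ × ℤ) : ℤ := if i = 0 then a.1 else a.2

/-- On a weight space of nonnegative weight `n`, the power `F i ^ n` is injective. -/
theorem F_pow_eq_zero (h : Generic s) (i : Fin 2)
    (htop : ∀ (a : ℤ × ℤ) (x : V), coef i a = 3 → IsWt ρ a x → x = 0) (m : ℕ)
    {a : ℤ × ℤ} {x : V} (ha : coef i a = 3 - m) (ha' : -2 ≤ coef (1 - i) a) (hx : IsWt ρ a x)
    {n : ℕ} (hn : pair i a = n) (h₀ : (ρ (F s i) ^ n) x = 0) : x = 0 := by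
  have hpair : ∀ a, pair i a = 2 * coef i a - coef (1 - i) a := fun a => by
    fin_cases i <;> simp [pair, coef]
  -- Downward induction on the coordinate along `root i`, from the value 3 at which no weight vector
  -- is left.
  induction m generalizing a x n with
  | zero => exact htop a x (by simpa using ha) hx
  | succ m ih =>
    have hroot : coef i (a + root i) = coef i a + 1 ∧
        coef (1 - i) (a + root i) = coef (1 - i) a ∧ pair i (a + root i) = pair i a + 2 := by
      fin_cases i <;> simp [coef, root, pair] <;> ring
    -- `E i` x has pairing n + 2. The coefficient in `E_F_pow` for `F i ^ (n + 1)` contains [n - n]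
    -- = 0, so `F i ^ (n + 1)` kills `E i` x and the induction hypothesis applies.
    have hEx : ρ (E s i) x = 0 := by
      refine ih (n := n + 2) (by rw [hroot.1, ha]; push_cast; ring) (by rw [hroot.2.1]; exact ha')
        (hx.E i) (by rw [hroot.2.2, hn]; push_cast; ring) ?_
      have := hx.E_F_pow h i n
      rw [hn, sub_self, qint_zero, mul_zero, zero_smul, add_zero, pow_succ', Module.End.mul_apply,
        h₀, map_zero, map_zero] at this
      rw [pow_succ', Module.End.mul_apply, pow_succ', ← this, map_zero]
    -- Twice a coordinate at most 2, minus a coordinate at least -2.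
    have hn6 : n ≤ 6 := by
      have := hpair a
      push_cast at ha
      omega
    clear ih
    -- Since `E i` x = 0, applying `E i` to `F i ^ (k + 1)` x gives [k + 1][n - k] `F i ^ k` x, with
    -- nonzero coefficient for k < n.
    have key : ∀ k, k ≤ n → (ρ (F s i) ^ k) x = 0 → x = 0 := by
      intro k
      induction k with
      | zero => intro _ hk; simpa using hk
      | succ k ihk =>
        intro hk hk0
        have := hx.E_F_pow h i k
        rw [hk0, hEx, map_zero, map_zero, zero_add] at this
        refine ihk (by omega) ((smul_eq_zero.1 this.symm).resolve_left ?_)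
        exact mul_ne_zero (h.qint_ne_zero (by omega) (by omega))
          (h.qint_ne_zero (by omega) (by omega))
    exact key n le_rfl h₀

end Mult

/-! ### Lower bounds and inequalities for weight multiplicities. -/

section MultBounds

variable {s : Kˣ} {V : Type*} [AddCommGroup V] [Module K V] [FiniteDimensional K V]
  {ρ : U s →ₐ[K] Module.End K V} {M : Submodule K V}

theorem le_mult {n : ℕ} {a : ℤ × ℤ} (v : Fin n → V) (hM : ∀ i, v i ∈ M)
    (hv : ∀ i, IsWt ρ a (v i)) (hli : LinearIndependent K v) : n ≤ mult ρ M a := by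
  let w : Fin n → ↥(M ⊓ wtSpace ρ a) := fun i => ⟨v i, hM i, hv i⟩
  have : LinearIndependent K w := LinearIndependent.of_comp (M ⊓ wtSpace ρ a).subtype hli
  simpa [mult] using this.fintype_card_le_finrank

theorem one_le_mult {a : ℤ × ℤ} {x : V} (hM : x ∈ M) (hx : IsWt ρ a x) (h₀ : x ≠ 0) :
    1 ≤ mult ρ M a :=
  le_mult ![x] (fun i => by fin_cases i; exact hM) (fun i => by fin_cases i; exact hx)
    (LinearIndependent.of_subsingleton 0 h₀)

/-- The witnesses are the two orders of `F 0` and `F 1` applied to v. Applying `E 0` and `E 1` to a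
relation between them gives a linear system with determinant [p + 1][r + 1] - [p][r]. -/
theorem two_le_mult {a : ℤ × ℤ} {v : V} (hM : ∀ u, ∀ x ∈ M, ρ u x ∈ M) (hv : v ∈ M)
    (hw : IsWt ρ a v) (hE : ∀ i, ρ (E s i) v = 0) (h₀ : v ≠ 0) {p r : ℤ} (hp : pair 0 a = p)
    (hr : pair 1 a = r) (hp₀ : qint s p ≠ 0) (hr₀ : qint s r ≠ 0)
    (hdet : qint s (p + 1) * qint s (r + 1) - qint s p * qint s r ≠ 0) :
    2 ≤ mult ρ M (a - root 0 - root 1) := by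
  have n01 : (0 : Fin 2) ≠ 1 := by decide
  have n10 : (1 : Fin 2) ≠ 0 := by decide
  have e0 : ρ (E s 0) (ρ (F s 0) v) = qint s p • v := by
    rw [hw.EF, hE, map_zero, zero_add, hp]
  have e1 : ρ (E s 1) (ρ (F s 1) v) = qint s r • v := by
    rw [hw.EF, hE, map_zero, zero_add, hr]
  have n0 : ρ (F s 0) v ≠ 0 := fun e => smul_ne_zero hp₀ h₀ (by rw [← e0, e, map_zero])
  have n1 : ρ (F s 1) v ≠ 0 := fun e => smul_ne_zero hr₀ h₀ (by rw [← e1, e, map_zero])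
  have p1 : pair 0 (a - root 1) = p + 1 := by rw [← hp]; simp [pair, root]; ring
  have p0 : pair 1 (a - root 0) = r + 1 := by rw [← hr]; simp [pair, root]; ring
  have a1 : ρ (E s 0) (ρ (F s 0) (ρ (F s 1) v)) = qint s (p + 1) • ρ (F s 1) v := by
    rw [(hw.F 1).EF, rep_EF_ne ρ n01, hE, map_zero, map_zero, zero_add, p1]
  have a2 : ρ (E s 0) (ρ (F s 1) (ρ (F s 0) v)) = qint s p • ρ (F s 1) v := by
    rw [rep_EF_ne ρ n01, e0, map_smul]
  have a3 : ρ (E s 1) (ρ (F s 0) (ρ (F s 1) v)) = qint s r • ρ (F s 0) v := by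
    rw [rep_EF_ne ρ n10, e1, map_smul]
  have a4 : ρ (E s 1) (ρ (F s 1) (ρ (F s 0) v)) = qint s (r + 1) • ρ (F s 0) v := by
    rw [(hw.F 0).EF, rep_EF_ne ρ n10, hE, map_zero, map_zero, zero_add, p0]
  refine le_mult ![ρ (F s 0) (ρ (F s 1) v), ρ (F s 1) (ρ (F s 0) v)] ?_ ?_ ?_
  · intro i
    fin_cases i
    · exact hM _ _ (hM _ _ hv)
    · exact hM _ _ (hM _ _ hv)
  · intro i
    fin_cases i
    · exact (hw.F 1).F' 0 (by abel)
    · exact (hw.F 0).F' 1 rfl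
  · rw [LinearIndependent.pair_iff]
    intro α β hαβ
    have b0 := congrArg (ρ (E s 0)) hαβ
    have b1 := congrArg (ρ (E s 1)) hαβ
    simp only [map_add, map_smul, a1, a2, a3, a4, map_zero, smul_smul, ← add_smul,
      smul_eq_zero, n0, n1, or_false] at b0 b1
    constructor
    · refine (mul_eq_zero.1 ?_).resolve_right hdet
      linear_combination qint s (r + 1) * b0 - qint s p * b1
    · refine (mul_eq_zero.1 ?_).resolve_right hdet
      linear_combination qint s (p + 1) * b1 - qint s r * b0

/-- `F i ^ k` embeds one weight space in the other: with n the pairing, `F i ^ n` is injective and k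
≤ n. -/
theorem mult_le_mult (h : Generic s)
    (htop : ∀ (i : Fin 2) (a : ℤ × ℤ) (x : V), coef i a = 3 → IsWt ρ a x → x = 0)
    (hM : ∀ u, ∀ x ∈ M, ρ u x ∈ M) (i : Fin 2) {a c : ℤ × ℤ} (k : ℕ)
    (hc : a - k • root i = c) (hk : (k : ℤ) ≤ pair i a) (ha : coef i a ≤ 2)
    (ha' : -2 ≤ coef (1 - i) a) : mult ρ M a ≤ mult ρ M c := by
  subst hc
  obtain ⟨m, hm⟩ := Int.eq_ofNat_of_zero_le (show 0 ≤ 3 - coef i a by omega)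
  obtain ⟨n, hn⟩ := Int.eq_ofNat_of_zero_le (show 0 ≤ pair i a by omega)
  have hpow : ∀ k, ∀ x ∈ M, (ρ (F s i) ^ k) x ∈ M := by
    intro k x hx
    rw [← map_pow]
    exact hM _ _ hx
  refine LinearMap.finrank_le_finrank_of_injective
    (f := (ρ (F s i) ^ k).restrict fun x hx => ⟨hpow k x hx.1, IsWt.F_pow hx.2 i k⟩) ?_
  rw [← LinearMap.ker_eq_bot, LinearMap.ker_eq_bot']
  rintro ⟨x, hx⟩ h0
  have h0 : (ρ (F s i) ^ k) x = 0 := congrArg Subtype.val h0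
  have : x = 0 := by
    refine F_pow_eq_zero h i (htop i) m (by omega) ha' hx.2 hn ?_
    rw [← Nat.sub_add_cancel (show k ≤ n by omega), pow_add, Module.End.mul_apply, h0, map_zero]
  exact Subtype.ext this

end MultBounds

/-! ### Dimensions of the six summands. -/

section Octet

variable {s : Kˣ} {V : Type*} [AddCommGroup V] [Module K V] {ρ : U s →ₐ[K] Module.End K V}
  {b : Module.Basis Ix K V} (he : IsOctet ρ b)
include he

theorem IsOctet.repr_t (μ : Weight) (x : V) (c : Ix) :
    b.repr (ρ (t s μ) x) c = (s : K) ^ (c.wt.1 * μ 0 + c.wt.2 * μ 1) * b.repr x c := by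
  have : b.coord c ∘ₗ ρ (t s μ)
      = ((s : K) ^ (c.wt.1 * μ 0 + c.wt.2 * μ 1)) • b.coord c := by
    refine b.ext fun d => ?_
    rw [LinearMap.comp_apply, he.wt d μ]
    by_cases hdc : d = c
    · subst hdc; simp
    · simp [hdc]
  exact LinearMap.congr_fun this x

theorem IsOctet.repr_diag_t (μ : Weight) (z : V ⊗[K] V) (c d : Ix) :
    (b.tensorProduct b).repr (diag ρ (t s μ) z) (c, d)
      = (s : K) ^ ((c.wt.1 + d.wt.1) * μ 0 + (c.wt.2 + d.wt.2) * μ 1)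
        * (b.tensorProduct b).repr z (c, d) := by
  induction z with
  | zero => simp
  | add x y hx hy => simp only [map_add, Finsupp.add_apply, hx, hy, mul_add]
  | tmul x y =>
    rw [diag_t, Module.Basis.tensorProduct_repr_tmul_apply,
      Module.Basis.tensorProduct_repr_tmul_apply, he.repr_t, he.repr_t, smul_eq_mul, smul_eq_mul,
      show (c.wt.1 + d.wt.1) * μ 0 + (c.wt.2 + d.wt.2) * μ 1 = (c.wt.1 * μ 0 + c.wt.2 * μ 1)
        + (d.wt.1 * μ 0 + d.wt.2 * μ 1) by ring,
      zpow_add₀ s.ne_zero (c.wt.1 * μ 0 + c.wt.2 * μ 1)]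
    ring

/-- Coordinates of weights of the tensor square lie between -2 and 2. They differ from 3 by at most
5, within the range where powers of q are distinct. -/
theorem IsOctet.eq_zero_of_coef (h : Generic s) (i : Fin 2) (a : ℤ × ℤ) (z : V ⊗[K] V)
    (ha : coef i a = 3) (hz : IsWt (diag ρ) a z) : z = 0 := by
  refine (b.tensorProduct b).repr.map_eq_zero_iff.1 (Finsupp.ext fun ⟨c, d⟩ => ?_)
  have hb : ∀ c : Ix, -1 ≤ coef i c.wt ∧ coef i c.wt ≤ 1 := by
    clear ha
    revert i
    clear he h hz
    decide
  have hc := hb c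
  have hd := hb d
  have key := he.repr_diag_t ((2 : ℤ) • Pi.single i 1) z c d
  rw [hz, map_smul, Finsupp.smul_apply, smul_eq_mul] at key
  rw [Finsupp.zero_apply]
  by_contra hne
  have key := mul_right_cancel₀ hne key
  have : q s ^ coef i a = q s ^ (coef i c.wt + coef i d.wt) := by
    rw [← q_zpow_eq, ← q_zpow_eq]
    convert key using 2
    · fin_cases i <;> simp [coef]
    · fin_cases i <;> simp [coef]
  have := h.zpow_inj (by omega) (by omega) this
  omega

/-- The coordinates of the three words at T1 ⊗ T1, T2 ⊗ T2 and T1 ⊗ T2 form a diagonal matrix with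
nonzero entries, because the words pass through p1 ⊗ p1, through p2 ⊗ p2, and through mixed tensors
respectively. -/
theorem IsOctet.three_le_mult (h : Generic s) {M : Submodule K (V ⊗[K] V)}
    (hM : ∀ u, ∀ x ∈ M, diag ρ u x ∈ M) (hv : hwv s b .m27 ∈ M) :
    3 ≤ mult (diag ρ) M (0, 0) := by
  have : FiniteDimensional K V := b.finiteDimensional_of_finite
  have two := h.two_ne
  have hs := s.ne_zero
  have hw := he.wt_hwv .m27
  set f0 := diag ρ (F s 0) with hf0
  set f1 := diag ρ (F s 1) with hf1
  set v := hwv s b .m27 with hv'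
  refine le_mult ![f0 (f0 (f1 (f1 v))), f1 (f1 (f0 (f0 v))), f0 (f1 (f1 (f0 v)))] ?_ ?_ ?_
  · intro i
    fin_cases i
    · exact hM _ _ (hM _ _ (hM _ _ (hM _ _ hv)))
    · exact hM _ _ (hM _ _ (hM _ _ (hM _ _ hv)))
    · exact hM _ _ (hM _ _ (hM _ _ (hM _ _ hv)))
  · intro i
    fin_cases i
    · exact (((hw.F 1).F 1).F 0).F' 0 (by decide)
    · exact (((hw.F 0).F 0).F 1).F' 1 (by decide)
    · exact (((hw.F 0).F 1).F 1).F' 0 (by decide)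
  · rw [Fintype.linearIndependent_iff]
    intro g hg
    rw [Fin.sum_univ_three] at hg
    have key := fun c => congrArg (fun z => (b.tensorProduct b).repr z c) hg
    simp only [hf0, hf1, hv', hwv, Matrix.cons_val_zero, Matrix.cons_val_one, Matrix.cons_val,
      map_add, map_smul, he.diag_F0, he.diag_F1, tabF0, tabF1, Ix.wt, pair,
      TensorProduct.tmul_smul, ← TensorProduct.smul_tmul', TensorProduct.zero_tmul,
      TensorProduct.tmul_zero, smul_zero, add_zero, zero_add, map_zero, Finsupp.add_apply,
      Finsupp.smul_apply, Finsupp.zero_apply, smul_eq_mul] at key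
    have k1 := key (.T1, .T1)
    have k2 := key (.T2, .T2)
    have k3 := key (.T1, .T2)
    simp at k1 k2 k3
    have e : (s : K) ^ 2 + ((s : K) ^ 2)⁻¹ ≠ 0 := two
    have e1 : (s : K)⁻¹ * ((s : K)⁻¹ * (((s : K) ^ 2)⁻¹ + (s : K) ^ 2))
        + s * (s * (((s : K) ^ 2)⁻¹ + (s : K) ^ 2))
        = ((s : K) ^ 2 + ((s : K) ^ 2)⁻¹) * ((s : K) ^ 2 + ((s : K) ^ 2)⁻¹) := by
      field_simp
      ring
    have e2 : ((s : K) ^ 2)⁻¹ * (s : K)⁻¹ + s = (s : K)⁻¹ * ((s : K) ^ 2 + ((s : K) ^ 2)⁻¹) := by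
      field_simp
      ring
    rw [e1] at k1 k2
    rw [e2] at k3
    intro i
    fin_cases i
    · exact k1.resolve_right (mul_ne_zero e e)
    · exact k2.resolve_right (mul_ne_zero e e)
    · exact k3.resolve_right (mul_ne_zero (inv_ne_zero hs) e)

/-- Carries a bound along a root string as far as the reflected weight, so that bounds at dominant
weights spread to the other weights. -/
theorem IsOctet.mult_hwMod_le (h : Generic s) (j : Summand) (i : Fin 2) {a c : ℤ × ℤ} (k : ℕ)
    (hc : a - k • root i = c) (hk : (k : ℤ) ≤ pair i a) (ha : coef i a ≤ 2)
    (ha' : -2 ≤ coef (1 - i) a) {n : ℕ} (hn : n ≤ mult (diag ρ) (hwMod ρ b j) a) :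
    n ≤ mult (diag ρ) (hwMod ρ b j) c :=
  have : FiniteDimensional K V := b.finiteDimensional_of_finite
  hn.trans (mult_le_mult h (he.eq_zero_of_coef h) (generated_stable _ _) i k hc hk ha ha')

theorem IsOctet.one_le_mult_weight (h : Generic s) (j : Summand) :
    1 ≤ mult (diag ρ) (hwMod ρ b j) j.weight :=
  have : FiniteDimensional K V := b.finiteDimensional_of_finite
  one_le_mult (mem_generated _ _) (he.wt_hwv j) (he.hwv_ne_zero h j)

omit he in
theorem le_finrank_of_mult (ρ : U s →ₐ[K] Module.End K V) (b : Module.Basis Ix K V)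
    (h : Generic s) (j : Summand) (T : Finset (ℤ × ℤ)) (g : ℤ × ℤ → ℕ)
    (hT : ∀ a ∈ T, |a.1| ≤ 2 ∧ |a.2| ≤ 2)
    (hg : ∀ a ∈ T, g a ≤ mult (diag ρ) (hwMod ρ b j) a) :
    ∑ a ∈ T, g a ≤ Module.finrank K (hwMod ρ b j) :=
  have : FiniteDimensional K V := b.finiteDimensional_of_finite
  (Finset.sum_le_sum hg).trans (sum_mult_le h _ T hT)

theorem IsOctet.two_le_mult_octet (h : Generic s) {j : Summand} (hj : j.weight = (1, 1)) :
    2 ≤ mult (diag ρ) (hwMod ρ b j) (0, 0) := by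
  have : FiniteDimensional K V := b.finiteDimensional_of_finite
  have one : qint s 1 ≠ 0 := h.qint_ne_zero (by norm_num) (by norm_num)
  have key := two_le_mult (generated_stable (diag ρ) (hwv s b j)) (mem_generated _ _)
    (he.wt_hwv j) (he.E_hwv j) (he.hwv_ne_zero h j) (p := 1) (r := 1) (by rw [hj]; decide)
    (by rw [hj]; decide) one one
  rw [hj, show (1, 1) - root 0 - root 1 = ((0, 0) : ℤ × ℤ) by decide] at key
  -- [2]² - [1]² = [3].
  refine key fun e => h.three_ne ?_
  have hq := q_ne_zero s
  norm_num [qint_one h, qint_two h] at e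
  rw [← e]
  field_simp
  ring

theorem IsOctet.two_le_mult_m27 (h : Generic s) :
    2 ≤ mult (diag ρ) (hwMod ρ b .m27) (1, 1) := by
  have : FiniteDimensional K V := b.finiteDimensional_of_finite
  have two : qint s 2 ≠ 0 := h.qint_ne_zero (by norm_num) (by norm_num)
  have key := two_le_mult (generated_stable (diag ρ) (hwv s b .m27)) (mem_generated _ _)
    (he.wt_hwv .m27) (he.E_hwv .m27) (he.hwv_ne_zero h .m27) (p := 2) (r := 2) (by decide)
    (by decide) two two
  rw [show Summand.m27.weight - root 0 - root 1 = (1, 1) by decide] at key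
  -- [3]² - [2]² = [5].
  refine key fun e => h.five_ne ?_
  have hq := q_ne_zero s
  have h2 := h.q_sub_ne
  have h3 : qint s 3 = q s ^ 2 + 1 + (q s)⁻¹ ^ 2 := by
    rw [qint, zpow_neg, inv_mul_eq_iff_eq_mul₀ h2]
    simp only [zpow_ofNat]
    field_simp
    ring
  norm_num [qint_two h, h3] at e
  rw [← e]
  field_simp
  ring

theorem IsOctet.dim_octet_le (h : Generic s) {j : Summand} (hj : j.weight = (1, 1)) :
    8 ≤ Module.finrank K (hwMod ρ b j) := by
  have m0 := he.one_le_mult_weight h j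
  rw [hj] at m0
  have m1 := he.mult_hwMod_le h j 0 (c := (0, 1)) 1 (by decide) (by decide) (by decide)
    (by decide) m0
  have m2 := he.mult_hwMod_le h j 1 (c := (1, 0)) 1 (by decide) (by decide) (by decide)
    (by decide) m0
  have m3 := he.mult_hwMod_le h j 1 (c := (0, -1)) 2 (by decide) (by decide) (by decide)
    (by decide) m1
  have m4 := he.mult_hwMod_le h j 0 (c := (-1, 0)) 2 (by decide) (by decide) (by decide)
    (by decide) m2
  have m5 := he.mult_hwMod_le h j 0 (c := (-1, -1)) 1 (by decide) (by decide) (by decide)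
    (by decide) m3
  have m6 := he.two_le_mult_octet h hj
  refine le_trans (le_of_eq ?_) (le_finrank_of_mult ρ b h j
    {(1, 1), (0, 1), (1, 0), (0, -1), (-1, 0), (-1, -1), (0, 0)}
    (fun a => if a = (0, 0) then 2 else 1) (by decide) fun a ha => ?_)
  · decide
  simp only [Finset.mem_insert, Finset.mem_singleton] at ha
  obtain rfl | rfl | rfl | rfl | rfl | rfl | rfl := ha
  exacts [m0, m1, m2, m3, m4, m5, m6]

theorem IsOctet.dim_m10_le (h : Generic s) : 10 ≤ Module.finrank K (hwMod ρ b .m10) := by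
  have m0 := he.one_le_mult_weight h .m10
  rw [show Summand.m10.weight = (2, 1) from rfl] at m0
  have m1 := he.mult_hwMod_le h .m10 0 (c := (1, 1)) 1 (by decide) (by decide) (by decide)
    (by decide) m0
  have m2 := he.mult_hwMod_le h .m10 0 (c := (0, 1)) 2 (by decide) (by decide) (by decide)
    (by decide) m0
  have m3 := he.mult_hwMod_le h .m10 0 (c := (-1, 1)) 3 (by decide) (by decide) (by decide)
    (by decide) m0
  have m4 := he.mult_hwMod_le h .m10 1 (c := (1, 0)) 1 (by decide) (by decide) (by decide)
    (by decide) m1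
  have m5 := he.mult_hwMod_le h .m10 1 (c := (0, 0)) 1 (by decide) (by decide) (by decide)
    (by decide) m2
  have m6 := he.mult_hwMod_le h .m10 1 (c := (0, -1)) 2 (by decide) (by decide) (by decide)
    (by decide) m2
  have m7 := he.mult_hwMod_le h .m10 1 (c := (-1, 0)) 1 (by decide) (by decide) (by decide)
    (by decide) m3
  have m8 := he.mult_hwMod_le h .m10 1 (c := (-1, -1)) 2 (by decide) (by decide) (by decide)
    (by decide) m3
  have m9 := he.mult_hwMod_le h .m10 1 (c := (-1, -2)) 3 (by decide) (by decide) (by decide)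
    (by decide) m3
  refine le_trans (le_of_eq ?_) (le_finrank_of_mult ρ b h .m10
    {(2, 1), (1, 1), (0, 1), (-1, 1), (1, 0), (0, 0), (0, -1), (-1, 0), (-1, -1), (-1, -2)}
    (fun _ => 1) (by decide) fun a ha => ?_)
  · decide
  simp only [Finset.mem_insert, Finset.mem_singleton] at ha
  obtain rfl | rfl | rfl | rfl | rfl | rfl | rfl | rfl | rfl | rfl := ha
  exacts [m0, m1, m2, m3, m4, m5, m6, m7, m8, m9]

theorem IsOctet.dim_m10star_le (h : Generic s) :
    10 ≤ Module.finrank K (hwMod ρ b .m10star) := by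
  have m0 := he.one_le_mult_weight h .m10star
  rw [show Summand.m10star.weight = (1, 2) from rfl] at m0
  have m1 := he.mult_hwMod_le h .m10star 1 (c := (1, 1)) 1 (by decide) (by decide) (by decide)
    (by decide) m0
  have m2 := he.mult_hwMod_le h .m10star 1 (c := (1, 0)) 2 (by decide) (by decide) (by decide)
    (by decide) m0
  have m3 := he.mult_hwMod_le h .m10star 1 (c := (1, -1)) 3 (by decide) (by decide) (by decide)
    (by decide) m0
  have m4 := he.mult_hwMod_le h .m10star 0 (c := (0, 1)) 1 (by decide) (by decide) (by decide)
    (by decide) m1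
  have m5 := he.mult_hwMod_le h .m10star 0 (c := (0, 0)) 1 (by decide) (by decide) (by decide)
    (by decide) m2
  have m6 := he.mult_hwMod_le h .m10star 0 (c := (-1, 0)) 2 (by decide) (by decide) (by decide)
    (by decide) m2
  have m7 := he.mult_hwMod_le h .m10star 0 (c := (0, -1)) 1 (by decide) (by decide) (by decide)
    (by decide) m3
  have m8 := he.mult_hwMod_le h .m10star 0 (c := (-1, -1)) 2 (by decide) (by decide) (by decide)
    (by decide) m3
  have m9 := he.mult_hwMod_le h .m10star 0 (c := (-2, -1)) 3 (by decide) (by decide) (by decide)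
    (by decide) m3
  refine le_trans (le_of_eq ?_) (le_finrank_of_mult ρ b h .m10star
    {(1, 2), (1, 1), (1, 0), (1, -1), (0, 1), (0, 0), (-1, 0), (0, -1), (-1, -1), (-2, -1)}
    (fun _ => 1) (by decide) fun a ha => ?_)
  · decide
  simp only [Finset.mem_insert, Finset.mem_singleton] at ha
  obtain rfl | rfl | rfl | rfl | rfl | rfl | rfl | rfl | rfl | rfl := ha
  exacts [m0, m1, m2, m3, m4, m5, m6, m7, m8, m9]

/-- Twelve outer weights count once, the six roots twice and the zero weight three times: 12 + 12 +
3. -/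
theorem IsOctet.dim_m27_le (h : Generic s) : 27 ≤ Module.finrank K (hwMod ρ b .m27) := by
  have m0 := he.one_le_mult_weight h .m27
  rw [show Summand.m27.weight = (2, 2) from rfl] at m0
  have m1 := he.mult_hwMod_le h .m27 0 (c := (1, 2)) 1 (by decide) (by decide) (by decide)
    (by decide) m0
  have m2 := he.mult_hwMod_le h .m27 0 (c := (0, 2)) 2 (by decide) (by decide) (by decide)
    (by decide) m0
  have m3 := he.mult_hwMod_le h .m27 1 (c := (2, 1)) 1 (by decide) (by decide) (by decide)
    (by decide) m0
  have m4 := he.mult_hwMod_le h .m27 1 (c := (2, 0)) 2 (by decide) (by decide) (by decide)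
    (by decide) m0
  have m5 := he.mult_hwMod_le h .m27 1 (c := (1, -1)) 3 (by decide) (by decide) (by decide)
    (by decide) m1
  have m6 := he.mult_hwMod_le h .m27 1 (c := (0, -2)) 4 (by decide) (by decide) (by decide)
    (by decide) m2
  have m7 := he.mult_hwMod_le h .m27 0 (c := (-1, 1)) 3 (by decide) (by decide) (by decide)
    (by decide) m3
  have m8 := he.mult_hwMod_le h .m27 0 (c := (-2, 0)) 4 (by decide) (by decide) (by decide)
    (by decide) m4
  have m9 := he.mult_hwMod_le h .m27 0 (c := (-1, -2)) 1 (by decide) (by decide) (by decide)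
    (by decide) m6
  have m10 := he.mult_hwMod_le h .m27 0 (c := (-2, -2)) 2 (by decide) (by decide) (by decide)
    (by decide) m6
  have m11 := he.mult_hwMod_le h .m27 1 (c := (-2, -1)) 1 (by decide) (by decide) (by decide)
    (by decide) m8
  have l0 := he.two_le_mult_m27 h
  have l1 := he.mult_hwMod_le h .m27 0 (c := (0, 1)) 1 (by decide) (by decide) (by decide)
    (by decide) l0
  have l2 := he.mult_hwMod_le h .m27 1 (c := (1, 0)) 1 (by decide) (by decide) (by decide)
    (by decide) l0
  have l3 := he.mult_hwMod_le h .m27 1 (c := (0, -1)) 2 (by decide) (by decide) (by decide)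
    (by decide) l1
  have l4 := he.mult_hwMod_le h .m27 0 (c := (-1, 0)) 2 (by decide) (by decide) (by decide)
    (by decide) l2
  have l5 := he.mult_hwMod_le h .m27 0 (c := (-1, -1)) 1 (by decide) (by decide) (by decide)
    (by decide) l3
  have l6 := he.three_le_mult h (generated_stable (diag ρ) (hwv s b .m27)) (mem_generated _ _)
  have key := le_finrank_of_mult ρ b h .m27
    {(2, 2), (1, 2), (0, 2), (2, 1), (2, 0), (1, -1), (0, -2), (-1, 1), (-2, 0), (-1, -2),
      (-2, -2), (-2, -1), (1, 1), (0, 1), (1, 0), (0, -1), (-1, 0), (-1, -1), (0, 0)}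
    (fun a => if a = (0, 0) then 3 else if |a.1| ≤ 1 ∧ |a.2| ≤ 1 ∧ |a.1 - a.2| ≤ 1 then 2 else 1)
    (by decide) fun a ha => ?_
  · refine le_trans (le_of_eq ?_) key
    decide
  simp only [Finset.mem_insert, Finset.mem_singleton] at ha
  obtain rfl | rfl | rfl | rfl | rfl | rfl | rfl | rfl | rfl | rfl | rfl | rfl | rfl | rfl | rfl |
    rfl | rfl | rfl | rfl := ha
  exacts [m0, m1, m2, m3, m4, m5, m6, m7, m8, m9, m10, m11, l0, l1, l2, l3, l4, l5, l6]

theorem IsOctet.dim_le (h : Generic s) (j : Summand) :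
    j.dim ≤ Module.finrank K (hwMod ρ b j) := by
  cases j
  · exact he.dim_m27_le h
  · exact he.dim_m10_le h
  · exact he.dim_m10star_le h
  · exact he.dim_octet_le h rfl
  · exact he.dim_octet_le h rfl
  · exact le_finrank_of_mult ρ b h .m1 {(0, 0)} (fun _ => 1) (by decide) fun a ha => by
      rw [Finset.mem_singleton.1 ha]
      exact he.one_le_mult_weight h .m1

omit he in
theorem finrank_tensor (b : Module.Basis Ix K V) : Module.finrank K (V ⊗[K] V) = 64 := by
  have : Module.finrank K V = 8 := Module.finrank_eq_card_basis b
  rw [Module.finrank_tensorProduct, this]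

/-- Independence bounds the sum of the dimensions by 64, and the lower bounds already sum to 64. -/
theorem IsOctet.finrank_hwMod (h : Generic s) (j : Summand) :
    Module.finrank K (hwMod ρ b j) = j.dim := by
  have : FiniteDimensional K V := b.finiteDimensional_of_finite
  have key := sum_finrank_le (he.iSupIndep_hwMod h) (M := ⊤) fun _ => le_top
  rw [finrank_top, finrank_tensor b] at key
  refine le_antisymm ?_ (he.dim_le h j)
  have hs := Finset.sum_erase_add Finset.univ (fun i => Module.finrank K (hwMod ρ b i))
    (Finset.mem_univ j)
  have hle := Finset.sum_le_sum fun i (_ : i ∈ Finset.univ.erase j) => he.dim_le h i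
  have hd := Finset.sum_erase_add Finset.univ Summand.dim (Finset.mem_univ j)
  have : ∑ i, Summand.dim i = 64 := by decide
  omega

theorem IsOctet.isInternal_hwMod (h : Generic s) : DirectSum.IsInternal (hwMod ρ b) := by
  have : FiniteDimensional K V := b.finiteDimensional_of_finite
  refine DirectSum.isInternal_submodule_of_iSupIndep_of_iSup_eq_top (he.iSupIndep_hwMod h)
    (Submodule.eq_top_of_finrank_eq (le_antisymm (Submodule.finrank_le _) ?_))
  refine le_trans ?_ (sum_finrank_le (he.iSupIndep_hwMod h) fun i => le_iSup _ i)
  rw [finrank_tensor b, Finset.sum_congr rfl fun i _ => he.finrank_hwMod h i]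
  decide

end Octet

/-! ### Equivariance of `σ` -/

/-- The map `p ⊗ r ↦ ad p y ⊗ r`. -/
def actOn (s : Kˣ) (y : U s) : U s ⊗[K] U s →ₗ[K] U s ⊗[K] U s :=
  LinearMap.rTensor (U s) ((bracket s).flip y)

theorem actOn_tmul (s : Kˣ) (y p r : U s) : actOn s y (p ⊗ₜ r) = ad s p y ⊗ₜ[K] r := rfl

theorem sigmaBar_tmul (s : Kˣ) (x y : U s) : sigmaBar s (x ⊗ₜ y) = actOn s y (comul s x) := rfl

theorem sigma_tmul (s : Kˣ) (C x y : U s) :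
    sigma s C (x ⊗ₜ y) = actOn s y (comul s x) - ad s x y ⊗ₜ[K] C := rfl

theorem comul_ad_E (s : Kˣ) (i : Fin 2) (x : U s) : comul s (ad s (E s i) x)
    = comul s (E s i) * comul s x * comul s (t s (H i))
      - (q s)⁻¹ • (comul s (t s (H i)) * comul s x * comul s (E s i)) := by
  simp only [ad_E, map_sub, map_mul, map_smul]

theorem comul_ad_F (s : Kˣ) (i : Fin 2) (x : U s) : comul s (ad s (F s i) x)
    = comul s (F s i) * comul s x * comul s (t s (H i))
      - q s • (comul s (t s (H i)) * comul s x * comul s (F s i)) := by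
  simp only [ad_F, map_sub, map_mul, map_smul]

theorem comul_ad_t (s : Kˣ) (μ : Weight) (x : U s) : comul s (ad s (t s μ) x)
    = comul s (t s μ) * comul s x * comul s (t s (-μ)) := by
  rw [ad_t, map_mul, map_mul]

theorem rep_t_neg_E (s : Kˣ) (i : Fin 2) (y : U s) : ad s (t s (-H i)) (ad s (E s i) y)
    = (q s)⁻¹ • ad s (E s i) (ad s (t s (-H i)) y) := by
  have := congrArg (fun u => ad s u y) (t_E s (-H i) i)
  simp only [map_mul, Module.End.mul_apply, map_smul, LinearMap.smul_apply] at this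
  rw [this, Pi.neg_apply, H_same, zpow_neg, q, zpow_ofNat]

theorem rep_t_neg_F (s : Kˣ) (i : Fin 2) (y : U s) : ad s (t s (-H i)) (ad s (F s i) y)
    = q s • ad s (F s i) (ad s (t s (-H i)) y) := by
  have := congrArg (fun u => ad s u y) (t_F s (-H i) i)
  simp only [map_mul, Module.End.mul_apply, map_smul, LinearMap.smul_apply] at this
  rw [this, Pi.neg_apply, H_same, neg_neg, q, zpow_ofNat]

/-- The equivariance of `sigmaBar` under `E i`, with the coproduct of x replaced by an arbitrary
tensor d so that linearity reduces it to pure tensors. -/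
theorem actOn_E (s : Kˣ) (i : Fin 2) (y : U s) (d : U s ⊗[K] U s) :
    actOn s (ad s (t s (-H i)) y) (comul s (E s i) * d * comul s (t s (H i))
        - (q s)⁻¹ • (comul s (t s (H i)) * d * comul s (E s i)))
      + actOn s (ad s (E s i) y) (comul s (t s (H i)) * d * comul s (t s (-H i)))
      = diag (ad s) (E s i) (actOn s y d) := by
  induction d with
  | zero => simp
  | add d d' hd hd' =>
    rw [map_add, map_add, ← hd, ← hd']
    simp only [mul_add, add_mul, smul_add, map_add, map_sub]
    abel
  | tmul p r =>
    simp only [comul_E, comul_t, add_mul, mul_add, Algebra.TensorProduct.tmul_mul_tmul, map_add,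
      map_sub, map_smul, actOn_tmul, map_mul, Module.End.mul_apply, rep_t_neg, rep_t_neg_E,
      diag_E, ad_E s i r, ad_t s _ r, neg_neg, TensorProduct.tmul_sub, TensorProduct.tmul_smul,
      ← TensorProduct.smul_tmul', smul_add]
    abel

theorem actOn_F (s : Kˣ) (i : Fin 2) (y : U s) (d : U s ⊗[K] U s) :
    actOn s (ad s (t s (-H i)) y) (comul s (F s i) * d * comul s (t s (H i))
        - q s • (comul s (t s (H i)) * d * comul s (F s i)))
      + actOn s (ad s (F s i) y) (comul s (t s (H i)) * d * comul s (t s (-H i)))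
      = diag (ad s) (F s i) (actOn s y d) := by
  induction d with
  | zero => simp
  | add d d' hd hd' =>
    rw [map_add, map_add, ← hd, ← hd']
    simp only [mul_add, add_mul, smul_add, map_add, map_sub]
    abel
  | tmul p r =>
    simp only [comul_F, comul_t, add_mul, mul_add, Algebra.TensorProduct.tmul_mul_tmul, map_add,
      map_sub, map_smul, actOn_tmul, map_mul, Module.End.mul_apply, rep_t_neg, rep_t_neg_F,
      diag_F, ad_F s i r, ad_t s _ r, neg_neg, TensorProduct.tmul_sub, TensorProduct.tmul_smul,
      ← TensorProduct.smul_tmul', smul_add]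
    abel

theorem actOn_t (s : Kˣ) (μ : Weight) (y : U s) (d : U s ⊗[K] U s) :
    actOn s (ad s (t s μ) y) (comul s (t s μ) * d * comul s (t s (-μ)))
      = diag (ad s) (t s μ) (actOn s y d) := by
  induction d with
  | zero => simp
  | add d d' hd hd' => rw [map_add, map_add, ← hd, ← hd', mul_add, add_mul, map_add]
  | tmul p r =>
    simp only [comul_t, Algebra.TensorProduct.tmul_mul_tmul, actOn_tmul, map_mul,
      Module.End.mul_apply, rep_t_neg', diag_t, ad_t s _ r]

theorem sigmaBar_diag (s : Kˣ) (u : U s) (z : U s ⊗[K] U s) :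
    sigmaBar s (diag (ad s) u z) = diag (ad s) u (sigmaBar s z) := by
  refine commute_of_gens (diag (ad s)) (diag (ad s)) (sigmaBar s) ?_ ?_ ?_ u z
  · intro i z
    induction z with
    | zero => simp
    | add z z' hz hz' => simp only [map_add, hz, hz']
    | tmul x y =>
      rw [diag_E, map_add, sigmaBar_tmul, sigmaBar_tmul, sigmaBar_tmul, ← actOn_E, comul_ad_E,
        comul_ad_t]
  · intro i z
    induction z with
    | zero => simp
    | add z z' hz hz' => simp only [map_add, hz, hz']
    | tmul x y =>
      rw [diag_F, map_add, sigmaBar_tmul, sigmaBar_tmul, sigmaBar_tmul, ← actOn_F, comul_ad_F,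
        comul_ad_t]
  · intro μ z
    induction z with
    | zero => simp
    | add z z' hz hz' => simp only [map_add, hz, hz']
    | tmul x y =>
      rw [diag_t, sigmaBar_tmul, sigmaBar_tmul, ← actOn_t, comul_ad_t]

theorem bracket_diag (s : Kˣ) (u : U s) (z : U s ⊗[K] U s) :
    TensorProduct.lift (bracket s) (diag (ad s) u z)
      = ad s u (TensorProduct.lift (bracket s) z) := by
  have hb : ∀ x y, bracket s x y = ad s x y := fun _ _ => rfl
  refine commute_of_gens (diag (ad s)) (ad s) (TensorProduct.lift (bracket s)) ?_ ?_ ?_ u z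
  · intro i z
    induction z with
    | zero => simp
    | add z z' hz hz' => simp only [map_add, hz, hz']
    | tmul x y =>
      simp only [diag_E, map_add, TensorProduct.lift.tmul, hb, ad_E s i x, ad_t s _ x, map_sub,
        map_smul, map_mul, Module.End.mul_apply, LinearMap.sub_apply, LinearMap.smul_apply,
        rep_t_neg, rep_t_neg_E]
      abel
  · intro i z
    induction z with
    | zero => simp
    | add z z' hz hz' => simp only [map_add, hz, hz']
    | tmul x y =>
      simp only [diag_F, map_add, TensorProduct.lift.tmul, hb, ad_F s i x, ad_t s _ x, map_sub,
        map_smul, map_mul, Module.End.mul_apply, LinearMap.sub_apply, LinearMap.smul_apply,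
        rep_t_neg, rep_t_neg_F]
      abel
  · intro μ z
    induction z with
    | zero => simp
    | add z z' hz hz' => simp only [map_add, hz, hz']
    | tmul x y =>
      simp only [diag_t, TensorProduct.lift.tmul, hb, ad_t s _ x, map_mul, Module.End.mul_apply,
        rep_t_neg']

/-- Tensoring with the trivial representation changes nothing; this makes the correction term of σ
equivariant. -/
theorem tmul_diag {s : Kˣ} {C : U s} (hC : ∀ u, ad s u C = counit s u • C) (u w : U s) :
    ad s u w ⊗ₜ[K] C = diag (ad s) u (w ⊗ₜ[K] C) := by
  refine commute_of_gens (ad s) (diag (ad s)) ((TensorProduct.mk K (U s) (U s)).flip C)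
    ?_ ?_ ?_ u w
  · intro i x
    simp [diag_E, hC]
  · intro i x
    simp [diag_F, hC]
  · intro μ x
    simp [diag_t, hC]

theorem sigma_diag {s : Kˣ} {C : U s} (hC : ∀ u, ad s u C = counit s u • C) (u : U s)
    (z : U s ⊗[K] U s) : sigma s C (diag (ad s) u z) = diag (ad s) u (sigma s C z) := by
  simp only [sigma, LinearMap.sub_apply, LinearMap.comp_apply, LinearMap.flip_apply,
    TensorProduct.mk_apply, sigmaBar_diag, bracket_diag, map_sub, tmul_diag hC]

/-! ### The explicit value of σ on X1 ⊗ y. -/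

theorem comul_X1 {s : Kˣ} (h : Generic s) :
    comul s (X1 s) = X1 s ⊗ₜ K0 s + t s ![0, -2] ⊗ₜ X1 s := by
  have e : X1 s = t s ![-2, -1] * E s 0 := by
    rw [X1, ad_E0_K0, smul_smul]
    convert one_smul K _
    rw [zpow_neg, zpow_ofNat]
    exact inv_mul_cancel₀ h.q_sub_ne
  have h1 : ![-2, -1] + -H 0 = ![-4, 0] := by decide
  have h2 : ![-2, -1] + H 0 = ![0, -2] := by decide
  rw [e, map_mul, comul_t, comul_E, mul_add, Algebra.TensorProduct.tmul_mul_tmul,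
    Algebra.TensorProduct.tmul_mul_tmul, t_mul, t_mul, h1, h2, K0]

/-- In the coproduct of `X1` only the second leg `K0` lies outside L. The term [x, y] ⊗ C corrects
exactly this, replacing `K0` by `K0 - C0 = kap`. -/
theorem sigma_X1 {s : Kˣ} (h : Generic s) (y : U s) : sigma s (C0 s) (X1 s ⊗ₜ y)
    = ad s (X1 s) y ⊗ₜ kap s + ad s (t s ![0, -2]) y ⊗ₜ X1 s := by
  rw [sigma_tmul, comul_X1 h, map_add, actOn_tmul, actOn_tmul, C0, TensorProduct.tmul_sub]
  abel

/-! ### Eigenvalues of a braiding on the tensor square of the octet -/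

/-- The eigenvalues of `σ`. -/
def eig (s : Kˣ) : Summand → K
  | .m27 => 1
  | .m10 => -(q s)⁻¹ ^ 2
  | .m10star => -q s ^ 2
  | .m8a => 1 - q s ^ 2 - (q s)⁻¹ ^ 2
  | .m8s => 1
  | .m1 => 1

section Octet

variable {s : Kˣ} {V : Type*} [AddCommGroup V] [Module K V] {ρ : U s →ₐ[K] Module.End K V}
  {b : Module.Basis Ix K V} (he : IsOctet ρ b) {S : Module.End K (V ⊗[K] V)}
  (hS : ∀ u z, S (diag ρ u z) = diag ρ u (S z))
include he

/-- No `F i` has an image with component along `b .p12`, so only the term of Δ(F i) with q^(-H i) on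
the right contributes, and q^(-H i) scales `b .p12` by s⁻¹. -/
theorem IsOctet.slot_diag_F (i : Fin 2) (z : V ⊗[K] V) :
    slot b .p12 (diag ρ (F s i) z) = (s : K)⁻¹ • ρ (F s i) (slot b .p12 z) := by
  have ht := he.repr_t (-H i)
  have hF : ∀ y, b.repr (ρ (F s i) y) .p12 = 0 := by
    intro y
    have : b.coord .p12 ∘ₗ ρ (F s i) = 0 := by
      refine b.ext fun c => ?_
      fin_cases i
      · cases c <;> simp [he.F0, tabF0]
      · cases c <;> simp [he.F1, tabF1]
    exact LinearMap.congr_fun this y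
  induction z with
  | zero => simp
  | add x y hx hy => simp only [map_add, hx, hy, smul_add]
  | tmul x y =>
    have : Ix.p12.wt.1 * (-H i) 0 + Ix.p12.wt.2 * (-H i) 1 = -1 := by
      clear hF ht
      revert i
      decide
    rw [diag_F, map_add, slot_tmul, slot_tmul, slot_tmul, hF, zero_smul, add_zero, ht, this,
      zpow_neg_one, map_smul, smul_smul]

include hS

/-- Equivariance under `F i` solved for one term: a recursion that lowers the first tensor factor
and computes top slots of S from known ones. -/
theorem IsOctet.slot_F_step (i : Fin 2) {a : ℤ × ℤ} {x : V} (hx : IsWt ρ a x) (c : Ix) :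
    slot b .p12 (S (ρ (F s i) x ⊗ₜ b c)) = (s : K) ^ pair i c.wt •
      ((s : K)⁻¹ • ρ (F s i) (slot b .p12 (S (x ⊗ₜ b c)))
        - (s : K) ^ pair i a • slot b .p12 (S (x ⊗ₜ ρ (F s i) (b c)))) := by
  have key := he.slot_diag_F i (S (x ⊗ₜ b c))
  rw [← hS, diag_F, (he.wt c).t_neg_H, hx.tH, TensorProduct.tmul_smul, ← TensorProduct.smul_tmul',
    map_add, map_smul, map_smul, map_add, map_smul, map_smul] at key
  rw [← key, add_sub_cancel_right, smul_smul, ← zpow_add₀ s.ne_zero, add_neg_cancel, zpow_zero,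
    one_smul]

variable {k : V} {B : V → V} (hk : b.repr (ρ (E s 1) k) .p12 = 0) (hk' : b.repr k .p12 = 0)
  (hS1 : ∀ y, S (b .p1 ⊗ₜ y) = B y ⊗ₜ k + ρ (t s ![0, -2]) y ⊗ₜ b .p1)
include hS1 hk'

-- `hS1` is the shape of `sigma_X1`, with k in the role of `kap`; neither k nor `b .p1` has a
-- component along `b .p12`.
omit he hS in
theorem slot_p1 (y : V) : slot b .p12 (S (b .p1 ⊗ₜ y)) = 0 := by
  rw [hS1, map_add, slot_tmul, slot_tmul, hk']
  simp

theorem IsOctet.slot_T1 (c : Ix) : slot b .p12 (S (b .T1 ⊗ₜ b c)) = 0 := by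
  have := he.slot_F_step hS 0 (he.wt .p1) c
  rwa [he.F0, tabF0, slot_p1 hk' hS1, slot_p1 hk' hS1, map_zero, smul_zero, smul_zero,
    sub_zero, smul_zero] at this

theorem IsOctet.slot_T1' (y : V) : slot b .p12 (S (b .T1 ⊗ₜ y)) = 0 := by
  have : slot b .p12 ∘ₗ S ∘ₗ TensorProduct.mk K V V (b .T1) = 0 :=
    b.ext fun c => he.slot_T1 hS hk' hS1 c
  exact LinearMap.congr_fun this y

theorem IsOctet.slot_m2 (c : Ix) : slot b .p12 (S (b .m2 ⊗ₜ b c)) = 0 := by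
  have := he.slot_F_step hS 1 (he.wt .T1) c
  rwa [he.F1, tabF1, he.slot_T1' hS hk' hS1, he.slot_T1' hS hk' hS1, map_zero, smul_zero,
    smul_zero, sub_zero, smul_zero] at this

theorem IsOctet.slot_m1 (h : Generic s) (y : V) : slot b .p12 (S (b .m1 ⊗ₜ y)) = 0 := by
  have : slot b .p12 ∘ₗ S ∘ₗ TensorProduct.mk K V V (b .m1) = 0 := by
    refine b.ext fun c => ?_
    have := he.slot_F_step hS 0 (he.wt .T1) c
    rw [he.F0, tabF0, he.slot_T1' hS hk' hS1, he.slot_T1' hS hk' hS1, map_zero, smul_zero,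
      smul_zero, sub_zero, smul_zero, ← TensorProduct.smul_tmul', map_smul, map_smul,
      smul_eq_zero] at this
    exact this.resolve_left h.two_ne
  exact LinearMap.congr_fun this y

theorem IsOctet.slot_m12 (h : Generic s) (c : Ix) : slot b .p12 (S (b .m12 ⊗ₜ b c)) = 0 := by
  have := he.slot_F_step hS 1 (he.wt .m1) c
  rwa [he.F1, tabF1, he.slot_m1 hS hk' hS1 h, he.slot_m1 hS hk' hS1 h, map_zero, smul_zero,
    smul_zero, sub_zero, smul_zero] at this

include hk

/-- Apply `E 1` to `b .p1 ⊗ b c`. On the right of `hS1` the only contribution along `b .p12` comes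
from `E 1` raising the last factor `b .p1`. -/
theorem IsOctet.slot_p12 (c : Ix) :
    slot b .p12 (S (b .p12 ⊗ₜ b c)) = (s : K) ^ (2 * c.wt.2 - 2 * c.wt.1) • b c := by
  have hz := congrArg (slot b .p12) (hS (E s 1) (b .p1 ⊗ₜ b c))
  rw [hS1, he.diag_E1, map_add, map_add, map_smul, map_smul, map_add, map_smul, map_smul,
    tabE1, slot_p1 hk' hS1, smul_zero, add_zero, diag_E, map_add, map_add (slot b .p12),
    slot_tmul, slot_tmul, hk,
    zero_smul, add_zero, he.repr_t, hk', mul_zero, zero_smul, zero_add,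
    diag_E, map_add, slot_tmul, slot_tmul, he.repr_t, he.E1, tabE1, b.repr_self, b.repr_self,
    he.wt c, map_smul, map_smul, (he.wt c).tH] at hz
  simp only [Finsupp.single_apply, reduceCtorEq, if_false, if_true, mul_zero, smul_smul, zero_mul,
    one_mul, zero_smul, zero_add, ← zpow_add₀ s.ne_zero] at hz
  rw [← one_smul K (slot b .p12 _), ← zpow_zero (s : K), ← add_neg_cancel (pair 1 c.wt),
    zpow_add₀ s.ne_zero, mul_smul, hz, smul_smul, ← zpow_add₀ s.ne_zero]
  congr 2
  simp [pair]
  ring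

theorem IsOctet.slot_p2 (c : Ix) : slot b .p12 (S (b .p2 ⊗ₜ b c))
    = ((s : K) ^ (c.wt.2 - 1) - (s : K) ^ (c.wt.2 + 3)) • tabF0 s b c := by
  have hs := s.ne_zero
  have key := he.slot_F_step hS 0 (he.wt .p12) c
  rw [he.F0, tabF0, he.slot_p12 hS hk hk' hS1, map_smul, he.F0] at key
  rw [key]
  cases c <;>
    simp only [tabF0, TensorProduct.tmul_zero, map_zero, smul_zero, TensorProduct.tmul_smul,
      map_smul, he.slot_p12 hS hk hk' hS1, Ix.wt, pair, if_true, Int.reduceMul, Int.reduceSub,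
      Int.reduceNeg, Int.reduceAdd, sub_zero, zpow_neg, zpow_ofNat (s : K) 2,
      zpow_ofNat (s : K) 3, zpow_ofNat (s : K) 4, zpow_one, zpow_zero, mul_zero,
      mul_one, zero_sub, zero_add, sub_self] <;>
    match_scalars <;> field_simp <;> ring

theorem IsOctet.slot_T2 (c : Ix) : slot b .p12 (S (b .T2 ⊗ₜ b c))
    = (s : K) ^ pair 1 c.wt • (((s : K)⁻¹ * ((s : K) ^ (c.wt.2 - 1) - (s : K) ^ (c.wt.2 + 3))) •
        ρ (F s 1) (tabF0 s b c) - (s : K) ^ (2 : ℤ) • slot b .p12 (S (b .p2 ⊗ₜ tabF1 s b c))) := by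
  have key := he.slot_F_step hS 1 (he.wt .p2) c
  rw [he.F1, tabF1, he.slot_p2 hS hk hk' hS1, map_smul, smul_smul, he.F1] at key
  exact key

/-- The difference of the two sides is again killed by the `E j`, so it vanishes once its top slot
does, and top slots of S are known on all the tensors involved. -/
theorem IsOctet.braiding_hwv (h : Generic s) (i : Summand) :
    S (hwv s b i) = eig s i • hwv s b i := by
  have hs := s.ne_zero
  rw [← sub_eq_zero]
  refine he.eq_zero_of_slot h (fun j => ?_) ?_
  · rw [map_sub, map_smul, ← hS, he.E_hwv, map_zero, smul_zero, sub_zero]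
  cases i <;>
    simp only [hwv, qh, q, eig, TensorProduct.add_tmul,
      TensorProduct.tmul_add, TensorProduct.sub_tmul, TensorProduct.tmul_sub,
      ← TensorProduct.smul_tmul', TensorProduct.tmul_smul, map_add, map_sub, map_smul,
      slot_p1 hk' hS1, he.slot_T1' hS hk' hS1, he.slot_m2 hS hk' hS1, he.slot_m1 hS hk' hS1 h,
      he.slot_m12 hS hk' hS1 h, he.slot_p12 hS hk hk' hS1, he.slot_p2 hS hk hk' hS1,
      he.slot_T2 hS hk hk' hS1, slot_tmul, b.repr_self, Finsupp.single_apply, reduceCtorEq,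
      he.F1, tabF0, tabF1, pair, Ix.wt,
      smul_zero, add_zero, zero_add, sub_zero, zero_sub, if_true, zero_smul, one_smul,
      one_ne_zero, if_false, zpow_neg, zpow_ofNat (s : K) 2, zpow_ofNat (s : K) 3,
      zpow_ofNat (s : K) 4, zpow_ofNat (s : K) 5, zpow_one, zpow_zero, Int.reduceMul,
      Int.reduceSub, Int.reduceNeg, Int.reduceAdd, mul_zero, mul_one, sub_self] <;>
    match_scalars <;> field_simp <;> ring

end Octet

/-! ### Projectors -/

theorem projector_of_mem {ι V : Type*} [DecidableEq ι] [AddCommMonoid V] [Module K V]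
    {M : ι → Submodule K V} (hM : DirectSum.IsInternal M) {i : ι} {x : V} (hx : x ∈ M i) :
    projector M hM i x = x :=
  congrArg Subtype.val (hM.ofBijective_coeLinearMap_of_mem hx)

theorem projector_of_mem_ne {ι V : Type*} [DecidableEq ι] [AddCommMonoid V] [Module K V]
    {M : ι → Submodule K V} (hM : DirectSum.IsInternal M) {i j : ι} (hij : i ≠ j) {x : V}
    (hx : x ∈ M i) : projector M hM j x = 0 :=
  congrArg Subtype.val (hM.ofBijective_coeLinearMap_of_mem_ne hij hx)

/-! ### `σ` on the quantum Lie algebra -/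

theorem incl_injective (s : Kˣ) (L : Submodule K (U s)) : Function.Injective (incl s L) :=
  TensorProduct.map_injective_of_flat_flat _ _ L.subtype_injective L.subtype_injective

theorem incl_diag {s : Kˣ} {L : Submodule K (U s)} (hL : ∀ u, ∀ x ∈ L, ad s u x ∈ L) (u : U s)
    (z : L ⊗[K] L) : incl s L (diag (adOn s L hL) u z) = diag (ad s) u (incl s L z) := by
  refine commute_of_gens (diag (adOn s L hL)) (diag (ad s)) (incl s L) ?_ ?_ ?_ u z
  · intro i z
    induction z with
    | zero => simp
    | add z z' hz hz' => simp only [map_add, hz, hz']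
    | tmul x y =>
      simp only [diag_E, map_add, incl, TensorProduct.map_tmul, Submodule.subtype_apply, adOn_coe]
  · intro i z
    induction z with
    | zero => simp
    | add z z' hz hz' => simp only [map_add, hz, hz']
    | tmul x y =>
      simp only [diag_F, map_add, incl, TensorProduct.map_tmul, Submodule.subtype_apply, adOn_coe]
  · intro μ z
    induction z with
    | zero => simp
    | add z z' hz hz' => simp only [map_add, hz, hz']
    | tmul x y =>
      simp only [diag_t, incl, TensorProduct.map_tmul, Submodule.subtype_apply, adOn_coe]

/-- The elements `x` such that `σ` maps `x ⊗ L` to `L ⊗ L`. -/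
def braided (s : Kˣ) (C : U s) (L : Submodule K (U s)) : Submodule K (U s) where
  carrier := {x | ∀ y ∈ L, sigma s C (x ⊗ₜ y) ∈ LinearMap.range (incl s L)}
  add_mem' hx hx' y hy := by
    rw [TensorProduct.add_tmul, map_add]
    exact Submodule.add_mem _ (hx y hy) (hx' y hy)
  zero_mem' y _ := by
    rw [TensorProduct.zero_tmul, map_zero]
    exact Submodule.zero_mem _
  smul_mem' c x hx y hy := by
    rw [← TensorProduct.smul_tmul', map_smul]
    exact Submodule.smul_mem _ _ (hx y hy)

/-- Applying `E i` to σ(x ⊗ q^(H i) y) produces σ(E i x ⊗ y) plus σ of q^(H i) x ⊗ E i q^(H i) y.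
The second term is in L ⊗ L by the case of q^μ, hence so is the first; likewise for `F i`. -/
theorem braided_stable {s : Kˣ} {C : U s} (hC : ∀ u, ad s u C = counit s u • C)
    {L : Submodule K (U s)} (hL : ∀ u, ∀ x ∈ L, ad s u x ∈ L) (u : U s) :
    ∀ x ∈ braided s C L, ad s u x ∈ braided s C L := by
  have hr : ∀ u, ∀ z ∈ LinearMap.range (incl s L),
      diag (ad s) u z ∈ LinearMap.range (incl s L) := by
    rintro u _ ⟨z, rfl⟩
    exact ⟨_, incl_diag hL u z⟩
  have ht : ∀ μ, ∀ x ∈ braided s C L, ad s (t s μ) x ∈ braided s C L := by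
    intro μ x hx y hy
    have := hr (t s μ) _ (hx _ (hL (t s (-μ)) y hy))
    rwa [← sigma_diag hC, diag_t, rep_t_neg] at this
  refine stable_of_gens (ad s) ?_ ?_ ht u
  · intro i x hx y hy
    have hy' := hL (t s (H i)) y hy
    have h1 := hr (E s i) _ (hx _ hy')
    have h2 := ht (H i) x hx _ (hL (E s i) _ hy')
    rw [← sigma_diag hC, diag_E, rep_t_neg', map_add] at h1
    exact (Submodule.add_mem_iff_left _ h2).1 h1
  · intro i x hx y hy
    have hy' := hL (t s (H i)) y hy
    have h1 := hr (F s i) _ (hx _ hy')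
    have h2 := ht (H i) x hx _ (hL (F s i) _ hy')
    rw [← sigma_diag hC, diag_F, rep_t_neg', map_add] at h1
    exact (Submodule.add_mem_iff_left _ h2).1 h1

theorem L0_le_braided {s : Kˣ} (h : Generic s) : L0 s ≤ braided s (C0 s) (L0 s) := by
  have hst := braided_stable (ad_C0 h) (ad_mem_L0 h)
  have h1 : X1 s ∈ braided s (C0 s) (L0 s) := by
    intro y hy
    rw [sigma_X1 h]
    exact Submodule.add_mem _
      ⟨⟨_, ad_mem_L0 h _ _ hy⟩ ⊗ₜ ⟨_, kap_mem s⟩, rfl⟩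
      ⟨⟨_, ad_mem_L0 h _ _ hy⟩ ⊗ₜ ⟨_, X_mem s .p1⟩, rfl⟩
  refine L0_le hst h1 ?_
  have hX := isOctet_X h
  -- `F 0` applied twice to `X1` gives [2] times `Xm1`, so `Xm1` needs no formula of its own.
  have := hst (F s 0) _ (hst (F s 0) _ h1)
  rw [show X1 s = X s .p1 from rfl, hX.F0, tabF0, hX.F0, tabF0] at this
  rwa [Submodule.smul_mem_iff _ h.two_ne] at this

theorem sigma_mem_range {s : Kˣ} (h : Generic s) (z : L0 s ⊗[K] L0 s) :
    sigma s (C0 s) (incl s (L0 s) z) ∈ LinearMap.range (incl s (L0 s)) := by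
  induction z with
  | zero => simp
  | add z z' hz hz' =>
    rw [map_add, map_add]
    exact Submodule.add_mem _ hz hz'
  | tmul x y => exact L0_le_braided h x.2 y y.2

/-- The restriction of `σ` to the tensor square of the quantum Lie algebra. -/
def sigmaL {s : Kˣ} (h : Generic s) : Module.End K (L0 s ⊗[K] L0 s) :=
  (LinearEquiv.ofInjective (incl s (L0 s)) (incl_injective s _)).symm.toLinearMap ∘ₗ
    (sigma s (C0 s) ∘ₗ incl s (L0 s)).codRestrict _ (sigma_mem_range h)

theorem incl_sigmaL {s : Kˣ} (h : Generic s) (z : L0 s ⊗[K] L0 s) :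
    incl s (L0 s) (sigmaL h z) = sigma s (C0 s) (incl s (L0 s) z) :=
  LinearEquiv.ofInjective_symm_apply (f := incl s (L0 s))
    (h := incl_injective s _) ⟨_, sigma_mem_range h z⟩

theorem sigmaL_diag {s : Kˣ} (h : Generic s) (u : U s) (z : L0 s ⊗[K] L0 s) :
    sigmaL h (diag (adOn s (L0 s) (ad_mem_L0 h)) u z)
      = diag (adOn s (L0 s) (ad_mem_L0 h)) u (sigmaL h z) := by
  apply incl_injective
  rw [incl_sigmaL, incl_diag, incl_diag, incl_sigmaL, sigma_diag (ad_C0 h)]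

theorem sigmaL_hwv {s : Kˣ} (h : Generic s) (i : Summand) :
    sigmaL h (hwv s (basisL0 h) i) = eig s i • hwv s (basisL0 h) i := by
  have he := isOctet_basisL0 h
  set c := (q s ^ 2 + 1 + (q s)⁻¹ ^ 2)⁻¹ * (q s - (q s)⁻¹)
  have ek : (⟨kap s, kap_mem s⟩ : L0 s)
      = c • ((q s + (q s)⁻¹) • basisL0 h .T1 - basisL0 h .T2) := by
    apply Subtype.ext
    simp [kap, X, c]
  refine he.braiding_hwv (sigmaL_diag h) (k := ⟨kap s, kap_mem s⟩)
    (B := fun y => adOn s (L0 s) (ad_mem_L0 h) (X1 s) y) ?_ ?_ ?_ h i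
  · rw [ek]
    simp [he.E1, tabE1]
  · rw [ek]
    simp
  · intro y
    apply incl_injective
    rw [incl_sigmaL, map_add]
    simp only [incl, TensorProduct.map_tmul, Submodule.subtype_apply, coe_basisL0, adOn_coe]
    exact sigma_X1 h _

theorem sigmaL_of_mem {s : Kˣ} (h : Generic s) (i : Summand) {x : L0 s ⊗[K] L0 s}
    (hx : x ∈ hwMod (adOn s (L0 s) (ad_mem_L0 h)) (basisL0 h) i) :
    sigmaL h x = eig s i • x := by
  obtain ⟨u, rfl⟩ := hx
  change sigmaL h (diag _ u _) = _ • diag _ u _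
  rw [sigmaL_diag, sigmaL_hwv, map_smul]

/-- On each summand σ is the scalar `eig`, and 1 minus `eig` is q² + 1, q² + q⁻², 1 + q⁻² on
`m10star`, `m8a`, `m10` and zero elsewhere. -/
theorem isAntisymmetriser_L0 {s : Kˣ} (h : Generic s)
    (hM : DirectSum.IsInternal (hwMod (adOn s (L0 s) (ad_mem_L0 h)) (basisL0 h))) :
    IsAntisymmetriser s (C0 s) (L0 s) ((q s ^ 2 - 1 + (q s)⁻¹ ^ 2)⁻¹ •
      ((q s ^ 2 + 1) • projector _ hM .m10star + (q s ^ 2 + (q s)⁻¹ ^ 2) • projector _ hM .m8a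
        + (1 + (q s)⁻¹ ^ 2) • projector _ hM .m10)) := by
  intro x
  rw [← incl_sigmaL h, ← map_sub, ← map_smul]
  congr 1
  have hx : x ∈ ⨆ i, hwMod (adOn s (L0 s) (ad_mem_L0 h)) (basisL0 h) i := by
    rw [hM.submodule_iSup_eq_top]
    trivial
  induction hx using Submodule.iSup_induction' with
  | zero => simp
  | add x y _ _ hx hy => rw [map_add, map_add, hx, hy]; module
  | mem i x hx =>
    rw [sigmaL_of_mem h i hx]
    simp only [LinearMap.smul_apply, LinearMap.add_apply]
    congr 1
    cases i
    case m10star =>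
      rw [projector_of_mem hM hx, projector_of_mem_ne hM (by decide) hx,
        projector_of_mem_ne hM (by decide) hx, eig]
      module
    case m8a =>
      rw [projector_of_mem hM hx, projector_of_mem_ne hM (by decide) hx,
        projector_of_mem_ne hM (by decide) hx, eig]
      module
    case m10 =>
      rw [projector_of_mem hM hx, projector_of_mem_ne hM (by decide) hx,
        projector_of_mem_ne hM (by decide) hx, eig]
      module
    all_goals
      rw [projector_of_mem_ne hM (by decide) hx, projector_of_mem_ne hM (by decide) hx,
        projector_of_mem_ne hM (by decide) hx, eig]
      module

theorem incl_hwv {s : Kˣ} (h : Generic s) (i : Summand) :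
    incl s (L0 s) (hwv s (basisL0 h) i) = W s i := by
  rw [← hwv_X]
  cases i <;>
    simp only [hwv, incl, map_add, map_sub, map_smul, TensorProduct.map_tmul,
      Submodule.subtype_apply, coe_basisL0]

end Sl3q

end


/-! ### Assembly: uniqueness of the pair reduces everything to `C0` and `L0`. -/

open scoped TensorProduct in
theorem mainTheorem6 {K : Type*} [Field K] (s : Kˣ)
    (h8 : Sl3q.q s ^ 8 ≠ 1) (h10 : Sl3q.q s ^ 10 ≠ 1) (h12 : Sl3q.q s ^ 12 ≠ 1) :
    (∃ C L, Sl3q.IsQuantumLie s C L) ∧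
    ∀ (C : Sl3q.U s) (L : Submodule K (Sl3q.U s)) (hL : Sl3q.IsQuantumLie s C L),
      Module.finrank K L = 8 ∧
      ∃ w : Sl3q.Summand → L ⊗[K] L,
        (∀ i, Sl3q.incl s L (w i) = Sl3q.W s i) ∧
        (∀ i j, Sl3q.adTensor s L hL.ad_mem (Sl3q.E s j) (w i) = 0) ∧
        (∀ i μ, Sl3q.adTensor s L hL.ad_mem (Sl3q.t s μ) (w i)
          = (s : K) ^ (i.weight.1 * μ 0 + i.weight.2 * μ 1) • w i) ∧
        (∀ i, Module.finrank K (Sl3q.M s L hL.ad_mem w i) = i.dim) ∧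
        (∀ i, Sl3q.IsSimpleSub (Sl3q.adTensor s L hL.ad_mem) (Sl3q.M s L hL.ad_mem w i)) ∧
        ∃ hM : DirectSum.IsInternal (Sl3q.M s L hL.ad_mem w),
          Sl3q.IsAntisymmetriser s C L
            ((Sl3q.q s ^ 2 - 1 + (Sl3q.q s)⁻¹ ^ 2)⁻¹ •
              ((Sl3q.q s ^ 2 + 1) • Sl3q.projector (Sl3q.M s L hL.ad_mem w) hM .m10star
                + (Sl3q.q s ^ 2 + (Sl3q.q s)⁻¹ ^ 2) •
                  Sl3q.projector (Sl3q.M s L hL.ad_mem w) hM .m8a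
                + (1 + (Sl3q.q s)⁻¹ ^ 2) •
                  Sl3q.projector (Sl3q.M s L hL.ad_mem w) hM .m10)) := by
  have h : Sl3q.Generic s := ⟨h8, h10, h12⟩
  refine ⟨⟨_, _, Sl3q.isQuantumLie_L0 h⟩, fun C L hL => ?_⟩
  obtain ⟨rfl, rfl⟩ := hL.unique h
  have he := Sl3q.isOctet_basisL0 h
  exact ⟨Sl3q.finrank_L0 h, Sl3q.hwv s (Sl3q.basisL0 h), Sl3q.incl_hwv h, he.E_hwv, he.wt_hwv,
    he.finrank_hwMod h, he.isSimpleSub h, he.isInternal_hwMod h,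
    Sl3q.isAntisymmetriser_L0 h (he.isInternal_hwMod h)⟩
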